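/- **Definitions.** A polytope is the convex hull of a nonempty finite set of points of some $\mathbb R^d$, and $V(P)$ is the set of vertices of $P$. Two polytopes are affinely isomorphic if an affine map of the ambient spaces maps one bijectively onto the other. If $v_1,\dots,v_n$ are the vertices of $P$ (each listed once) and $P=\{x\in\mathbb R^d : Ax\le b,\ A^{=}x=b^{=}\}$ with $A\in\mathbb R^{m\times d}$, then the matrix $S\in\mathbb R^{m\times n}$ with $S_{i,j}=b_i-A_iv_j$ is called a slack matrix of $P$. Let $k\ge 1$, and fix $k-1$ coordinates $x_1,\dots,x_{k-1}$ of the ambient space of a polytope $P_1\subseteq\mathbb R^{d_1}$ and $k-1$ coordinates $y_1,\dots,y_{k-1}$ of the ambient space of a polytope $P_2\subseteq\mathbb R^{d_2}$. The glued product of $P_1$ and $P_2$ is $$P_1\times_k P_2=\operatorname{conv}\{(x,y): x\in V(P_1),\ y\in V(P_2),\ x_i=y_i \text{ for } 1\le i\le k-1\}.$$ It is simplicial if the projection of $P_1$ to $x_1,\dots,x_{k-1}$ is $\operatorname{conv}\{\mathbf 0,e_1,\dots,e_{k-1}\}$, every vertex of $P_1$ has $x_i\in\{0,1\}$ for all $i$,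 each inequality $x_i\ge 0$ is facet-defining for $P_1$, and the same holds for $P_2$ and $y_1,\dots,y_{k-1}$. The factors $P_1,P_2$ are always required to have dimension at least $1$. The product is called proper if neither $P_1$ nor $P_2$ is a $(k-1)$-dimensional simplex. An algorithm is a random access program over the reals with exact unit-cost operations $+,-,\times,/$ and comparisons on reals, with the constants $0,1$, and with natural-number indices that can be added, subtracted and compared; its running time is the number of operations. **Theorem.** Let $k\ge 1$ be a constant. (a) There is an algorithm which, given a slack matrix $S\in\mathbb R^{m\times n}$ of a polytope $P$, runs in time polynomial in $m$ and $n$ and correctly determines whether $P$ is affinely isomorphic to a simplicial glued product $P_1\times_k P_2$; if it is, the algorithm outputs two matrices $S_1,S_2$ such that, for some simplicial glued product $P_1\times_kP_2$ affinely isomorphic to $P$, $S_i$ is a slack matrix of $P_i$ for $i=1,2$. (b) There is also such an algorithm for proper simplicial glued products (in the decision and in the output). (c) In particular there is such an algorithm that determines whether $P$ is affinely isomorphic to a Cartesian product $P_1\times P_2$ of two polytopes of dimension at least $1$ and, if so, outputs slack matrices of such $P_1$ and $P_2$. -/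

import Mathlib

open Set

/-! ### Polytopes, slack matrices, glued products -/

namespace GluedProduct

/-- The dimension of a set of points: the dimension of its affine hull. -/
noncomputable def dim {E : Type*} [AddCommGroup E] [Module ℝ E] (P : Set E) : ℕ :=
  Module.finrank ℝ (vectorSpan ℝ P)

/-- A (nonempty) polytope: the convex hull of a nonempty finite set of points. -/
def IsPolytope {E : Type*} [AddCommGroup E] [Module ℝ E] (P : Set E) : Prop :=
  ∃ V : Set E, V.Finite ∧ V.Nonempty ∧ P = convexHull ℝ V

/-- `P` is an `r`-dimensional simplex. -/
def IsSimplex {E : Type*} [AddCommGroup E] [Module ℝ E] (r : ℕ) (P : Set E) : Prop :=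
  ∃ s : Affine.Simplex ℝ E r, P = convexHull ℝ (range s.points)

/-- `P` and `Q` are affinely isomorphic: an affine map of the ambient spaces maps `P`
bijectively onto `Q`. -/
def AffinelyIsomorphic {E F : Type*} [AddCommGroup E] [Module ℝ E] [AddCommGroup F] [Module ℝ F]
    (P : Set E) (Q : Set F) : Prop :=
  ∃ f : E →ᵃ[ℝ] F, BijOn f P Q

/-- `S` is a slack matrix of the polytope `P ⊆ ℝ^d`: there are a list `v` of the vertices of `P`
(each listed once) and a description `P = {x | A x ≤ b, A' x = b'}` such that
`S i j = b i - (A v_j) i`. -/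
def IsSlackMatrix {m n d : ℕ} (S : Matrix (Fin m) (Fin n) ℝ) (P : Set (Fin d → ℝ)) : Prop :=
  ∃ (v : Fin n → Fin d → ℝ) (A : Matrix (Fin m) (Fin d) ℝ) (b : Fin m → ℝ)
    (q : ℕ) (A' : Matrix (Fin q) (Fin d) ℝ) (b' : Fin q → ℝ),
    Function.Injective v ∧ range v = P.extremePoints ℝ ∧
    P = convexHull ℝ (range v) ∧
    P = {x | A.mulVec x ≤ b ∧ A'.mulVec x = b'} ∧
    ∀ i j, S i j = b i - A.mulVec (v j) i

/-- The inequality `x_i ≥ 0` is facet-defining for `P`: it is valid for `P`, and the face on which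
it is tight is nonempty and has dimension `dim P - 1`. -/
def NonnegIsFacet {d : ℕ} (P : Set (Fin d → ℝ)) (i : Fin d) : Prop :=
  (∀ x ∈ P, 0 ≤ x i) ∧ {x ∈ P | x i = 0}.Nonempty ∧ dim {x ∈ P | x i = 0} + 1 = dim P

/-- The glued product of `P₁` and `P₂` with respect to the coordinates `c₁ 0, …, c₁ (r-1)` of `P₁`
and `c₂ 0, …, c₂ (r-1)` of `P₂`; the index of the product is `k = r + 1`. -/
def gluedProduct {r d₁ d₂ : ℕ} (c₁ : Fin r → Fin d₁) (c₂ : Fin r → Fin d₂)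
    (P₁ : Set (Fin d₁ → ℝ)) (P₂ : Set (Fin d₂ → ℝ)) : Set ((Fin d₁ → ℝ) × (Fin d₂ → ℝ)) :=
  convexHull ℝ {z | z.1 ∈ P₁.extremePoints ℝ ∧ z.2 ∈ P₂.extremePoints ℝ ∧
    ∀ i, z.1 (c₁ i) = z.2 (c₂ i)}

/-- The condition on each factor of a simplicial glued product: the projection of `P` to the
selected coordinates is `conv {0, e_1, …, e_r}`, these coordinates are `0` or `1` at every vertex
of `P`, and each of the inequalities "selected coordinate `≥ 0`" is facet-defining for `P`. -/
structure IsSimplicialFactor {r d : ℕ} (c : Fin r → Fin d) (P : Set (Fin d → ℝ)) : Prop where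
  polytope : IsPolytope P
  projection : (fun (x : Fin d → ℝ) (i : Fin r) => x (c i)) '' P =
    convexHull ℝ (insert 0 (range fun i : Fin r => (Pi.single i 1 : Fin r → ℝ)))
  zero_one : ∀ x ∈ P.extremePoints ℝ, ∀ i, x (c i) = 0 ∨ x (c i) = 1
  facet : ∀ i, NonnegIsFacet P (c i)

/-- A kind of product of two polytopes: `R d₁ d₂ P₁ P₂ Q` says that `Q` is such a product of
`P₁` and `P₂`. -/
abbrev ProductNotion : Type :=
  ∀ d₁ d₂ : ℕ, Set (Fin d₁ → ℝ) → Set (Fin d₂ → ℝ) → Set ((Fin d₁ → ℝ) × (Fin d₂ → ℝ)) → Prop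

/-- `Q` is a simplicial glued product `P₁ ×_k P₂`, for `k ≥ 1`. Both factors have positive
dimension (for `k ≥ 2` this holds automatically). -/
def SimplicialGluedProduct (k : ℕ) : ProductNotion := fun d₁ d₂ P₁ P₂ Q =>
  1 ≤ dim P₁ ∧ 1 ≤ dim P₂ ∧
  ∃ (c₁ : Fin (k - 1) → Fin d₁) (c₂ : Fin (k - 1) → Fin d₂),
    IsSimplicialFactor c₁ P₁ ∧ IsSimplicialFactor c₂ P₂ ∧ Q = gluedProduct c₁ c₂ P₁ P₂

/-- A simplicial glued product none of whose factors is a `(k - 1)`-dimensional simplex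
(the `(k - 1)`-dimensional simplex is a neutral element of the product). -/
def ProperSimplicialGluedProduct (k : ℕ) : ProductNotion := fun d₁ d₂ P₁ P₂ Q =>
  SimplicialGluedProduct k d₁ d₂ P₁ P₂ Q ∧ ¬ IsSimplex (k - 1) P₁ ∧ ¬ IsSimplex (k - 1) P₂

/-- `Q` is the Cartesian product of polytopes `P₁`, `P₂` of positive dimension. -/
def CartesianProduct : ProductNotion := fun _ _ P₁ P₂ Q =>
  IsPolytope P₁ ∧ IsPolytope P₂ ∧ 1 ≤ dim P₁ ∧ 1 ≤ dim P₂ ∧ Q = P₁ ×ˢ P₂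

end GluedProduct

/-! ### Algorithms on real matrices

Random access programs over the reals: structured programs that act on arrays of reals and arrays
of natural numbers. The arithmetic operations and comparisons of reals are exact and have unit
cost; natural numbers, which serve as indices and counters, can only be added, subtracted and
compared. There are no real constants other than `0` and `1`, and no rounding. -/

namespace RealRAM

/-- The memory: countably many two-dimensional arrays of natural numbers and countably many
two-dimensional arrays of reals. The arguments are the name of the array, the row and the
column. -/
structure Store where
  nat : ℕ → ℕ → ℕ → ℕ
  real : ℕ → ℕ → ℕ → ℝ

/-- Expressions with natural number values; `sub` is truncated. -/
inductive NatExpr : Type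
  | const (c : ℕ)
  | load (name : ℕ) (i j : NatExpr)
  | add (a b : NatExpr)
  | sub (a b : NatExpr)

namespace NatExpr

def eval (s : Store) : NatExpr → ℕ
  | const c => c
  | load name i j => s.nat name (i.eval s) (j.eval s)
  | add a b => a.eval s + b.eval s
  | sub a b => a.eval s - b.eval s

/-- The number of operations in an expression. -/
def cost : NatExpr → ℕ
  | const _ => 1
  | load _ i j => i.cost + j.cost + 1
  | add a b => a.cost + b.cost + 1
  | sub a b => a.cost + b.cost + 1

end NatExpr

/-- Expressions with real values; division by zero yields zero. -/
inductive RealExpr : Type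
  | zero
  | one
  | load (name : ℕ) (i j : NatExpr)
  | add (a b : RealExpr)
  | sub (a b : RealExpr)
  | mul (a b : RealExpr)
  | div (a b : RealExpr)

namespace RealExpr

noncomputable def eval (s : Store) : RealExpr → ℝ
  | zero => 0
  | one => 1
  | load name i j => s.real name (i.eval s) (j.eval s)
  | add a b => a.eval s + b.eval s
  | sub a b => a.eval s - b.eval s
  | mul a b => a.eval s * b.eval s
  | div a b => a.eval s / b.eval s

/-- The number of operations in an expression. -/
def cost : RealExpr → ℕ
  | zero => 1
  | one => 1
  | load _ i j => i.cost + j.cost + 1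
  | add a b => a.cost + b.cost + 1
  | sub a b => a.cost + b.cost + 1
  | mul a b => a.cost + b.cost + 1
  | div a b => a.cost + b.cost + 1

end RealExpr

/-- Tests. -/
inductive Test : Type
  | natLt (a b : NatExpr)
  | natEq (a b : NatExpr)
  | realLt (a b : RealExpr)
  | realEq (a b : RealExpr)
  | not (a : Test)
  | and (a b : Test)
  | or (a b : Test)

namespace Test

def Holds (s : Store) : Test → Prop
  | natLt a b => a.eval s < b.eval s
  | natEq a b => a.eval s = b.eval s
  | realLt a b => a.eval s < b.eval s
  | realEq a b => a.eval s = b.eval s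
  | not a => ¬ a.Holds s
  | and a b => a.Holds s ∧ b.Holds s
  | or a b => a.Holds s ∨ b.Holds s

/-- The number of operations in a test. -/
def cost : Test → ℕ
  | natLt a b => a.cost + b.cost + 1
  | natEq a b => a.cost + b.cost + 1
  | realLt a b => a.cost + b.cost + 1
  | realEq a b => a.cost + b.cost + 1
  | not a => a.cost + 1
  | and a b => a.cost + b.cost + 1
  | or a b => a.cost + b.cost + 1

end Test

/-- Programs. -/
inductive Program : Type
  | skip
  | natStore (name : ℕ) (i j e : NatExpr)
  | realStore (name : ℕ) (i j : NatExpr) (e : RealExpr)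
  | seq (p q : Program)
  | cond (b : Test) (p q : Program)
  | loop (b : Test) (p : Program)

namespace Store

/-- Write `x` into entry `(i, j)` of the array `name` of natural numbers. -/
def setNat (s : Store) (name i j x : ℕ) : Store where
  nat := fun name' i' j' => if name' = name ∧ i' = i ∧ j' = j then x else s.nat name' i' j'
  real := s.real

/-- Write `x` into entry `(i, j)` of the array `name` of reals. -/
def setReal (s : Store) (name i j : ℕ) (x : ℝ) : Store where
  nat := s.nat
  real := fun name' i' j' => if name' = name ∧ i' = i ∧ j' = j then x else s.real name' i' j'

/-- The number of rows of the matrix called `name`. -/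
def rows (s : Store) (name : ℕ) : ℕ := s.nat name 0 0

/-- The number of columns of the matrix called `name`. -/
def cols (s : Store) (name : ℕ) : ℕ := s.nat name 0 1

/-- The matrix called `name`: its format is stored in the array `name` of natural numbers, its
entries in the array `name` of reals. -/
def matrix (s : Store) (name : ℕ) : Matrix (Fin (s.rows name)) (Fin (s.cols name)) ℝ :=
  fun i j => s.real name i j

/-- The initial memory on input `S`: the matrix called `0` is `S`, all the rest is zero. -/
def init {m n : ℕ} (S : Matrix (Fin m) (Fin n) ℝ) : Store where
  nat := fun name i j =>
    if name = 0 ∧ i = 0 ∧ j = 0 then m else if name = 0 ∧ i = 0 ∧ j = 1 then n else 0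
  real := fun name i j =>
    if h : name = 0 ∧ i < m ∧ j < n then S ⟨i, h.2.1⟩ ⟨j, h.2.2⟩ else 0

/-- The verdict of an algorithm: entry `(0, 0)` of the array `3` of natural numbers. -/
def Accepts (s : Store) : Prop := s.nat 3 0 0 ≠ 0

end Store

/-- `Exec p s s' t`: the program `p`, started in memory `s`, halts in memory `s'` after exactly
`t` operations. -/
inductive Exec : Program → Store → Store → ℕ → Prop
  | skip (s : Store) : Exec .skip s s 1
  | natStore (s : Store) (name : ℕ) (i j e : NatExpr) :
      Exec (.natStore name i j e) s (s.setNat name (i.eval s) (j.eval s) (e.eval s))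
        (i.cost + j.cost + e.cost + 1)
  | realStore (s : Store) (name : ℕ) (i j : NatExpr) (e : RealExpr) :
      Exec (.realStore name i j e) s (s.setReal name (i.eval s) (j.eval s) (e.eval s))
        (i.cost + j.cost + e.cost + 1)
  | seq {p q : Program} {s s' s'' : Store} {t t' : ℕ} :
      Exec p s s' t → Exec q s' s'' t' → Exec (.seq p q) s s'' (t + t')
  | condTrue {b : Test} {p q : Program} {s s' : Store} {t : ℕ} :
      b.Holds s → Exec p s s' t → Exec (.cond b p q) s s' (b.cost + t)
  | condFalse {b : Test} {p q : Program} {s s' : Store} {t : ℕ} :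
      ¬ b.Holds s → Exec q s s' t → Exec (.cond b p q) s s' (b.cost + t)
  | loopTrue {b : Test} {p : Program} {s s' s'' : Store} {t t' : ℕ} :
      b.Holds s → Exec p s s' t → Exec (.loop b p) s' s'' t' →
        Exec (.loop b p) s s'' (b.cost + t + t')
  | loopFalse {b : Test} {p : Program} {s : Store} :
      ¬ b.Holds s → Exec (.loop b p) s s b.cost

/-- Programs are deterministic: the final memory and the number of operations are determined by
the program and the initial memory. -/
theorem Exec.deterministic {p : Program} {s s₁ s₂ : Store} {t₁ t₂ : ℕ}
    (h₁ : Exec p s s₁ t₁) (h₂ : Exec p s s₂ t₂) : s₁ = s₂ ∧ t₁ = t₂ := by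
  induction h₁ generalizing s₂ t₂ with
  | skip => cases h₂; exact ⟨rfl, rfl⟩
  | natStore => cases h₂; exact ⟨rfl, rfl⟩
  | realStore => cases h₂; exact ⟨rfl, rfl⟩
  | seq _ _ ih ih' =>
    cases h₂ with
    | seq h h' =>
      obtain ⟨rfl, rfl⟩ := ih h
      obtain ⟨rfl, rfl⟩ := ih' h'
      exact ⟨rfl, rfl⟩
  | condTrue hb _ ih =>
    cases h₂ with
    | condTrue _ h => obtain ⟨rfl, rfl⟩ := ih h; exact ⟨rfl, rfl⟩
    | condFalse hb' _ => exact absurd hb hb'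
  | condFalse hb _ ih =>
    cases h₂ with
    | condTrue hb' _ => exact absurd hb' hb
    | condFalse _ h => obtain ⟨rfl, rfl⟩ := ih h; exact ⟨rfl, rfl⟩
  | loopTrue hb _ _ ih ih' =>
    cases h₂ with
    | loopTrue _ h h' =>
      obtain ⟨rfl, rfl⟩ := ih h
      obtain ⟨rfl, rfl⟩ := ih' h'
      exact ⟨rfl, rfl⟩
    | loopFalse hb' => exact absurd hb hb'
  | loopFalse hb =>
    cases h₂ with
    | loopTrue hb' _ _ => exact absurd hb' hb
    | loopFalse _ => exact ⟨rfl, rfl⟩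

end RealRAM

namespace GluedProduct

/-- The product notion `R` is recognizable from slack matrices in polynomial time: there are one
program and one polynomial `f` such that, on every slack matrix `S ∈ ℝ^{m × n}` of a polytope `P`,
the program halts after at most `f (m + n)` operations, accepts if and only if `P` is affinely
isomorphic to a product of two polytopes, and, if it accepts, has stored as the matrices called
`1` and `2`, of size at most `f (m + n)`, slack matrices of the factors of such a product. -/
def PolyTimeRecognizable (R : ProductNotion) : Prop :=
  ∃ (p : RealRAM.Program) (f : Polynomial ℕ),
    ∀ (m n d : ℕ) (S : Matrix (Fin m) (Fin n) ℝ) (P : Set (Fin d → ℝ)), IsSlackMatrix S P →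
      ∃ (s : RealRAM.Store) (t : ℕ),
        RealRAM.Exec p (RealRAM.Store.init S) s t ∧ t ≤ f.eval (m + n) ∧
        (s.Accepts ↔ ∃ (d₁ d₂ : ℕ) (P₁ : Set (Fin d₁ → ℝ)) (P₂ : Set (Fin d₂ → ℝ))
          (Q : Set ((Fin d₁ → ℝ) × (Fin d₂ → ℝ))),
          R d₁ d₂ P₁ P₂ Q ∧ AffinelyIsomorphic P Q) ∧
        (s.Accepts → s.rows 1 * s.cols 1 + s.rows 2 * s.cols 2 ≤ f.eval (m + n) ∧
          ∃ (d₁ d₂ : ℕ) (P₁ : Set (Fin d₁ → ℝ)) (P₂ : Set (Fin d₂ → ℝ))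
            (Q : Set ((Fin d₁ → ℝ) × (Fin d₂ → ℝ))),
            R d₁ d₂ P₁ P₂ Q ∧ AffinelyIsomorphic P Q ∧
            IsSlackMatrix (s.matrix 1) P₁ ∧ IsSlackMatrix (s.matrix 2) P₂)

end GluedProduct

/-! ### A language of array expressions with bounded counting, compiled to random access programs -/

namespace RealRAM

/-! Write r = k - 1. The geometry first has to be read off the slack matrix. A nonzero row with
minimal support spans the functions that vanish on its zeros, and every facet occurs among these
facet rows (`facetProperty_of_facetRow`, `exists_facetRow_of_facetProperty`). Then a polytope is a
simplicial glued product exactly if there are r facet rows that behave like the common coordinates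
(`SpecialRows`) and a set X of rows that is a separator of the linear matroid of the facet rows
modulo the functions that are constant on types, where a type is the set of all columns over one
vertex of the simplex (`Separates`).

Necessity: the vertices of the product are all pairs of vertices of the factors that have the same
type, and every affine function splits as h₁ + h₂. After subtraction of the minimum over each type,
a facet row becomes a sum of nonnegative functions, each of which vanishes where the row does. By
the facet property the row therefore depends on one factor only (`facetRow_left_or_right`). Let X
consist of the rows that depend on the first factor. Exchanging one component of a vertex pair shows
that X separates (`exists_separates`).

Sufficiency: by duality, a separator permits gluing: two points of the affine hull with equal
special values have a common refinement that takes the rows in X from the first and the other facet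
rows from the second (`exists_glue`). So the projections of the polytope to the rows in X and to the
remaining rows, each together with the special rows, are two polytopes whose fibre product over the
simplex is the given polytope. Their vertices, facets and slack matrices are obtained by lifting
points.

Algorithm: all tuples of r rows are tried, and r is a constant. For a special tuple, a reference
column is subtracted from each column of its type, and column operations then produce a matrix with
the same row relations in which each nonzero column contains a unit row. Its separators are the sets
that are unions of connected components of the incidence structure of nonzero entries
(`IsSeparator.columnClosed`, `Connected`). A proper product exists if and only if the nonzero rows
do not all lie in one component. For k ≥ 2, if properness is not demanded, any separator will do,
because a simplex may be a factor. For k = 1 every product of factors of positive dimension is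
proper, and Cartesian products are this case.

The running time is treated separately. The algorithm is written in a small language of array
expressions with bounded counting and bounded loops. Every well-formed expression and command of it
compiles to a polynomial time program (`Tm.computes_compile`, `Cmd.implements_compile`), so
correctness only concerns the denotational semantics `Cmd.sem`. -/

/-- The number of rows plus the number of columns of the input matrix. -/
def Store.size (s : Store) : ℕ := s.nat 0 0 0 + s.nat 0 0 1

/-- Ranges of the bounded quantifiers and loops. -/
inductive Bound : Type
  | rows
  | cols
  | rowsSucc
  | const (c : ℕ)

namespace Bound

def eval (s : Store) : Bound → ℕ
  | rows => s.nat 0 0 0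
  | cols => s.nat 0 0 1
  | rowsSucc => s.nat 0 0 0 + 1
  | const c => c

def expr : Bound → NatExpr
  | rows => .load 0 (.const 0) (.const 0)
  | cols => .load 0 (.const 0) (.const 1)
  | rowsSucc => .add (.load 0 (.const 0) (.const 0)) (.const 1)
  | const c => .const c

/-- The amount by which a range can exceed the size of the input; needed for time bounds that are
polynomials in the size. -/
def slop : Bound → ℕ
  | rows => 0
  | cols => 0
  | rowsSucc => 1
  | const c => c

theorem expr_eval (B : Bound) (s : Store) : B.expr.eval s = B.eval s := by
  cases B <;> rfl

theorem expr_cost_le (B : Bound) : B.expr.cost ≤ 5 := by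
  cases B <;> simp [expr, NatExpr.cost]

theorem eval_le (B : Bound) (s : Store) : B.eval s ≤ s.size + B.slop := by
  cases B <;> simp [eval, Store.size, slop]

end Bound

namespace Store

/-- Two memories agree on all arrays with names below `d`. -/
structure Agree (d : ℕ) (s s' : Store) : Prop where
  nat : ∀ name < d, s.nat name = s'.nat name
  real : ∀ name < d, s.real name = s'.real name

theorem Agree.refl (d : ℕ) (s : Store) : s.Agree d s := ⟨fun _ _ => rfl, fun _ _ => rfl⟩

theorem Agree.trans {d : ℕ} {s s' s'' : Store} (h : s.Agree d s') (h' : s'.Agree d s'') :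
    s.Agree d s'' :=
  ⟨fun n hn => (h.nat n hn).trans (h'.nat n hn), fun n hn => (h.real n hn).trans (h'.real n hn)⟩

theorem Agree.mono {d d' : ℕ} {s s' : Store} (hd : d ≤ d') (h : s.Agree d' s') : s.Agree d s' :=
  ⟨fun n hn => h.nat n (hn.trans_le hd), fun n hn => h.real n (hn.trans_le hd)⟩

theorem Agree.setNat_right {d : ℕ} {s s' : Store} (h : s.Agree d s') {name : ℕ} (hn : d ≤ name)
    (i j x : ℕ) : s.Agree d (s'.setNat name i j x) := by
  refine ⟨fun n hn' => ?_, h.real⟩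
  funext a b
  simp [setNat, show n ≠ name by omega, h.nat n hn']

theorem Agree.setReal_right {d : ℕ} {s s' : Store} (h : s.Agree d s') {name : ℕ} (hn : d ≤ name)
    (i j : ℕ) (x : ℝ) : s.Agree d (s'.setReal name i j x) := by
  refine ⟨h.nat, fun n hn' => ?_⟩
  funext a b
  simp [setReal, show n ≠ name by omega, h.real n hn']

theorem Agree.setNat {d : ℕ} {s s' : Store} (h : s.Agree d s') (name i j x : ℕ) :
    (s.setNat name i j x).Agree d (s'.setNat name i j x) := by
  refine ⟨fun n hn' => ?_, h.real⟩
  funext a b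
  simp [Store.setNat, h.nat n hn']

theorem Agree.size_eq {d : ℕ} (hd : 1 ≤ d) {s s' : Store} (h : s.Agree d s') :
    s.size = s'.size := by
  simp [Store.size, h.nat 0 (by omega)]

theorem Agree.bound_eq {d : ℕ} (hd : 1 ≤ d) {s s' : Store} (h : s.Agree d s') (B : Bound) :
    B.eval s = B.eval s' := by
  cases B <;> simp [Bound.eval, h.nat 0 (by omega)]

theorem setNat_self (s : Store) (name i j : ℕ) : s.setNat name i j (s.nat name i j) = s := by
  cases s
  simp only [setNat, Store.mk.injEq, and_true]
  funext a b c
  split_ifs with h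
  · obtain ⟨rfl, rfl, rfl⟩ := h; rfl
  · rfl

theorem setNat_setNat (s : Store) (name i j x y : ℕ) :
    (s.setNat name i j x).setNat name i j y = s.setNat name i j y := by
  cases s
  simp only [setNat, Store.mk.injEq, and_true]
  funext a b c
  split_ifs <;> rfl

@[simp] theorem setNat_real (s : Store) (name i j x : ℕ) : (s.setNat name i j x).real = s.real :=
  rfl

@[simp] theorem setNat_nat_self (s : Store) (name i j x : ℕ) :
    (s.setNat name i j x).nat name i j = x := by simp [setNat]

@[simp] theorem setReal_real_self (s : Store) (name i j : ℕ) (x : ℝ) :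
    (s.setReal name i j x).real name i j = x := by simp [setReal]

theorem setNat_nat_of_ne (s : Store) {name name' : ℕ} (h : name' ≠ name) (i j x : ℕ) :
    (s.setNat name i j x).nat name' = s.nat name' := by
  funext a b; simp [setNat, h]

theorem setReal_real_of_ne (s : Store) {name name' : ℕ} (h : name' ≠ name) (i j : ℕ) (x : ℝ) :
    (s.setReal name i j x).real name' = s.real name' := by
  funext a b; simp [setReal, h]

end Store

/-! #### Running a program within a time bound -/

/-- Started in `s`, the program halts within time `T` in a memory satisfying `Q`. -/
def Runs (p : Program) (s : Store) (T : ℕ) (Q : Store → Prop) : Prop :=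
  ∃ s' t, Exec p s s' t ∧ t ≤ T ∧ Q s'

namespace Runs

theorem mono {p : Program} {s : Store} {T T' : ℕ} {Q Q' : Store → Prop} (h : Runs p s T Q)
    (hT : T ≤ T') (hQ : ∀ s', Q s' → Q' s') : Runs p s T' Q' := by
  obtain ⟨s', t, he, ht, hq⟩ := h
  exact ⟨s', t, he, ht.trans hT, hQ _ hq⟩

theorem seq {p q : Program} {s : Store} {T T' : ℕ} {Q : Store → Prop}
    (h : Runs p s T fun s' => Runs q s' T' Q) : Runs (.seq p q) s (T + T') Q := by
  obtain ⟨s', t, he, ht, s'', t', he', ht', hq⟩ := h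
  exact ⟨s'', t + t', .seq he he', by omega, hq⟩

theorem natStore {name : ℕ} {i j e : NatExpr} {s : Store} {Q : Store → Prop}
    (h : Q (s.setNat name (i.eval s) (j.eval s) (e.eval s))) :
    Runs (.natStore name i j e) s (i.cost + j.cost + e.cost + 1) Q :=
  ⟨_, _, .natStore s name i j e, le_rfl, h⟩

theorem realStore {name : ℕ} {i j : NatExpr} {e : RealExpr} {s : Store} {Q : Store → Prop}
    (h : Q (s.setReal name (i.eval s) (j.eval s) (e.eval s))) :
    Runs (.realStore name i j e) s (i.cost + j.cost + e.cost + 1) Q :=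
  ⟨_, _, .realStore s name i j e, le_rfl, h⟩

theorem cond {b : Test} {p q : Program} {s : Store} {T : ℕ} {Q : Store → Prop}
    (h : b.Holds s → Runs p s T Q) (h' : ¬ b.Holds s → Runs q s T Q) :
    Runs (.cond b p q) s (b.cost + T) Q := by
  by_cases hb : b.Holds s
  · obtain ⟨s', t, he, ht, hq⟩ := h hb
    exact ⟨s', _, .condTrue hb he, by omega, hq⟩
  · obtain ⟨s', t, he, ht, hq⟩ := h' hb
    exact ⟨s', _, .condFalse hb he, by omega, hq⟩

theorem skip {s : Store} {Q : Store → Prop} (h : Q s) : Runs .skip s 1 Q :=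
  ⟨s, 1, .skip s, le_rfl, h⟩

end Runs

/-- The natural number register `c`. -/
def reg (c : ℕ) : NatExpr := .load c (.const 0) (.const 0)

/-- The real register `c`. -/
def rreg (c : ℕ) : RealExpr := .load c (.const 0) (.const 0)

/-- Assign a value to the natural number register `c`. -/
def setReg (c : ℕ) (e : NatExpr) : Program := .natStore c (.const 0) (.const 0) e

/-- Assign a value to the real register `c`. -/
def setRReg (c : ℕ) (e : RealExpr) : Program := .realStore c (.const 0) (.const 0) e

@[simp] theorem reg_eval (c : ℕ) (s : Store) : (reg c).eval s = s.nat c 0 0 := rfl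
@[simp] theorem rreg_eval (c : ℕ) (s : Store) : (rreg c).eval s = s.real c 0 0 := rfl
@[simp] theorem reg_cost (c : ℕ) : (reg c).cost = 3 := rfl

theorem Runs.setReg {c : ℕ} {e : NatExpr} {s : Store} {Q : Store → Prop}
    (h : Q (s.setNat c 0 0 (e.eval s))) : Runs (setReg c e) s (e.cost + 3) Q :=
  (Runs.natStore (i := .const 0) (j := .const 0) h).mono (by simp [NatExpr.cost]; omega)
    fun _ => id

theorem Runs.setRReg {c : ℕ} {e : RealExpr} {s : Store} {Q : Store → Prop}
    (h : Q (s.setReal c 0 0 (e.eval s))) : Runs (setRReg c e) s (e.cost + 3) Q :=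
  (Runs.realStore (i := .const 0) (j := .const 0) h).mono (by simp [NatExpr.cost]; omega)
    fun _ => id

/-- `for c < B do body`. -/
def forLoop (c : ℕ) (B : Bound) (body : Program) : Program :=
  .seq (setReg c (.const 0))
    (.loop (.natLt (reg c) B.expr) (.seq body (setReg c (.add (reg c) (.const 1)))))

/-- Induction on the number of remaining rounds. The test evaluates the range anew in each round, so
its value is part of what the invariant must fix, and the body has to leave the counter alone. The
constant 25 has room for the test, the increment and the initialization. -/
theorem Runs.forLoop {c : ℕ} {B : Bound} {body : Program} {s : Store} {T b : ℕ}
    {Q : Store → Prop} (Inv : ℕ → Store → Prop) (h0 : Inv 0 (s.setNat c 0 0 0))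
    (hc : ∀ v s, Inv v s → s.nat c 0 0 = v ∧ B.eval s = b)
    (hstep : ∀ v < b, ∀ s, Inv v s →
      Runs body s T fun s' => s'.nat c 0 0 = v ∧ Inv (v + 1) (s'.setNat c 0 0 (v + 1)))
    (hQ : ∀ s, Inv b s → Q s) :
    Runs (forLoop c B body) s ((b + 1) * (T + 25)) Q := by
  have key : ∀ k v, v + k = b → ∀ s, Inv v s →
      Runs (.loop (.natLt (reg c) B.expr) (.seq body (RealRAM.setReg c (.add (reg c) (.const 1)))))
        s (k * (T + 25) + 9) (Inv b) := by
    intro k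
    induction k with
    | zero =>
      intro v hv s hs
      refine ⟨s, _, .loopFalse ?_, ?_, ?_⟩
      · have := hc v s hs
        simp only [Test.Holds, reg_eval, Bound.expr_eval]
        omega
      · have := B.expr_cost_le
        simp [Test.cost]; omega
      · obtain rfl : v = b := by omega
        exact hs
    | succ k ih =>
      intro v hv s hs
      obtain ⟨s', t, he, ht, hv', hinv⟩ := hstep v (by omega) s hs
      obtain ⟨s'', t', he', ht', hq⟩ := ih (v + 1) (by omega) _ hinv
      have hcv := hc v s hs
      have hstore : Exec (RealRAM.setReg c (.add (reg c) (.const 1))) s'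
          (s'.setNat c 0 0 (v + 1)) 8 := by
        have := Exec.natStore s' c (.const 0) (.const 0) (.add (reg c) (.const 1))
        simp only [NatExpr.eval, reg_eval, hv'] at this
        exact this
      refine ⟨s'', _, .loopTrue ?_ (.seq he hstore) he', ?_, hq⟩
      · simp only [Test.Holds, reg_eval, Bound.expr_eval]
        omega
      · have := B.expr_cost_le
        simp only [Test.cost, reg_cost]
        have : (k + 1) * (T + 25) = k * (T + 25) + (T + 25) := by ring
        omega
  have := key b 0 (by omega) _ h0
  have hrun : Runs (RealRAM.forLoop c B body) s (4 + (b * (T + 25) + 9)) (Inv b) :=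
    Runs.seq (Runs.setReg (s := s) (c := c) (e := .const 0) this)
  refine hrun.mono ?_ hQ
  · have : (b + 1) * (T + 25) = b * (T + 25) + (T + 25) := by ring
    omega

/-! #### Terms -/

/-- The sorts of terms. -/
inductive Ty : Type
  | nat
  | real
  | bool

/-- The values of each sort. -/
abbrev Ty.Val : Ty → Type
  | .nat => ℕ
  | .real => ℝ
  | .bool => Prop

/-- Terms; `count x B b` is the number of values below `B` of the register `x` for which `b`
holds. -/
inductive Tm : Ty → Type
  | const (c : ℕ) : Tm .nat
  | natLoad (name : ℕ) (i j : Tm .nat) : Tm .nat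
  | count (x : ℕ) (B : Bound) (b : Tm .bool) : Tm .nat
  | zero : Tm .real
  | one : Tm .real
  | realLoad (name : ℕ) (i j : Tm .nat) : Tm .real
  | sub (a b : Tm .real) : Tm .real
  | mul (a b : Tm .real) : Tm .real
  | div (a b : Tm .real) : Tm .real
  | realIte (b : Tm .bool) (x y : Tm .real) : Tm .real
  | natLt (a b : Tm .nat) : Tm .bool
  | natEq (a b : Tm .nat) : Tm .bool
  | realEq (a b : Tm .real) : Tm .bool
  | not (a : Tm .bool) : Tm .bool
  | and (a b : Tm .bool) : Tm .bool

/-- The value held by register `d`. -/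
def Store.result (s : Store) (d : ℕ) : (τ : Ty) → τ.Val
  | .nat => s.nat d 0 0
  | .real => s.real d 0 0
  | .bool => s.nat d 0 0 = 1

theorem Store.Agree.result_eq {d c : ℕ} (hc : c < d) {s s' : Store} (h : s.Agree d s') (τ : Ty) :
    s.result c τ = s'.result c τ := by
  cases τ <;> simp [Store.result, h.nat c hc, h.real c hc]

namespace Tm

open Classical in
noncomputable def eval : {τ : Ty} → Tm τ → Store → τ.Val
  | _, const c, _ => c
  | _, natLoad name i j, s => s.nat name (i.eval s) (j.eval s)
  | _, count x B b, s => ((Finset.range (B.eval s)).filter fun v => b.eval (s.setNat x 0 0 v)).card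
  | _, zero, _ => 0
  | _, one, _ => 1
  | _, realLoad name i j, s => s.real name (i.eval s) (j.eval s)
  | _, sub a b, s => (show ℝ from a.eval s) - (show ℝ from b.eval s)
  | _, mul a b, s => (show ℝ from a.eval s) * (show ℝ from b.eval s)
  | _, div a b, s => (show ℝ from a.eval s) / (show ℝ from b.eval s)
  | _, realIte b x y, s => if b.eval s then x.eval s else y.eval s
  | _, natLt a b, s => (show ℕ from a.eval s) < (show ℕ from b.eval s)
  | _, natEq a b, s => a.eval s = b.eval s
  | _, realEq a b, s => a.eval s = b.eval s
  | _, not a, s => ¬ a.eval s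
  | _, and a b, s => a.eval s ∧ b.eval s

/-- All arrays used by the term have names below `d`, and the array `0` is not used as a bound
variable. -/
def WF (d : ℕ) : {τ : Ty} → Tm τ → Prop
  | _, const _ => True
  | _, natLoad name i j => name < d ∧ i.WF d ∧ j.WF d
  | _, count x _ b => x ≠ 0 ∧ x < d ∧ b.WF d
  | _, zero => True
  | _, one => True
  | _, realLoad name i j => name < d ∧ i.WF d ∧ j.WF d
  | _, sub a b => a.WF d ∧ b.WF d
  | _, mul a b => a.WF d ∧ b.WF d
  | _, div a b => a.WF d ∧ b.WF d
  | _, realIte b x y => b.WF d ∧ x.WF d ∧ y.WF d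
  | _, natLt a b => a.WF d ∧ b.WF d
  | _, natEq a b => a.WF d ∧ b.WF d
  | _, realEq a b => a.WF d ∧ b.WF d
  | _, not a => a.WF d
  | _, and a b => a.WF d ∧ b.WF d

theorem WF.mono {τ : Ty} {t : Tm τ} {d d' : ℕ} (hd : d ≤ d') (h : t.WF d) : t.WF d' := by
  induction t with
  | count x B b ih => exact ⟨h.1, h.2.1.trans_le hd, ih h.2.2⟩
  | natLoad name i j ih₁ ih₂ => exact ⟨h.1.trans_le hd, ih₁ h.2.1, ih₂ h.2.2⟩
  | realLoad name i j ih₁ ih₂ => exact ⟨h.1.trans_le hd, ih₁ h.2.1, ih₂ h.2.2⟩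
  | _ => simp_all [WF]

-- Scratch arrays have names at least `d`, so they cannot influence a term that is well-formed for
-- `d`. This makes it harmless to evaluate one subterm after another.
open Classical in
theorem eval_congr {τ : Ty} (t : Tm τ) {d : ℕ} (hd : 1 ≤ d) (ht : t.WF d) {s s' : Store}
    (h : s.Agree d s') : t.eval s = t.eval s' := by
  induction t generalizing s s' with
  | const c => rfl
  | zero => rfl
  | one => rfl
  | natLoad name i j ih₁ ih₂ =>
    simp only [eval, ih₁ ht.2.1 h, ih₂ ht.2.2 h, h.nat name ht.1]
  | realLoad name i j ih₁ ih₂ =>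
    simp only [eval, ih₁ ht.2.1 h, ih₂ ht.2.2 h, h.real name ht.1]
  | count x B b ih =>
    simp only [eval, h.bound_eq hd B]
    simp only [ih ht.2.2 (h.setNat x 0 0 _)]
  | sub a b iha ihb => simp only [eval, iha ht.1 h, ihb ht.2 h]
  | mul a b iha ihb => simp only [eval, iha ht.1 h, ihb ht.2 h]
  | div a b iha ihb => simp only [eval, iha ht.1 h, ihb ht.2 h]
  | natLt a b iha ihb => simp only [eval, iha ht.1 h, ihb ht.2 h]
  | natEq a b iha ihb => simp only [eval, iha ht.1 h, ihb ht.2 h]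
  | realEq a b iha ihb => simp only [eval, iha ht.1 h, ihb ht.2 h]
  | and a b iha ihb => simp only [eval, iha ht.1 h, ihb ht.2 h]
  | not a ih =>
    have := ih ht h
    simp only [eval, this]
  | realIte b x y ihb ihx ihy =>
    have hb : b.eval s ↔ b.eval s' := iff_of_eq (ihb ht.1 h)
    simp only [eval, ihx ht.2.1 h, ihy ht.2.2 h]
    by_cases hb' : b.eval s
    · rw [if_pos hb', if_pos (hb.1 hb')]
    · rw [if_neg hb', if_neg fun hn => hb' (hb.2 hn)]

/-- Store the truth value of a test in register `d`. -/
def setBool (d : ℕ) (b : Test) : Program :=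
  .cond b (setReg d (.const 1)) (setReg d (.const 0))

/-- A program that stores the value of the term in register `d`, and uses arrays with names at
least `d` as scratch space. -/
def compile : {τ : Ty} → Tm τ → ℕ → Program
  | _, const c, d => setReg d (.const c)
  | _, natLoad name i j, d =>
    .seq (i.compile d) (.seq (j.compile (d + 1)) (setReg d (.load name (reg d) (reg (d + 1)))))
  | _, count x B b, d =>
    -- Register `d` counts, `d + 1` saves the old value of the bound variable `x`, which lies below
    -- `d` and must be restored at the end, and `d + 2` is the loop counter.
    .seq (setReg d (.const 0)) (.seq (setReg (d + 1) (reg x))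
      (.seq (forLoop (d + 2) B (.seq (setReg x (reg (d + 2))) (.seq (b.compile (d + 3))
        (.cond (.natEq (reg (d + 3)) (.const 1)) (setReg d (.add (reg d) (.const 1))) .skip))))
      (setReg x (reg (d + 1)))))
  | _, zero, d => setRReg d .zero
  | _, one, d => setRReg d .one
  | _, realLoad name i j, d =>
    .seq (i.compile d) (.seq (j.compile (d + 1)) (setRReg d (.load name (reg d) (reg (d + 1)))))
  | _, sub a b, d =>
    .seq (a.compile d) (.seq (b.compile (d + 1)) (setRReg d (.sub (rreg d) (rreg (d + 1)))))
  | _, mul a b, d =>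
    .seq (a.compile d) (.seq (b.compile (d + 1)) (setRReg d (.mul (rreg d) (rreg (d + 1)))))
  | _, div a b, d =>
    .seq (a.compile d) (.seq (b.compile (d + 1)) (setRReg d (.div (rreg d) (rreg (d + 1)))))
  | _, realIte b x y, d =>
    .seq (b.compile d) (.cond (.natEq (reg d) (.const 1)) (x.compile d) (y.compile d))
  | _, natLt a b, d =>
    .seq (a.compile d) (.seq (b.compile (d + 1)) (setBool d (.natLt (reg d) (reg (d + 1)))))
  | _, natEq a b, d =>
    .seq (a.compile d) (.seq (b.compile (d + 1)) (setBool d (.natEq (reg d) (reg (d + 1)))))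
  | _, realEq a b, d =>
    .seq (a.compile d) (.seq (b.compile (d + 1)) (setBool d (.realEq (rreg d) (rreg (d + 1)))))
  | _, not a, d => .seq (a.compile d) (setBool d (.not (.natEq (reg d) (.const 1))))
  | _, and a b, d =>
    .seq (a.compile d) (.seq (b.compile (d + 1))
      (setBool d (.and (.natEq (reg d) (.const 1)) (.natEq (reg (d + 1)) (.const 1)))))

/-- The program `p` computes the function `f` into register `d` within time `C`, without changing
the arrays below `d`. -/
def Computes (p : Program) (d : ℕ) {τ : Ty} (f : Store → τ.Val) (C : Polynomial ℕ) : Prop :=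
  ∀ s, Runs p s (C.eval s.size) fun s' => s.Agree d s' ∧ s'.result d τ = f s

theorem Computes.bind {p q : Program} {d : ℕ} (hd : 1 ≤ d) {σ : Ty} {f : Store → σ.Val}
    {C : Polynomial ℕ} (hp : Computes p d f C) {T : ℕ} {Q : Store → Prop} {s : Store}
    (h : ∀ s', s.Agree d s' → s'.size = s.size → s'.result d σ = f s → Runs q s' T Q) :
    Runs (.seq p q) s (C.eval s.size + T) Q :=
  Runs.seq ((hp s).mono le_rfl fun s' hs' => h s' hs'.1 (hs'.1.size_eq hd).symm hs'.2)

/-- The second program works from `d + 1` on, so the first result in register `d` survives; by `hg`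
the second result is still the value in the original memory. -/
theorem Computes.bind₂ {p q fin : Program} {d : ℕ} (hd : 1 ≤ d) {σ τ : Ty} {f : Store → σ.Val}
    {g : Store → τ.Val} {C C' : Polynomial ℕ} (hp : Computes p d f C)
    (hq : Computes q (d + 1) g C') (hg : ∀ s s', Store.Agree d s s' → g s = g s') {T : ℕ}
    {Q : Store → Prop} {s : Store}
    (h : ∀ s', s.Agree d s' → s'.result d σ = f s → s'.result (d + 1) τ = g s →
      Runs fin s' T Q) :
    Runs (.seq p (.seq q fin)) s ((C + C' + Polynomial.C T).eval s.size) Q := by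
  refine (hp.bind hd (T := C'.eval s.size + T) fun s₁ h₁ hs₁ r₁ => ?_).mono
    (by simp [add_assoc]) fun _ => id
  rw [← hs₁]
  refine hq.bind (by omega) fun s₂ h₂ hs₂ r₂ => ?_
  refine h s₂ (h₁.trans (h₂.mono (by omega))) ?_ ?_
  · rw [← r₁, h₂.result_eq (by omega)]
  · rw [r₂, hg s s₁ h₁]

theorem runs_setBool {d : ℕ} {b : Test} {s s₀ : Store} (h : s₀.Agree d s) {v : Prop}
    (hb : b.Holds s ↔ v) :
    Runs (setBool d b) s (b.cost + 4) fun s' => s₀.Agree d s' ∧ s'.result d .bool = v := by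
  refine Runs.cond (fun hb' => ?_) (fun hb' => ?_)
  · refine Runs.setReg ⟨h.setNat_right le_rfl _ _ _, ?_⟩
    simp [Store.result, NatExpr.eval, hb.1 hb']
  · refine Runs.setReg ⟨h.setNat_right le_rfl _ _ _, ?_⟩
    rw [hb] at hb'
    simp [Store.result, NatExpr.eval, hb']

theorem runs_setRReg {d : ℕ} {e : RealExpr} {s s₀ : Store} (h : s₀.Agree d s) {v : ℝ}
    (hb : e.eval s = v) :
    Runs (setRReg d e) s (e.cost + 3) fun s' => s₀.Agree d s' ∧ s'.result d .real = v := by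
  refine Runs.setRReg ⟨h.setReal_right le_rfl _ _ _, ?_⟩
  simp [Store.result, hb]

theorem runs_setReg {d : ℕ} {e : NatExpr} {s s₀ : Store} (h : s₀.Agree d s) {v : ℕ}
    (hb : e.eval s = v) :
    Runs (setReg d e) s (e.cost + 3) fun s' => s₀.Agree d s' ∧ s'.result d .nat = v := by
  refine Runs.setReg ⟨h.setNat_right le_rfl _ _ _, ?_⟩
  simp [Store.result, hb]

open Classical in
theorem computes_count {x d : ℕ} {B : Bound} {b : Tm .bool} {p : Program} {C : Polynomial ℕ}
    (hd : 1 ≤ d) (hx : x ≠ 0) (hxd : x < d) (hb : b.WF d)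
    (hp : Computes p (d + 3) b.eval C) :
    ∃ C', Computes (.seq (setReg d (.const 0)) (.seq (setReg (d + 1) (reg x))
      (.seq (forLoop (d + 2) B (.seq (setReg x (reg (d + 2))) (.seq p
        (.cond (.natEq (reg (d + 3)) (.const 1)) (setReg d (.add (reg d) (.const 1))) .skip))))
      (setReg x (reg (d + 1)))))) d (τ := .nat) (count x B b).eval C' := by
  refine ⟨(Polynomial.X + Polynomial.C (B.slop + 1)) * (C + Polynomial.C 100) + Polynomial.C 100,
    fun s => ?_⟩
  set bd := B.eval s with hbd
  set F : ℕ → ℕ := fun v =>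
    ((Finset.range v).filter fun v => b.eval (s.setNat x 0 0 v)).card with hF
  have hmain : Runs (.seq (setReg d (.const 0)) (.seq (setReg (d + 1) (reg x))
      (.seq (forLoop (d + 2) B (.seq (setReg x (reg (d + 2))) (.seq p
        (.cond (.natEq (reg (d + 3)) (.const 1)) (setReg d (.add (reg d) (.const 1))) .skip))))
      (setReg x (reg (d + 1)))))) s
      (4 + (6 + ((bd + 1) * ((6 + (C.eval s.size + 18)) + 25) + 6))) fun s' => s.Agree d s' ∧
        s'.result d .nat = (count x B b).eval s := by
    refine Runs.seq (Runs.setReg (Runs.seq (Runs.setReg (Runs.seq ?_))))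
    set s₁ := (s.setNat d 0 0 ((NatExpr.const 0).eval s)).setNat (d + 1) 0 0
      ((reg x).eval (s.setNat d 0 0 ((NatExpr.const 0).eval s))) with hs₁
    -- Invariant: below `d` the memory is the original one up to the value of the bound variable,
    -- and register `d` holds the count over the values treated so far.
    refine Runs.forLoop (b := bd) (fun v s' => (∃ w, Store.Agree d (s.setNat x 0 0 w) s') ∧
      s'.nat d 0 0 = F v ∧ s'.nat (d + 1) 0 0 = s.nat x 0 0 ∧ s'.nat (d + 2) 0 0 = v) ?_ ?_ ?_ ?_
    · refine ⟨⟨s.nat x 0 0, ?_⟩, ?_, ?_, ?_⟩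
      · rw [Store.setNat_self]
        exact (((Store.Agree.refl d s).setNat_right le_rfl _ _ _).setNat_right
          (by omega) _ _ _).setNat_right (by omega) _ _ _
      · have : F 0 = 0 := by simp [hF]
        rw [this]
        simp [hs₁, Store.setNat, NatExpr.eval]
      · simp [hs₁, Store.setNat, NatExpr.eval, show x ≠ d by omega]
      · simp
    · rintro v s' ⟨⟨w, hw⟩, h1, h2, h3⟩
      refine ⟨h3, ?_⟩
      rw [← hw.bound_eq hd, hbd]
      cases B <;> simp [Bound.eval, Store.setNat, Ne.symm hx]
    · rintro v hv s' ⟨⟨w, hw⟩, h1, h2, h3⟩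
      refine Runs.seq (Runs.setReg ?_)
      have hag : Store.Agree d (s.setNat x 0 0 v) (s'.setNat x 0 0 ((reg (d + 2)).eval s')) := by
        rw [reg_eval, h3]
        have := hw.setNat x 0 0 v
        rwa [Store.setNat_setNat] at this
      have hsz : (s'.setNat x 0 0 ((reg (d + 2)).eval s')).size = s.size := by
        rw [← hag.size_eq hd]
        simp [Store.size, Store.setNat, Ne.symm hx]
      rw [← hsz]
      refine hp.bind (by omega) fun s₂ h₂ _ r₂ => ?_
      have e₂ : b.eval (s'.setNat x 0 0 ((reg (d + 2)).eval s')) = b.eval (s.setNat x 0 0 v) :=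
        (b.eval_congr hd hb hag).symm
      rw [e₂] at r₂
      have n1 : s₂.nat d 0 0 = F v := by
        rw [← h₂.nat d (by omega), Store.setNat_nat_of_ne _ (by omega), h1]
      have n2 : s₂.nat (d + 1) 0 0 = s.nat x 0 0 := by
        rw [← h₂.nat _ (by omega), Store.setNat_nat_of_ne _ (by omega), h2]
      have n3 : s₂.nat (d + 2) 0 0 = v := by
        rw [← h₂.nat _ (by omega), Store.setNat_nat_of_ne _ (by omega), h3]
      have ag₂ := hag.trans (h₂.mono (by omega))
      have hr : s₂.nat (d + 3) 0 0 = 1 ↔ b.eval (s.setNat x 0 0 v) := by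
        rw [← r₂]; rfl
      refine (Runs.cond (T := 8) (fun hb' => ?_) (fun hb' => ?_)).mono
        (by simp [Test.cost, NatExpr.cost]) fun _ => id
      · refine (Runs.setReg ⟨?_, ⟨v, ?_⟩, ?_, ?_, ?_⟩).mono (by simp [NatExpr.cost]) fun _ => id
        · simp [Store.setNat, n3]
        · exact (ag₂.setNat_right le_rfl _ _ _).setNat_right (by omega) _ _ _
        · have hb'' : b.eval (s.setNat x 0 0 v) := hr.1 hb'
          have hF1 : F (v + 1) = F v + 1 := by
            simp only [hF, Finset.range_add_one, Finset.filter_insert]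
            rw [if_pos hb'', Finset.card_insert_of_notMem (by simp)]
          rw [hF1]
          simp [Store.setNat, NatExpr.eval, n1]
        · simp [Store.setNat, n2]
        · simp [Store.setNat]
      · refine (Runs.skip ⟨?_, ⟨v, ?_⟩, ?_, ?_, ?_⟩).mono (by simp) fun _ => id
        · exact n3
        · exact ag₂.setNat_right (by omega) _ _ _
        · have hb'' : ¬ b.eval (s.setNat x 0 0 v) := fun h => hb' (hr.2 h)
          have hF1 : F (v + 1) = F v := by
            simp only [hF, Finset.range_add_one, Finset.filter_insert]
            rw [if_neg hb'']
          rw [hF1]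
          simp [Store.setNat, n1]
        · simp [Store.setNat, n2]
        · simp [Store.setNat]
    · rintro s' ⟨⟨w, hw⟩, h1, h2, h3⟩
      refine Runs.setReg ⟨?_, ?_⟩
      · rw [reg_eval, h2]
        have := hw.setNat x 0 0 (s.nat x 0 0)
        rwa [Store.setNat_setNat, Store.setNat_self] at this
      · change (s'.setNat _ _ _ _).nat d 0 0 = _
        rw [Store.setNat_nat_of_ne _ (by omega), h1]
        simp only [hF, hbd, eval]
  refine hmain.mono ?_ fun _ => id
  have hle : bd ≤ s.size + B.slop := B.eval_le s
  simp only [Polynomial.eval_add, Polynomial.eval_mul, Polynomial.eval_X, Polynomial.eval_C]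
  have : (bd + 1) * ((6 + (C.eval s.size + 18)) + 25) ≤
      (s.size + (B.slop + 1)) * (C.eval s.size + 100) := Nat.mul_le_mul (by omega) (by omega)
  omega

/-- The polynomial arises from the structure of the term: costs of subterms add up, and a bounded
count multiplies the cost by a range of polynomial size. Subterms are kept apart by raising `d`. -/
theorem computes_compile {τ : Ty} (t : Tm τ) {d : ℕ} (hd : 1 ≤ d) (ht : t.WF d) :
    ∃ C, Computes (t.compile d) d t.eval C := by
  induction t generalizing d with
  | const c =>
    exact ⟨Polynomial.C 4, fun s => (runs_setReg (e := .const c) (Store.Agree.refl d s) rfl).mono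
      (by simp [NatExpr.cost]) fun _ => id⟩
  | zero =>
    exact ⟨Polynomial.C 4, fun s => (runs_setRReg (e := .zero) (Store.Agree.refl d s) rfl).mono
      (by simp [RealExpr.cost]) fun _ => id⟩
  | one =>
    exact ⟨Polynomial.C 4, fun s => (runs_setRReg (e := .one) (Store.Agree.refl d s) rfl).mono
      (by simp [RealExpr.cost]) fun _ => id⟩
  | natLoad name i j ih₁ ih₂ =>
    obtain ⟨C, hC⟩ := ih₁ hd ht.2.1
    obtain ⟨C', hC'⟩ := ih₂ (d := d + 1) (by omega) (ht.2.2.mono (by omega))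
    refine ⟨_, fun s => hC.bind₂ (T := 10) hd hC' (fun _ _ => j.eval_congr hd ht.2.2) ?_⟩
    intro s' h h1 h2
    refine runs_setReg h ?_
    simp only [Store.result] at h1 h2
    simp [NatExpr.eval, eval, h1, h2, h.nat name ht.1]
  | realLoad name i j ih₁ ih₂ =>
    obtain ⟨C, hC⟩ := ih₁ hd ht.2.1
    obtain ⟨C', hC'⟩ := ih₂ (d := d + 1) (by omega) (ht.2.2.mono (by omega))
    refine ⟨_, fun s => hC.bind₂ (T := 10) hd hC' (fun _ _ => j.eval_congr hd ht.2.2) ?_⟩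
    intro s' h h1 h2
    refine runs_setRReg h ?_
    simp only [Store.result] at h1 h2
    simp [RealExpr.eval, eval, h1, h2, h.real name ht.1]
  | count x B b ih =>
    obtain ⟨C, hC⟩ := ih (d := d + 3) (by omega) (ht.2.2.mono (by omega))
    exact computes_count hd ht.1 ht.2.1 ht.2.2 hC
  | sub a b ih₁ ih₂ =>
    obtain ⟨C, hC⟩ := ih₁ hd ht.1
    obtain ⟨C', hC'⟩ := ih₂ (d := d + 1) (by omega) (ht.2.mono (by omega))
    refine ⟨_, fun s => hC.bind₂ (T := 10) hd hC' (fun _ _ => b.eval_congr hd ht.2) ?_⟩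
    intro s' h h1 h2
    exact runs_setRReg h (congrArg₂ (· - ·) h1 h2)
  | mul a b ih₁ ih₂ =>
    obtain ⟨C, hC⟩ := ih₁ hd ht.1
    obtain ⟨C', hC'⟩ := ih₂ (d := d + 1) (by omega) (ht.2.mono (by omega))
    refine ⟨_, fun s => hC.bind₂ (T := 10) hd hC' (fun _ _ => b.eval_congr hd ht.2) ?_⟩
    intro s' h h1 h2
    exact runs_setRReg h (congrArg₂ (· * ·) h1 h2)
  | div a b ih₁ ih₂ =>
    obtain ⟨C, hC⟩ := ih₁ hd ht.1
    obtain ⟨C', hC'⟩ := ih₂ (d := d + 1) (by omega) (ht.2.mono (by omega))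
    refine ⟨_, fun s => hC.bind₂ (T := 10) hd hC' (fun _ _ => b.eval_congr hd ht.2) ?_⟩
    intro s' h h1 h2
    exact runs_setRReg h (congrArg₂ (· / ·) h1 h2)
  | natLt a b ih₁ ih₂ =>
    obtain ⟨C, hC⟩ := ih₁ hd ht.1
    obtain ⟨C', hC'⟩ := ih₂ (d := d + 1) (by omega) (ht.2.mono (by omega))
    refine ⟨_, fun s => hC.bind₂ (T := 11) hd hC' (fun _ _ => b.eval_congr hd ht.2) ?_⟩
    intro s' h h1 h2
    refine runs_setBool h ?_
    simp only [Store.result] at h1 h2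
    simp only [Test.Holds, reg_eval, h1, h2, eval]
  | natEq a b ih₁ ih₂ =>
    obtain ⟨C, hC⟩ := ih₁ hd ht.1
    obtain ⟨C', hC'⟩ := ih₂ (d := d + 1) (by omega) (ht.2.mono (by omega))
    refine ⟨_, fun s => hC.bind₂ (T := 11) hd hC' (fun _ _ => b.eval_congr hd ht.2) ?_⟩
    intro s' h h1 h2
    refine runs_setBool h ?_
    simp only [Store.result] at h1 h2
    simp only [Test.Holds, reg_eval, h1, h2, eval]
  | realEq a b ih₁ ih₂ =>
    obtain ⟨C, hC⟩ := ih₁ hd ht.1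
    obtain ⟨C', hC'⟩ := ih₂ (d := d + 1) (by omega) (ht.2.mono (by omega))
    refine ⟨_, fun s => hC.bind₂ (T := 11) hd hC' (fun _ _ => b.eval_congr hd ht.2) ?_⟩
    intro s' h h1 h2
    refine runs_setBool h ?_
    simp only [Store.result] at h1 h2
    simp only [Test.Holds, rreg_eval, h1, h2, eval]
  | and a b ih₁ ih₂ =>
    obtain ⟨C, hC⟩ := ih₁ hd ht.1
    obtain ⟨C', hC'⟩ := ih₂ (d := d + 1) (by omega) (ht.2.mono (by omega))
    refine ⟨_, fun s => hC.bind₂ (T := 15) hd hC' (fun _ _ => b.eval_congr hd ht.2) ?_⟩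
    intro s' h h1 h2
    refine runs_setBool h ?_
    simp only [Store.result] at h1 h2
    simp only [Test.Holds, reg_eval, NatExpr.eval, h1, h2, eval]
  | not a ih =>
    obtain ⟨C, hC⟩ := ih hd ht
    refine ⟨C + Polynomial.C 10, fun s => ?_⟩
    rw [Polynomial.eval_add, Polynomial.eval_C]
    refine hC.bind hd fun s' h _ h1 => ?_
    refine runs_setBool h ?_
    simp only [Store.result] at h1
    simp only [Test.Holds, reg_eval, NatExpr.eval, h1, eval]
  | realIte b x y ih₀ ih₁ ih₂ =>
    obtain ⟨C₀, hC₀⟩ := ih₀ hd ht.1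
    obtain ⟨C, hC⟩ := ih₁ hd ht.2.1
    obtain ⟨C', hC'⟩ := ih₂ hd ht.2.2
    refine ⟨C₀ + (Polynomial.C 5 + (C + C')), fun s => ?_⟩
    simp only [Polynomial.eval_add, Polynomial.eval_C]
    refine hC₀.bind hd fun s' h hsz h1 => ?_
    simp only [Store.result] at h1
    refine Runs.cond (fun hb => ?_) (fun hb => ?_)
    · have hb' : b.eval s := h1.mp hb
      rw [← hsz]
      refine (hC s').mono (by omega) fun s'' hs'' => ⟨h.trans hs''.1, ?_⟩
      rw [hs''.2, ← x.eval_congr hd ht.2.1 h]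
      simp [eval, hb']
    · have hb' : ¬ b.eval s := fun hn => hb (h1.mpr hn)
      rw [← hsz]
      refine (hC' s').mono (by omega) fun s'' hs'' => ⟨h.trans hs''.1, ?_⟩
      rw [hs''.2, ← y.eval_congr hd ht.2.2 h]
      simp [eval, hb']

end Tm
end RealRAM

/-! ### Commands: simultaneous assignment and bounded loops -/

namespace RealRAM

/-- `Inv v v'` describes the memory before entry `(v, v')` is treated, in lexicographic order;
`hrow` passes from the end of one row to the beginning of the next. -/
theorem Runs.forLoop₂ {c c' : ℕ} {B B' : Bound} {body : Program} {T b b' : ℕ} {Q : Store → Prop}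
    (hcc : c ≠ c') (Inv : ℕ → ℕ → Store → Prop)
    (hc : ∀ v v' x s, Inv v v' s → Inv v v' (s.setNat c 0 0 x))
    (hc' : ∀ v v' x s, Inv v v' s → Inv v v' (s.setNat c' 0 0 x))
    (hrow : ∀ v s, Inv v b' s → Inv (v + 1) 0 s)
    (hB : ∀ v v' s, Inv v v' s → B.eval s = b ∧ B'.eval s = b')
    (hstep : ∀ v < b, ∀ v' < b', ∀ s, Inv v v' s → s.nat c 0 0 = v → s.nat c' 0 0 = v' →
      Runs body s T fun s' => s'.nat c 0 0 = v ∧ s'.nat c' 0 0 = v' ∧ Inv v (v' + 1) s')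
    {s : Store} (h0 : Inv 0 0 s) (hQ : ∀ s, Inv b 0 s → Q s) :
    Runs (RealRAM.forLoop c B (RealRAM.forLoop c' B' body)) s
      ((b + 1) * ((b' + 1) * (T + 25) + 25)) Q := by
  refine Runs.forLoop (b := b) (fun v s => Inv v 0 s ∧ s.nat c 0 0 = v)
    ⟨hc _ _ _ _ h0, by simp⟩ (fun v s h => ⟨h.2, (hB _ _ _ h.1).1⟩) ?_ (fun s h => hQ s h.1)
  rintro v hv s ⟨hs, hsc⟩
  refine Runs.forLoop (b := b')
    (fun v' s => Inv v v' s ∧ s.nat c 0 0 = v ∧ s.nat c' 0 0 = v')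
    ⟨hc' _ _ _ _ hs, by rw [Store.setNat_nat_of_ne _ hcc, hsc], by simp⟩
    (fun v' s h => ⟨h.2.2, (hB _ _ _ h.1).2⟩) ?_ ?_
  · rintro v' hv' s ⟨h1, h2, h3⟩
    refine (hstep v hv v' hv' s h1 h2 h3).mono le_rfl ?_
    rintro s' ⟨h1, h2, h3⟩
    exact ⟨h2, hc' _ _ _ _ h3, by rw [Store.setNat_nat_of_ne _ hcc, h1], by simp⟩
  · rintro s ⟨h1, h2, h3⟩
    exact ⟨h2, hc _ _ _ _ (hrow _ _ h1), by simp⟩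

/-- Commands. `realMap name x y B B' e` assigns `e` to the entries `(x, y)` with `x < B`, `y < B'`
of the real array `name`, simultaneously. -/
inductive Cmd : Type
  | natSet (name i j : ℕ) (e : Tm .nat)
  | realMap (name x y : ℕ) (B B' : Bound) (e : Tm .real)
  | seq (p q : Cmd)
  | ite (b : Tm .bool) (p : Cmd)
  | loop (x : ℕ) (B : Bound) (p : Cmd)

/-- Replace the real array `name`. -/
def Store.setArray (s : Store) (name : ℕ) (f : ℕ → ℕ → ℝ) : Store where
  nat := s.nat
  real := fun name' => if name' = name then f else s.real name'

theorem Store.Agree.setArray {d : ℕ} {s s' : Store} (h : s.Agree d s') (name : ℕ)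
    (f : ℕ → ℕ → ℝ) : (s.setArray name f).Agree d (s'.setArray name f) := by
  refine ⟨h.nat, fun n hn => ?_⟩
  simp [Store.setArray, h.real n hn]

namespace Cmd

open Classical in
noncomputable def sem : Cmd → Store → Store
  | natSet name i j e, s => s.setNat name i j (e.eval s)
  | realMap name x y B B' e, s => s.setArray name fun i j =>
      if i < B.eval s ∧ j < B'.eval s then e.eval ((s.setNat x 0 0 i).setNat y 0 0 j)
      else s.real name i j
  | seq p q, s => q.sem (p.sem s)
  | ite b p, s => if b.eval s then p.sem s else s
  | loop x B p, s => Nat.rec s (fun v s' => p.sem (s'.setNat x 0 0 v)) (B.eval s)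

/-- The array `0` of natural numbers is protected from writing because it holds the format of the
input, on which all ranges depend. -/
def WF (d : ℕ) : Cmd → Prop
  | natSet name _ _ e => name ≠ 0 ∧ name < d ∧ e.WF d
  | realMap name x y _ _ e => name < d ∧ x ≠ 0 ∧ x < d ∧ y ≠ 0 ∧ y < d ∧ e.WF d
  | seq p q => p.WF d ∧ q.WF d
  | ite b p => b.WF d ∧ p.WF d
  | loop x _ p => x ≠ 0 ∧ x < d ∧ p.WF d

theorem WF.mono {c : Cmd} {d d' : ℕ} (hd : d ≤ d') (h : c.WF d) : c.WF d' := by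
  induction c with
  | natSet name i j e => exact ⟨h.1, h.2.1.trans_le hd, h.2.2.mono hd⟩
  | realMap name x y B B' e =>
    obtain ⟨h1, h2, h3, h4, h5, h6⟩ := h
    exact ⟨by omega, h2, by omega, h4, by omega, h6.mono hd⟩
  | seq p q ihp ihq => exact ⟨ihp h.1, ihq h.2⟩
  | ite b p ih => exact ⟨h.1.mono hd, ih h.2⟩
  | loop x B p ih => exact ⟨h.1, h.2.1.trans_le hd, ih h.2.2⟩

theorem sem_nat_of_ge {c : Cmd} {d : ℕ} (hc : c.WF d) (s : Store) {name : ℕ} (hn : d ≤ name) :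
    (c.sem s).nat name = s.nat name := by
  induction c generalizing s with
  | natSet name' i j e =>
    have := hc.2.1
    exact Store.setNat_nat_of_ne _ (by omega) _ _ _
  | realMap name' x y B B' e => rfl
  | seq p q ihp ihq => rw [sem, ihq hc.2, ihp hc.1]
  | ite b p ih =>
    rw [sem]
    split_ifs
    · exact ih hc.2 s
    · rfl
  | loop x B p ih =>
    rw [sem]
    have hx := hc.2.1
    induction B.eval s with
    | zero => rfl
    | succ v ihv =>
      change (p.sem _).nat name = _
      rw [ih hc.2.2, Store.setNat_nat_of_ne _ (by omega), ihv]

theorem sem_nat_zero {c : Cmd} {d : ℕ} (hc : c.WF d) (s : Store) :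
    (c.sem s).nat 0 = s.nat 0 := by
  induction c generalizing s with
  | natSet name' i j e => exact Store.setNat_nat_of_ne _ (Ne.symm hc.1) _ _ _
  | realMap name' x y B B' e => rfl
  | seq p q ihp ihq => rw [sem, ihq hc.2, ihp hc.1]
  | ite b p ih =>
    rw [sem]
    split_ifs
    · exact ih hc.2 s
    · rfl
  | loop x B p ih =>
    rw [sem]
    induction B.eval s with
    | zero => rfl
    | succ v ihv =>
      change (p.sem _).nat 0 = _
      rw [ih hc.2.2, Store.setNat_nat_of_ne _ (Ne.symm hc.1), ihv]

theorem _root_.RealRAM.Bound.eval_eq_of_nat_zero (B : Bound) {s s' : Store}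
    (h : s.nat 0 = s'.nat 0) : B.eval s = B.eval s' := by
  cases B <;> simp [Bound.eval, h]

/-- The compiled program reaches the intended memory only up to scratch arrays; this permits
continuing from there. -/
theorem sem_congr {c : Cmd} {d : ℕ} (hd : 1 ≤ d) (hc : c.WF d) {s s' : Store}
    (h : s.Agree d s') : (c.sem s).Agree d (c.sem s') := by
  induction c generalizing s s' with
  | natSet name' i j e =>
    rw [sem, sem, e.eval_congr hd hc.2.2 h]
    exact h.setNat _ _ _ _
  | realMap name' x y B B' e =>
    obtain ⟨h1, h2, h3, h4, h5, h6⟩ := hc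
    rw [sem, sem]
    convert h.setArray name' _ using 4 with i j
    rw [h.bound_eq hd B, h.bound_eq hd B', h.real _ h1,
      e.eval_congr hd h6 ((h.setNat x 0 0 i).setNat y 0 0 j)]
  | seq p q ihp ihq => exact ihq hc.2 (ihp hc.1 h)
  | ite b p ih =>
    have hb : b.eval s ↔ b.eval s' := iff_of_eq (b.eval_congr hd hc.1 h)
    rw [sem, sem]
    by_cases hb' : b.eval s
    · rw [if_pos hb', if_pos (hb.1 hb')]
      exact ih hc.2 h
    · rw [if_neg hb', if_neg fun h' => hb' (hb.2 h')]
      exact h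
  | loop x B p ih =>
    rw [sem, sem, h.bound_eq hd B]
    induction B.eval s' with
    | zero => exact h
    | succ v ihv => exact ih hc.2.2 (ihv.setNat x 0 0 v)

/-- A program that executes the command; it uses arrays with names at least `d` as scratch
space. -/
def compile : Cmd → ℕ → Program
  | natSet name i j e, d => .seq (e.compile d) (.natStore name (.const i) (.const j) (reg d))
  | realMap name x y B B' e, d =>
    -- All values are computed into the scratch array `d` and copied afterwards, because `e` may
    -- read the array that is overwritten.
    .seq (setReg (d + 1) (reg x)) (.seq (setReg (d + 2) (reg y))
      (.seq (forLoop (d + 3) B (forLoop (d + 4) B' (.seq (setReg x (reg (d + 3)))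
          (.seq (setReg y (reg (d + 4))) (.seq (e.compile (d + 5))
            (.realStore d (reg (d + 3)) (reg (d + 4)) (rreg (d + 5))))))))
        (.seq (setReg x (reg (d + 1))) (.seq (setReg y (reg (d + 2)))
          (forLoop (d + 3) B (forLoop (d + 4) B'
            (.realStore name (reg (d + 3)) (reg (d + 4))
              (.load d (reg (d + 3)) (reg (d + 4))))))))))
  | seq p q, d => .seq (p.compile d) (q.compile d)
  | ite b p, d => .seq (b.compile d) (.cond (.natEq (reg d) (.const 1)) (p.compile d) .skip)
  | loop x B p, d => forLoop d B (.seq (setReg x (reg d)) (p.compile (d + 1)))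

/-- The program `p` has the effect `f` on the arrays below `d`, within time `C`. -/
def Implements (p : Program) (d : ℕ) (f : Store → Store) (C : Polynomial ℕ) : Prop :=
  ∀ s, Runs p s (C.eval s.size) fun s' => (f s).Agree d s'

open Classical in
theorem implements_realMap {name x y : ℕ} {B B' : Bound} {e : Tm .real} {d : ℕ} (hd : 1 ≤ d)
    (hc : (realMap name x y B B' e).WF d) :
    ∃ C, Implements ((realMap name x y B B' e).compile d) d (realMap name x y B B' e).sem C := by
  obtain ⟨hname, hx, hxd, hy, hyd, he⟩ := hc
  obtain ⟨C, hC⟩ := e.computes_compile (d := d + 5) (by omega) (he.mono (by omega))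
  refine ⟨(Polynomial.X + Polynomial.C (B.slop + 1)) * ((Polynomial.X + Polynomial.C (B'.slop + 1))
    * (C + Polynomial.C 100) + Polynomial.C 25) + ((Polynomial.X + Polynomial.C (B.slop + 1)) *
    ((Polynomial.X + Polynomial.C (B'.slop + 1)) * Polynomial.C 100 + Polynomial.C 25)) +
      Polynomial.C 100, fun s => ?_⟩
  set b := B.eval s with hb
  set b' := B'.eval s with hb'
  set E : ℕ → ℕ → ℝ := fun i j => e.eval ((s.setNat x 0 0 i).setNat y 0 0 j) with hE
  have hmain : Runs ((realMap name x y B B' e).compile d) s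
      (6 + (6 + ((b + 1) * ((b' + 1) * ((6 + (6 + (C.eval s.size + 10))) + 25) + 25) + (6 + (6 +
        (b + 1) * ((b' + 1) * (14 + 25) + 25))))))
      fun s' => ((realMap name x y B B' e).sem s).Agree d s' := by
    rw [compile]
    refine Runs.seq (Runs.setReg (Runs.seq (Runs.setReg (Runs.seq ?_))))
    -- First pass: below `d` only the bound variables may have changed, and the scratch array holds
    -- the new values at all positions before `(v, v')`.
    refine Runs.forLoop₂ (b := b) (b' := b') (by omega)
      (fun v v' s' => (∃ w w', Store.Agree d ((s.setNat x 0 0 w).setNat y 0 0 w') s') ∧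
        s'.nat (d + 1) 0 0 = s.nat x 0 0 ∧ s'.nat (d + 2) 0 0 = s.nat y 0 0 ∧
        ∀ i j, i < v ∨ (i = v ∧ j < v') → j < b' → s'.real d i j = E i j) ?_ ?_ ?_ ?_ ?_ ?_ ?_
    · rintro v v' z s' ⟨⟨w, w', h1⟩, h2, h3, h4⟩
      exact ⟨⟨w, w', h1.setNat_right (by omega) _ _ _⟩, by simp [Store.setNat, h2],
        by simp [Store.setNat, h3], h4⟩
    · rintro v v' z s' ⟨⟨w, w', h1⟩, h2, h3, h4⟩
      exact ⟨⟨w, w', h1.setNat_right (by omega) _ _ _⟩, by simp [Store.setNat, h2],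
        by simp [Store.setNat, h3], h4⟩
    · rintro v s' ⟨h1, h2, h3, h4⟩
      exact ⟨h1, h2, h3, fun i j hij hj => h4 i j (by omega) hj⟩
    · rintro v v' s' ⟨⟨w, w', h1⟩, h2, h3, h4⟩
      have : s'.nat 0 = s.nat 0 := by
        rw [← h1.nat 0 (by omega), Store.setNat_nat_of_ne _ (Ne.symm hy),
          Store.setNat_nat_of_ne _ (Ne.symm hx)]
      exact ⟨B.eval_eq_of_nat_zero this, B'.eval_eq_of_nat_zero this⟩
    · rintro v hv v' hv' s' ⟨⟨w, w', h1⟩, h2, h3, h4⟩ hcv hcv'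
      refine Runs.seq (Runs.setReg (Runs.seq (Runs.setReg ?_)))
      set s₁ := (s'.setNat x 0 0 ((reg (d + 3)).eval s')).setNat y 0 0
        ((reg (d + 4)).eval (s'.setNat x 0 0 ((reg (d + 3)).eval s'))) with hs₁
      have hag : Store.Agree d ((s.setNat x 0 0 v).setNat y 0 0 v') s₁ := by
        have e1 : (reg (d + 4)).eval (s'.setNat x 0 0 ((reg (d + 3)).eval s')) = v' := by
          rw [reg_eval, Store.setNat_nat_of_ne _ (by omega), hcv']
        rw [hs₁, e1, reg_eval, hcv]
        refine ⟨fun n hn => ?_, h1.real⟩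
        have := h1.nat n hn
        funext p q
        have := congrFun (congrFun this p) q
        simp only [Store.setNat] at this ⊢
        split_ifs at this ⊢ <;> first | rfl | exact this
      have hsz : s₁.size = s.size := by
        rw [← hag.size_eq hd]
        simp [Store.size, Store.setNat, Ne.symm hx, Ne.symm hy]
      rw [← hsz]
      refine hC.bind (by omega) fun s₂ h₂ _ r₂ => ?_
      have n1 : ∀ k, 1 ≤ k → k ≤ 4 → s₂.nat (d + k) 0 0 = s'.nat (d + k) 0 0 := by
        intro k hk hk'
        rw [← h₂.nat _ (by omega), hs₁, Store.setNat_nat_of_ne _ (by omega),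
          Store.setNat_nat_of_ne _ (by omega)]
      have r₂' : s₂.real (d + 5) 0 0 = E v v' := by
        change s₂.result (d + 5) .real = _
        rw [r₂]
        exact (e.eval_congr hd he hag).symm
      refine Runs.realStore ⟨?_, ?_, ⟨v, v', ?_⟩, ?_, ?_, ?_⟩
      · change s₂.nat (d + 3) 0 0 = v
        rw [n1 3 (by omega) (by omega), hcv]
      · change s₂.nat (d + 4) 0 0 = v'
        rw [n1 4 (by omega) (by omega), hcv']
      · exact (hag.trans (h₂.mono (by omega))).setReal_right le_rfl _ _ _
      · change s₂.nat (d + 1) 0 0 = _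
        rw [n1 1 (by omega) (by omega), h2]
      · change s₂.nat (d + 2) 0 0 = _
        rw [n1 2 (by omega) (by omega), h3]
      · intro i j hij hj
        simp only [reg_eval, rreg_eval, n1 3 (by omega) (by omega), n1 4 (by omega) (by omega),
          hcv, hcv', r₂', Store.setReal, true_and]
        split_ifs with hh
        · rw [hh.1, hh.2]
        · rw [← h₂.real d (by omega)]
          exact h4 i j (by omega) hj
    · refine ⟨⟨s.nat x 0 0, s.nat y 0 0, ?_⟩, ?_, ?_, fun i j hij => by omega⟩
      · rw [Store.setNat_self, Store.setNat_self]
        exact ((Store.Agree.refl d s).setNat_right (by omega) _ _ _).setNat_right (by omega) _ _ _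
      · simp [Store.setNat]
      · simp [Store.setNat, show y ≠ d + 1 by omega]
    · rintro s' ⟨⟨w, w', h1⟩, h2, h3, h4⟩
      refine Runs.seq (Runs.setReg (Runs.seq (Runs.setReg ?_)))
      -- Second pass: the positions before `(v, v')` have been copied, all others still hold the old
      -- entries.
      refine Runs.forLoop₂ (b := b) (b' := b') (by omega)
        (fun v v' t => (∀ n < d, t.nat n = s.nat n) ∧ (∀ n < d, n ≠ name → t.real n = s.real n) ∧
          (∀ i < b, ∀ j < b', t.real d i j = E i j) ∧
          ∀ i j, t.real name i j = if (i < v ∨ (i = v ∧ j < v')) ∧ j < b' then E i j else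
            s.real name i j) ?_ ?_ ?_ ?_ ?_ ?_ ?_
      · rintro v v' z t ⟨g1, g2, g3, g4⟩
        exact ⟨fun n hn => by rw [Store.setNat_nat_of_ne _ (by omega), g1 n hn], g2, g3, g4⟩
      · rintro v v' z t ⟨g1, g2, g3, g4⟩
        exact ⟨fun n hn => by rw [Store.setNat_nat_of_ne _ (by omega), g1 n hn], g2, g3, g4⟩
      · rintro v t ⟨g1, g2, g3, g4⟩
        refine ⟨g1, g2, g3, fun i j => ?_⟩
        rw [g4]
        refine if_congr ?_ rfl rfl
        omega
      · rintro v v' t ⟨g1, g2, g3, g4⟩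
        have : t.nat 0 = s.nat 0 := g1 0 (by omega)
        exact ⟨B.eval_eq_of_nat_zero this, B'.eval_eq_of_nat_zero this⟩
      · rintro v hv v' hv' t ⟨g1, g2, g3, g4⟩ hcv hcv'
        refine Runs.realStore ⟨hcv, hcv', g1, ?_, ?_, ?_⟩
        · intro n hn hne
          rw [Store.setReal_real_of_ne _ hne, g2 n hn hne]
        · intro i hi j hj
          rw [Store.setReal_real_of_ne _ (by omega), g3 i hi j hj]
        · intro i j
          simp only [RealExpr.eval, reg_eval, hcv, hcv', Store.setReal, true_and, g3 v hv v' hv']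
          split_ifs with q1 q2
          · rw [q1.1, q1.2]
          · omega
          · rw [g4, if_pos (by omega)]
          · rw [g4, if_neg (by omega)]
      · refine ⟨?_, ?_, ?_, ?_⟩
        · intro n hn
          funext p q
          have := congrFun (congrFun (h1.nat n hn) p) q
          rw [reg_eval, reg_eval, Store.setNat_nat_of_ne _ (show d + 2 ≠ x by omega), h3, h2]
          simp only [Store.setNat] at this ⊢
          split_ifs at this ⊢ with q1 q2
          · rw [q1.1, q1.2.1, q1.2.2]
          · rw [q2.1, q2.2.1, q2.2.2]
          · exact this.symm
        · intro n hn hne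
          exact (h1.real n hn).symm
        · intro i hi j hj
          exact h4 i j (Or.inl hi) hj
        · intro i j
          rw [if_neg (by omega)]
          exact congrFun (congrFun (h1.real name hname).symm i) j
      · rintro t ⟨g1, g2, g3, g4⟩
        refine ⟨fun n hn => (g1 n hn).symm, fun n hn => ?_⟩
        by_cases hne : n = name
        · subst hne
          funext i j
          rw [g4]
          simp only [sem, Store.setArray, if_true]
          exact if_congr (by omega) rfl rfl
        · simp only [sem, Store.setArray, if_neg hne]
          exact (g2 n hn hne).symm
  refine hmain.mono ?_ fun _ => id
  have hle : b ≤ s.size + B.slop := B.eval_le s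
  have hle' : b' ≤ s.size + B'.slop := B'.eval_le s
  simp only [Polynomial.eval_add, Polynomial.eval_mul, Polynomial.eval_X, Polynomial.eval_C]
  have h1 : (b + 1) * ((b' + 1) * ((6 + (6 + (C.eval s.size + 10))) + 25) + 25) ≤
      (s.size + (B.slop + 1)) * ((s.size + (B'.slop + 1)) * (C.eval s.size + 100) + 25) :=
    Nat.mul_le_mul (by omega) (Nat.add_le_add_right (Nat.mul_le_mul (by omega) (by omega)) _)
  have h2 : (b + 1) * ((b' + 1) * (14 + 25) + 25) ≤
      (s.size + (B.slop + 1)) * ((s.size + (B'.slop + 1)) * 100 + 25) :=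
    Nat.mul_le_mul (by omega) (Nat.add_le_add_right (Nat.mul_le_mul (by omega) (by omega)) _)
  omega

/-- From here on the running time is settled by well-formedness alone, and an algorithm can be
verified on `sem`. -/
theorem implements_compile (c : Cmd) {d : ℕ} (hd : 1 ≤ d) (hc : c.WF d) :
    ∃ C, Implements (c.compile d) d c.sem C := by
  induction c generalizing d with
  | natSet name i j e =>
    obtain ⟨C, hC⟩ := e.computes_compile hd hc.2.2
    refine ⟨C + Polynomial.C 6, fun s => ?_⟩
    rw [Polynomial.eval_add, Polynomial.eval_C]
    refine hC.bind hd fun s' h _ h1 => ?_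
    refine Runs.natStore ?_
    have := h.setNat name i j (e.eval s)
    simp only [Store.result] at h1
    simp only [NatExpr.eval, reg_eval, h1]
    exact this
  | realMap name x y B B' e => exact implements_realMap hd hc
  | seq p q ihp ihq =>
    obtain ⟨C, hC⟩ := ihp hd hc.1
    obtain ⟨C', hC'⟩ := ihq hd hc.2
    refine ⟨C + C', fun s => ?_⟩
    rw [Polynomial.eval_add]
    refine Runs.seq ((hC s).mono le_rfl fun s' hs' => ?_)
    have hsz : s.size = s'.size := by
      rw [← hs'.size_eq hd]
      simp [Store.size, sem_nat_zero hc.1]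
    rw [hsz]
    exact (hC' s').mono le_rfl fun s'' hs'' => (sem_congr hd hc.2 hs').trans hs''
  | ite b p ih =>
    obtain ⟨C, hC⟩ := b.computes_compile hd hc.1
    obtain ⟨C', hC'⟩ := ih hd hc.2
    refine ⟨C + (Polynomial.C 5 + (C' + Polynomial.C 1)), fun s => ?_⟩
    simp only [Polynomial.eval_add, Polynomial.eval_C]
    refine hC.bind hd fun s' h hsz h1 => ?_
    simp only [Store.result] at h1
    refine Runs.cond (fun hb => ?_) (fun hb => ?_)
    · have hb' : b.eval s := h1.mp hb
      rw [← hsz]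
      refine (hC' s').mono (by omega) fun s'' hs'' => ?_
      rw [sem, if_pos hb']
      exact (sem_congr hd hc.2 h).trans hs''
    · have hb' : ¬ b.eval s := fun hn => hb (h1.mpr hn)
      rw [sem, if_neg hb']
      exact (Runs.skip h).mono (by omega) fun _ => id
  | loop x B p ih =>
    obtain ⟨hx, hxd, hp⟩ := hc
    obtain ⟨C, hC⟩ := ih (d := d + 1) (by omega) (hp.mono (by omega))
    refine ⟨(Polynomial.X + Polynomial.C (B.slop + 1)) * (C + Polynomial.C 50), fun s => ?_⟩
    have hmain : Runs ((loop x B p).compile d) s ((B.eval s + 1) * ((6 + C.eval s.size) + 25))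
        fun s' => ((loop x B p).sem s).Agree d s' := by
      have h0 : ∀ v, (Nat.rec s (fun v s' => p.sem (s'.setNat x 0 0 v)) v : Store).nat 0 =
          s.nat 0 := by
        intro v
        induction v with
        | zero => rfl
        | succ v ihv =>
          change (p.sem _).nat 0 = _
          rw [sem_nat_zero hp, Store.setNat_nat_of_ne _ (Ne.symm hx), ihv]
      refine Runs.forLoop (b := B.eval s) (fun v s' =>
        Store.Agree d (Nat.rec s (fun v s' => p.sem (s'.setNat x 0 0 v)) v) s' ∧
        s'.nat d 0 0 = v) ⟨?_, ?_⟩ ?_ ?_ ?_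
      · exact (Store.Agree.refl d s).setNat_right le_rfl _ _ _
      · simp
      · rintro v s' ⟨h1, h2⟩
        exact ⟨h2, B.eval_eq_of_nat_zero ((h1.nat 0 (by omega)).symm.trans (h0 v))⟩
      · rintro v hv s' ⟨h1, h2⟩
        refine Runs.seq (Runs.setReg ?_)
        rw [reg_eval, h2]
        have hag := h1.setNat x 0 0 v
        have hsz : s.size = (s'.setNat x 0 0 v).size := by
          rw [← hag.size_eq hd]
          simp only [Store.size, Store.setNat_nat_of_ne _ (Ne.symm hx), h0]
        rw [hsz]
        refine (hC _).mono le_rfl fun s'' hs'' => ⟨?_, ?_, ?_⟩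
        · rw [← hs''.nat d (by omega), sem_nat_of_ge hp _ le_rfl,
            Store.setNat_nat_of_ne _ (by omega), h2]
        · exact ((sem_congr hd hp hag).trans (hs''.mono (by omega))).setNat_right le_rfl _ _ _
        · simp
      · exact fun s' h => h.1
    refine hmain.mono ?_ fun _ => id
    have hle : B.eval s ≤ s.size + B.slop := B.eval_le s
    simp only [Polynomial.eval_add, Polynomial.eval_mul, Polynomial.eval_X, Polynomial.eval_C]
    exact Nat.mul_le_mul (by omega) (by omega)

end Cmd
end RealRAM

/-! ### Facets of a polytope and the rows of its slack matrices -/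

namespace GluedProduct

open Filter Topology

theorem affine_apply_add_smul {E : Type*} [AddCommGroup E] [Module ℝ E] (f : E →ᵃ[ℝ] ℝ)
    (x u : E) (t : ℝ) : f (x + t • u) = f x + t * f.linear u := by
  have := f.map_vadd x (t • u)
  simp only [vadd_eq_add, map_smul, smul_eq_mul] at this
  rw [add_comm x, this, add_comm]

theorem affine_apply_sub {E F : Type*} [AddCommGroup E] [Module ℝ E] [AddCommGroup F] [Module ℝ F]
    (f : E →ᵃ[ℝ] F) (x y : E) : f.linear (x - y) = f x - f y := by
  simpa using f.linearMap_vsub x y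

theorem affine_apply_sum {E κ : Type*} [AddCommGroup E] [Module ℝ E] (f : E →ᵃ[ℝ] ℝ) {T : Finset κ}
    {w : κ → ℝ} (hw : ∑ j ∈ T, w j = 1) (v : κ → E) :
    f (∑ j ∈ T, w j • v j) = ∑ j ∈ T, w j * f (v j) := by
  have := T.map_affineCombination v w hw f
  rw [Finset.affineCombination_eq_linear_combination _ _ _ hw,
    Finset.affineCombination_eq_linear_combination _ _ _ hw] at this
  simpa using this

/-- Affine maps that agree on a set agree on its affine span. -/
theorem affine_eqOn_affineSpan {E F : Type*} [AddCommGroup E] [Module ℝ E] [AddCommGroup F]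
    [Module ℝ F] {f g : E →ᵃ[ℝ] F} {s : Set E} (h : ∀ x ∈ s, f x = g x) {x : E}
    (hx : x ∈ affineSpan ℝ s) : f x = g x := by
  refine affineSpan_induction (p := fun x => f x = g x) hx h fun c u v w hu hv hw => ?_
  · rw [f.map_vadd, g.map_vadd, map_smul, map_smul, f.linearMap_vsub, g.linearMap_vsub, hu, hv, hw]

theorem linear_eq_zero_of_vectorSpan {E F : Type*} [AddCommGroup E] [Module ℝ E] [AddCommGroup F]
    [Module ℝ F] {f : E →ₗ[ℝ] F} {s : Set E} (h : ∀ x ∈ s, ∀ y ∈ s, f (x - y) = 0) {u : E}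
    (hu : u ∈ vectorSpan ℝ s) : f u = 0 := by
  have : vectorSpan ℝ s ≤ LinearMap.ker f := by
    rw [vectorSpan_def, Submodule.span_le]
    rintro _ ⟨x, hx, y, hy, rfl⟩
    simpa using h x hx y hy
  exact this hu

/-- A row of a nonnegative matrix is a facet row if it is nonzero and its support is minimal among
the supports of the nonzero rows. -/
def FacetRow {ι κ : Type*} (S : ι → κ → ℝ) (i : ι) : Prop :=
  (∃ j, S i j ≠ 0) ∧
    ∀ l, (∃ j, S l j ≠ 0) → (∀ j, S l j ≠ 0 → S i j ≠ 0) → ∀ j, S i j ≠ 0 → S l j ≠ 0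

/-- The points `v j` are the vertices of a polytope, and the polytope is described, inside its
affine hull, by the inequalities `σ i ≥ 0`. -/
structure IsSlackSystem {E ι κ : Type*} [AddCommGroup E] [Module ℝ E] (v : κ → E)
    (σ : ι → E →ᵃ[ℝ] ℝ) : Prop where
  injective : Function.Injective v
  extreme : ∀ j, v j ∈ (convexHull ℝ (range v)).extremePoints ℝ
  nonneg : ∀ i j, 0 ≤ σ i (v j)
  mem : ∀ x ∈ affineSpan ℝ (range v), (∀ i, 0 ≤ σ i x) → x ∈ convexHull ℝ (range v)

/-- The affine function `g` spans the functions that vanish on the vertices at which `g`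
vanishes. -/
def FacetProperty {E κ : Type*} [AddCommGroup E] [Module ℝ E] (v : κ → E) (g : E →ᵃ[ℝ] ℝ) :
    Prop :=
  ∀ h : E →ᵃ[ℝ] ℝ, (∀ j, g (v j) = 0 → h (v j) = 0) →
    ∃ c : ℝ, ∀ x ∈ affineSpan ℝ (range v), h x = c * g x

theorem nonneg_of_mem_convexHull {E κ : Type*} [AddCommGroup E] [Module ℝ E] {v : κ → E}
    {g : E →ᵃ[ℝ] ℝ} (hg : ∀ j, 0 ≤ g (v j)) {x : E} (hx : x ∈ convexHull ℝ (range v)) :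
    0 ≤ g x := by
  have hconv : Convex ℝ (g ⁻¹' Ici 0) := (convex_Ici 0).affine_preimage g
  exact convexHull_min (by rintro _ ⟨j, rfl⟩; exact hg j) hconv hx

/-- The points with `0 ≤ g` at which `g = 0` forces `h = 0` form a convex set: if `g` vanishes at a
convex combination of such points, it vanishes at every point of positive weight. -/
theorem eq_zero_of_mem_face {E κ : Type*} [AddCommGroup E] [Module ℝ E] {v : κ → E}
    {g h : E →ᵃ[ℝ] ℝ} (hg : ∀ j, 0 ≤ g (v j)) (hh : ∀ j, g (v j) = 0 → h (v j) = 0) {x : E}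
    (hx : x ∈ convexHull ℝ (range v)) (hx0 : g x = 0) : h x = 0 := by
  have hconv : Convex ℝ {x | 0 ≤ g x ∧ (g x = 0 → h x = 0)} := by
    rintro x ⟨hx, hx'⟩ y ⟨hy, hy'⟩ a b ha hb hab
    rw [mem_ofPred_eq, Convex.combo_affine_apply hab, Convex.combo_affine_apply hab]
    simp only [smul_eq_mul]
    have h1 := mul_nonneg ha hx
    have h2 := mul_nonneg hb hy
    refine ⟨by linarith, fun h0 => ?_⟩
    have e1 : a * g x = 0 := by linarith
    have e2 : b * g y = 0 := by linarith
    have e3 : a * h x = 0 := by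
      rcases mul_eq_zero.1 e1 with h | h
      · simp [h]
      · simp [hx' h]
    have e4 : b * h y = 0 := by
      rcases mul_eq_zero.1 e2 with h | h
      · simp [h]
      · simp [hy' h]
    linarith
  exact (convexHull_min (by rintro _ ⟨j, rfl⟩; exact ⟨hg j, hh j⟩) hconv hx).2 hx0

theorem exists_vertex_eq_zero {E κ : Type*} [AddCommGroup E] [Module ℝ E] {v : κ → E}
    {g : E →ᵃ[ℝ] ℝ} (hg : ∀ j, 0 ≤ g (v j)) {x : E} (hx : x ∈ convexHull ℝ (range v))
    (hx0 : g x = 0) : ∃ j, g (v j) = 0 := by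
  by_contra! hne
  have hconv : Convex ℝ (g ⁻¹' Ioi 0) := (convex_Ioi 0).affine_preimage g
  have := convexHull_min (by rintro _ ⟨j, rfl⟩; exact (hg j).lt_of_ne' (hne j)) hconv hx
  exact (ne_of_gt this) hx0

/-! ### Irredundant descriptions of a polytope and facet rows -/

section Normed

variable {E ι κ : Type*} [NormedAddCommGroup E] [NormedSpace ℝ E]
  {v : κ → E} {σ : ι → E →ᵃ[ℝ] ℝ}

/-- A polytope is bounded. If all its points have norm at most `R`, the parameter `(R + ‖p‖ + 1) /
‖u‖` leads too far away from `p`. -/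
theorem eq_zero_of_line_subset [Finite κ] {p u : E}
    (h : ∀ t : ℝ, p + t • u ∈ convexHull ℝ (range v)) : u = 0 := by
  obtain ⟨R, hR⟩ := ((Set.finite_range v).isCompact_convexHull ℝ).isBounded.exists_norm_le
  by_contra hu
  have hu' : 0 < ‖u‖ := norm_pos_iff.2 hu
  have h1 := hR _ (h ((R + ‖p‖ + 1) / ‖u‖))
  have h0 := hR _ (h 0)
  have hR0 : 0 ≤ R := (norm_nonneg _).trans h0
  have h2 : ‖((R + ‖p‖ + 1) / ‖u‖) • u‖ = R + ‖p‖ + 1 := by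
    rw [norm_smul, Real.norm_of_nonneg (by positivity)]
    field_simp
  have h3 := norm_sub_le (p + ((R + ‖p‖ + 1) / ‖u‖) • u) p
  rw [add_sub_cancel_left, h2] at h3
  linarith

/-- The rows in `J` describe the polytope inside its affine hull. -/
def Defines (v : κ → E) (σ : ι → E →ᵃ[ℝ] ℝ) (J : Set ι) : Prop :=
  ∀ x ∈ affineSpan ℝ (range v), (∀ i ∈ J, 0 ≤ σ i x) → x ∈ convexHull ℝ (range v)

theorem add_smul_mem_affineSpan {x u : E} (hx : x ∈ affineSpan ℝ (range v))
    (hu : u ∈ vectorSpan ℝ (range v)) (t : ℝ) : x + t • u ∈ affineSpan ℝ (range v) := by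
  rw [add_comm]
  exact vadd_mem_affineSpan_of_mem_affineSpan_of_mem_vectorSpan hx (Submodule.smul_mem _ t hu)

/-- A row that is positive at `z` stays positive nearby, and a row whose linear part kills `u` does
not change at all; there are only finitely many rows. -/
theorem Defines.eventually_mem [Finite ι] {J : Set ι} (hJ : Defines v σ J) {z u : E}
    (hz : z ∈ affineSpan ℝ (range v)) (hu : u ∈ vectorSpan ℝ (range v))
    (h : ∀ i ∈ J, 0 < σ i z ∨ (σ i z = 0 ∧ (σ i).linear u = 0)) :
    ∀ᶠ t : ℝ in 𝓝[>] 0, z + t • u ∈ convexHull ℝ (range v) := by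
  have key : ∀ i, ∀ᶠ t : ℝ in 𝓝 0, i ∈ J → 0 ≤ σ i (z + t • u) := by
    intro i
    by_cases hi : i ∈ J
    · rcases h i hi with h | ⟨h, h'⟩
      · have hc : Continuous fun t : ℝ => σ i z + t * (σ i).linear u := by fun_prop
        have := hc.tendsto 0
        simp only [zero_mul, add_zero] at this
        filter_upwards [this.eventually (lt_mem_nhds h)] with t ht _
        rw [affine_apply_add_smul]
        exact ht.le
      · exact Eventually.of_forall fun t _ => by rw [affine_apply_add_smul, h, h']; simp
    · exact Eventually.of_forall fun t h => absurd h hi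
  filter_upwards [nhdsWithin_le_nhds (eventually_all.2 key)] with t ht
  exact hJ _ (add_smul_mem_affineSpan hz hu t) fun i hi => ht i hi

theorem exists_minimal_defines [Finite ι] (hS : IsSlackSystem v σ) :
    ∃ J : Set ι, Defines v σ J ∧ ∀ i ∈ J, ¬ Defines v σ (J \ {i}) := by
  obtain ⟨J, hJ⟩ := (Set.toFinite {J : Set ι | Defines v σ J}).exists_minimal
    ⟨univ, fun x hx h => hS.mem x hx fun i => h i (mem_univ i)⟩
  refine ⟨J, hJ.prop, fun i hi hn => ?_⟩
  exact (hJ.le_of_le hn sdiff_subset hi).2 rfl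

theorem linear_eq_zero_of_eq_zero_on {h : E →ᵃ[ℝ] ℝ} {z u : E} (hz : h z = 0)
    (hev : ∀ᶠ t : ℝ in 𝓝[>] 0, h (z + t • u) = 0) : h.linear u = 0 := by
  obtain ⟨t, ht, ht0⟩ := (hev.and self_mem_nhdsWithin).exists
  rw [affine_apply_add_smul, hz, zero_add] at ht
  exact (mul_eq_zero.1 ht).resolve_left (ne_of_gt ht0)

theorem vertex_mem (v : κ → E) (j : κ) : v j ∈ affineSpan ℝ (range v) :=
  subset_affineSpan ℝ _ ⟨j, rfl⟩

/-- A row that vanishes at all vertices vanishes on the affine hull, so a minimal description does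
not contain it. -/
theorem exists_vertex_ne_of_minimal (hS : IsSlackSystem v σ) {J : Set ι} (hJ : Defines v σ J)
    (hmin : ∀ i ∈ J, ¬ Defines v σ (J \ {i})) {i : ι} (hi : i ∈ J) : ∃ j, 0 < σ i (v j) := by
  by_contra! hle
  refine hmin i hi fun x hx h => hJ x hx fun l hl => ?_
  by_cases hli : l = i
  · subst hli
    have : (σ l) x = (0 : E →ᵃ[ℝ] ℝ) x := affine_eqOn_affineSpan
      (by rintro _ ⟨j, rfl⟩; exact le_antisymm (hle j) (hS.nonneg l j)) hx
    rw [this]; simp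
  · exact h l ⟨hl, hli⟩

/-- The barycentre of the vertices in `Z` works. -/
theorem exists_interior_point [Finite κ] (hS : IsSlackSystem v σ) (Z : Set κ) (hZ : Z.Nonempty) :
    ∃ z ∈ convexHull ℝ (v '' Z), ∀ i, (∃ j ∈ Z, 0 < σ i (v j)) → 0 < σ i z := by
  classical
  have := Fintype.ofFinite κ
  have hcard : 0 < ((Z.toFinset.card : ℕ) : ℝ) :=
    Nat.cast_pos.2 (Finset.card_pos.2 (Set.toFinset_nonempty.2 hZ))
  have hw : ∑ j ∈ Z.toFinset, ((Z.toFinset.card : ℕ) : ℝ)⁻¹ = 1 := by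
    rw [Finset.sum_const, nsmul_eq_mul, mul_inv_cancel₀ hcard.ne']
  refine ⟨∑ j ∈ Z.toFinset, ((Z.toFinset.card : ℕ) : ℝ)⁻¹ • v j, ?_, ?_⟩
  · refine (convex_convexHull ℝ _).sum_mem (fun _ _ => inv_nonneg.2 hcard.le) hw fun j hj => ?_
    exact subset_convexHull ℝ _ ⟨j, by simpa using hj, rfl⟩
  · rintro i ⟨j, hjZ, hj⟩
    rw [affine_apply_sum _ hw]
    refine Finset.sum_pos' (fun l _ => ?_) ⟨j, by simpa using hjZ, ?_⟩
    · exact mul_nonneg (inv_nonneg.2 hcard.le) (hS.nonneg i l)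
    · exact mul_pos (inv_pos.2 hcard) hj

/-- A nonnegative affine function that vanishes at a vertex vanishes identically, unless its zeros
are contained in the zeros of a row from `J`. -/
theorem eq_zero_of_forall_exists_pos [Nonempty κ] [Finite ι] [Finite κ] (hS : IsSlackSystem v σ) {J : Set ι}
    (hJ : Defines v σ J) {g : E →ᵃ[ℝ] ℝ} (hg : ∀ j, 0 ≤ g (v j)) (hg0 : ∃ j, g (v j) = 0)
    (h : ∀ i ∈ J, ∃ j, g (v j) = 0 ∧ 0 < σ i (v j)) :
    ∀ x ∈ affineSpan ℝ (range v), g x = 0 := by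
  -- At the barycentre `z` of the zeros of `g` all rows of `J` are positive, so short steps from `z`
  -- in any direction stay in the polytope. As `g z = 0` and `g ≥ 0` there, the linear part of `g`
  -- is nonnegative on a vector space, hence zero.
  obtain ⟨z, hz, hpos⟩ := exists_interior_point hS {j | g (v j) = 0} hg0
  have hzH : z ∈ affineSpan ℝ (range v) :=
    convexHull_subset_affineSpan _ (convexHull_mono (image_subset_range _ _) hz)
  have hgz : g z = 0 := by
    have hconv : Convex ℝ (g ⁻¹' {0}) := (convex_singleton 0).affine_preimage g
    exact convexHull_min (by rintro _ ⟨j, hj, rfl⟩; exact hj) hconv hz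
  have hlin : ∀ u ∈ vectorSpan ℝ (range v), 0 ≤ g.linear u := by
    intro u hu
    have := hJ.eventually_mem hzH hu fun i hi => Or.inl (hpos i (h i hi))
    obtain ⟨t, ht, ht0⟩ := (this.and self_mem_nhdsWithin).exists
    have := nonneg_of_mem_convexHull hg ht
    rw [affine_apply_add_smul, hgz, zero_add] at this
    exact nonneg_of_mul_nonneg_right this ht0
  intro x hx
  have hu : x - z ∈ vectorSpan ℝ (range v) :=
    vsub_mem_vectorSpan_of_mem_affineSpan_of_mem_affineSpan hx hzH
  have h1 := hlin _ hu
  have h2 := hlin _ (Submodule.neg_mem _ hu)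
  rw [map_neg] at h2
  rw [affine_apply_sub] at h1 h2
  linarith

/-- By minimality some point `y` of the affine hull violates row `i` and no other row of `J`. The
segment from an interior point `c` to `y` meets the hyperplane of row `i` in a point `z` where the
other rows of `J` are positive. A function that vanishes on the face of row `i` vanishes near `z`
within this hyperplane, hence is a multiple of row `i`. -/
theorem facetProperty_of_minimal [Nonempty κ] [Finite ι] [Finite κ] (hS : IsSlackSystem v σ) {J : Set ι}
    (hJ : Defines v σ J) (hmin : ∀ i ∈ J, ¬ Defines v σ (J \ {i})) {i : ι} (hi : i ∈ J) :
    FacetProperty v (σ i) ∧ ∃ j, σ i (v j) = 0 := by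
  have hd := hmin i hi
  simp only [Defines, not_forall, exists_prop] at hd
  obtain ⟨y, hyH, hy, hyP⟩ := hd
  have hyi : σ i y < 0 := by
    by_contra! hyi
    refine hyP (hJ y hyH fun l hl => ?_)
    by_cases hli : l = i
    · rwa [hli]
    · exact hy l ⟨hl, hli⟩
  obtain ⟨c, hc, hcpos⟩ := exists_interior_point hS univ univ_nonempty
  rw [image_univ] at hc
  have hcH := convexHull_subset_affineSpan _ hc
  have hcp : ∀ l ∈ J, 0 < σ l c := fun l hl =>
    hcpos l (by simpa using exists_vertex_ne_of_minimal hS hJ hmin hl)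
  have hden : 0 < σ i c - σ i y := by linarith [hcp i hi]
  -- The weights solve `a * σ i c + b * σ i y = 0` with `a + b = 1`.
  set a : ℝ := -σ i y / (σ i c - σ i y) with ha
  set b : ℝ := σ i c / (σ i c - σ i y) with hb
  have ha0 : 0 < a := div_pos (by linarith) hden
  have hb0 : 0 < b := div_pos (hcp i hi) hden
  have hab : a + b = 1 := by rw [ha, hb, ← add_div, div_eq_one_iff_eq hden.ne']; ring
  set z := a • c + b • y with hz
  have hzH : z ∈ affineSpan ℝ (range v) := by
    have := add_smul_mem_affineSpan hcH
      (vsub_mem_vectorSpan_of_mem_affineSpan_of_mem_affineSpan hyH hcH) b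
    convert this using 1
    rw [hz, vsub_eq_sub, smul_sub, show a = 1 - b by linarith, sub_smul, one_smul]
    abel
  have hzi : σ i z = 0 := by
    rw [hz, Convex.combo_affine_apply hab, ha, hb]
    simp only [smul_eq_mul]
    field_simp
    ring
  have hzl : ∀ l ∈ J, l ≠ i → 0 < σ l z := by
    intro l hl hli
    rw [hz, Convex.combo_affine_apply hab]
    exact add_pos_of_pos_of_nonneg (mul_pos ha0 (hcp l hl)) (mul_nonneg hb0.le (hy l ⟨hl, hli⟩))
  have hzP : z ∈ convexHull ℝ (range v) := hJ z hzH fun l hl => by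
    by_cases hli : l = i
    · rw [hli, hzi]
    · exact (hzl l hl hli).le
  refine ⟨fun h hh => ?_, exists_vertex_eq_zero (hS.nonneg i) hzP hzi⟩
  have hhz : h z = 0 := eq_zero_of_mem_face (hS.nonneg i) hh hzP hzi
  have hlin : ∀ u ∈ vectorSpan ℝ (range v), (σ i).linear u = 0 → h.linear u = 0 := by
    intro u hu hu0
    refine linear_eq_zero_of_eq_zero_on hhz ?_
    filter_upwards [hJ.eventually_mem hzH hu fun l hl => by
      by_cases hli : l = i
      · exact Or.inr ⟨by rw [hli, hzi], by rw [hli, hu0]⟩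
      · exact Or.inl (hzl l hl hli)] with t ht
    refine eq_zero_of_mem_face (hS.nonneg i) hh ht ?_
    rw [affine_apply_add_smul, hzi, hu0]; simp
  refine ⟨h c / σ i c, fun x hx => ?_⟩
  have hci := hcp i hi
  have hu1 : x - z ∈ vectorSpan ℝ (range v) :=
    vsub_mem_vectorSpan_of_mem_affineSpan_of_mem_affineSpan hx hzH
  have hu2 : c - z ∈ vectorSpan ℝ (range v) :=
    vsub_mem_vectorSpan_of_mem_affineSpan_of_mem_affineSpan hcH hzH
  have := hlin ((x - z) - (σ i x / σ i c) • (c - z))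
    (Submodule.sub_mem _ hu1 (Submodule.smul_mem _ _ hu2)) (by
      rw [map_sub, map_smul, affine_apply_sub, affine_apply_sub, hzi, smul_eq_mul]
      field_simp
      ring)
  rw [map_sub, map_smul, affine_apply_sub, affine_apply_sub, hhz, smul_eq_mul] at this
  field_simp at this ⊢
  linarith

/-- A nonzero row whose support lies in that of row `i` vanishes wherever row `i` does, so it is a
nonzero multiple of row `i` and has the same support. -/
theorem facetRow_of_facetProperty {i : ι} (hne : ∃ j, σ i (v j) ≠ 0)
    (h : FacetProperty v (σ i)) : FacetRow (fun i j => σ i (v j)) i := by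
  refine ⟨hne, fun l hl hsub j hj => ?_⟩
  obtain ⟨c, hc⟩ := h (σ l) fun j hj => by
    by_contra hlj
    exact hsub j hlj hj
  obtain ⟨j', hj'⟩ := hl
  have hc0 : c ≠ 0 := by
    rintro rfl
    exact hj' (by simp [hc _ (vertex_mem v j')])
  change σ l (v j) ≠ 0
  rw [hc _ (vertex_mem v j)]
  exact mul_ne_zero hc0 hj

/-- The facet rows of a slack matrix describe the polytope. -/
theorem defines_facetRow [Nonempty κ] [Finite ι] [Finite κ] (hS : IsSlackSystem v σ) :
    Defines v σ {i | FacetRow (fun i j => σ i (v j)) i} := by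
  obtain ⟨J, hJ, hmin⟩ := exists_minimal_defines hS
  refine fun x hx h => hJ x hx fun i hi => h i ?_
  obtain ⟨j, hj⟩ := exists_vertex_ne_of_minimal hS hJ hmin hi
  exact facetRow_of_facetProperty ⟨j, hj.ne'⟩ (facetProperty_of_minimal hS hJ hmin hi).1

/-- If a row `l` of a minimal description vanishes wherever row `i` does, minimality of the support
makes their zeros agree, and row `i` inherits the property from row `l`. Otherwise a zero of row `i`
would make it vanish identically. There remains a row without zeros: then the minimal description is
empty and the polytope is a single point. -/
theorem facetProperty_of_facetRow [Nonempty κ] [Finite ι] [Finite κ] (hS : IsSlackSystem v σ) {i : ι}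
    (hi : FacetRow (fun i j => σ i (v j)) i) : FacetProperty v (σ i) := by
  obtain ⟨J, hJ, hmin⟩ := exists_minimal_defines hS
  by_cases hex : ∃ l ∈ J, ∀ j, σ i (v j) = 0 → σ l (v j) = 0
  · obtain ⟨l, hl, hil⟩ := hex
    obtain ⟨j, hj⟩ := exists_vertex_ne_of_minimal hS hJ hmin hl
    have hli := hi.2 l ⟨j, hj.ne'⟩ (fun j hj hj' => hj (hil j hj'))
    have hfp := (facetProperty_of_minimal hS hJ hmin hl).1
    have hzero : ∀ j, σ l (v j) = 0 → σ i (v j) = 0 := fun j hj => by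
      by_contra hne
      exact hli j hne hj
    obtain ⟨c, hc⟩ := hfp (σ i) hzero
    obtain ⟨j', hj'⟩ := hi.1
    have hc0 : c ≠ 0 := by
      rintro rfl
      exact hj' (by simp [hc _ (vertex_mem v j')])
    intro h hh
    obtain ⟨c', hc'⟩ := hfp h fun j hj => hh j (hzero j hj)
    refine ⟨c' / c, fun x hx => ?_⟩
    rw [hc' x hx, hc x hx]
    field_simp
  · push Not at hex
    obtain ⟨j', hj'⟩ := hi.1
    by_cases hz : ∃ j, σ i (v j) = 0
    · have := eq_zero_of_forall_exists_pos hS hJ (hS.nonneg i) hz fun l hl => by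
        obtain ⟨j, h1, h2⟩ := hex l hl
        exact ⟨j, h1, (hS.nonneg l j).lt_of_ne' h2⟩
      exact absurd (this _ (vertex_mem v j')) hj'
    · push Not at hz
      have hJe : ∀ l, l ∉ J := fun l hl => by
        obtain ⟨j, h1, -⟩ := hex l hl
        exact hz j h1
      have hpt : ∀ x ∈ affineSpan ℝ (range v), x = v j' := by
        intro x hx
        have : x - v j' = 0 := eq_zero_of_line_subset (v := v) (p := v j') fun t =>
          hJ _ (add_smul_mem_affineSpan (vertex_mem v j')
            (vsub_mem_vectorSpan_of_mem_affineSpan_of_mem_affineSpan hx (vertex_mem v j')) t)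
            fun l hl => absurd hl (hJe l)
        exact sub_eq_zero.1 this
      intro h _
      refine ⟨h (v j') / σ i (v j'), fun x hx => ?_⟩
      have : σ i (v j') ≠ 0 := hj'
      rw [hpt x hx]
      field_simp

/-- Every facet of the polytope is the zero set of a facet row. -/
theorem exists_facetRow_of_facetProperty [Nonempty κ] [Finite ι] [Finite κ] (hS : IsSlackSystem v σ) {g : E →ᵃ[ℝ] ℝ}
    (hg : ∀ j, 0 ≤ g (v j)) (hg0 : ∃ j, g (v j) = 0) (hg1 : ∃ j, g (v j) ≠ 0)
    (hfp : FacetProperty v g) :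
    ∃ i, FacetRow (fun i j => σ i (v j)) i ∧ ∃ c : ℝ, c ≠ 0 ∧ ∀ j, σ i (v j) = c * g (v j) := by
  obtain ⟨J, hJ, hmin⟩ := exists_minimal_defines hS
  by_cases hex : ∃ l ∈ J, ∀ j, g (v j) = 0 → σ l (v j) = 0
  · obtain ⟨l, hl, hil⟩ := hex
    obtain ⟨j, hj⟩ := exists_vertex_ne_of_minimal hS hJ hmin hl
    obtain ⟨c, hc⟩ := hfp (σ l) hil
    refine ⟨l, facetRow_of_facetProperty ⟨j, hj.ne'⟩ (facetProperty_of_minimal hS hJ hmin hl).1,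
      c, ?_, fun j => hc _ (vertex_mem v j)⟩
    rintro rfl
    exact hj.ne' (by simp [hc _ (vertex_mem v j)])
  · push Not at hex
    obtain ⟨j', hj'⟩ := hg1
    have := eq_zero_of_forall_exists_pos hS hJ hg hg0 fun l hl => by
      obtain ⟨j, h1, h2⟩ := hex l hl
      exact ⟨j, h1, (hS.nonneg l j).lt_of_ne' h2⟩
    exact absurd (this _ (vertex_mem v j')) hj'

/-- The facet rows separate the points of the affine hull. -/
theorem eq_of_facetRow_eq [Nonempty κ] [Finite ι] [Finite κ] (hS : IsSlackSystem v σ) {x y : E}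
    (hx : x ∈ affineSpan ℝ (range v)) (hy : y ∈ affineSpan ℝ (range v))
    (h : ∀ i, FacetRow (fun i j => σ i (v j)) i → σ i x = σ i y) : x = y := by
  have j : κ := Classical.arbitrary κ
  -- The facet rows do not change along `x - y`, so the polytope contains the whole line through a
  -- vertex in this direction.
  refine sub_eq_zero.1 (eq_zero_of_line_subset (v := v) (p := v j) fun t =>
    defines_facetRow hS _ (add_smul_mem_affineSpan (vertex_mem v j)
      (vsub_mem_vectorSpan_of_mem_affineSpan_of_mem_affineSpan hx hy) t) fun i hi => ?_)
  rw [affine_apply_add_smul, affine_apply_sub, h i hi]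
  simpa using hS.nonneg i j

end Normed

end GluedProduct

/-! ### Special rows and separations -/

namespace GluedProduct

theorem affineMap_sum_apply {E α : Type*} [AddCommGroup E] [Module ℝ E] (T : Finset α)
    (f : α → E →ᵃ[ℝ] ℝ) (x : E) : (∑ i ∈ T, f i) x = ∑ i ∈ T, f i x := by
  classical
  induction T using Finset.induction_on with
  | empty => simp
  | insert a T ha ih => rw [Finset.sum_insert ha, Finset.sum_insert ha, ← ih]; rfl

theorem affineMap_sum_linear {E α : Type*} [AddCommGroup E] [Module ℝ E] (T : Finset α)
    (f : α → E →ᵃ[ℝ] ℝ) (x : E) : (∑ i ∈ T, f i).linear x = ∑ i ∈ T, (f i).linear x := by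
  classical
  induction T using Finset.induction_on with
  | empty => simp
  | insert a T ha ih => rw [Finset.sum_insert ha, Finset.sum_insert ha, ← ih]; rfl

/-- Rows that can play the part of the `r` common coordinates of a simplicial glued product. -/
structure SpecialRows {ι κ : Type*} (S : ι → κ → ℝ) {r : ℕ} (ρ : Fin r → ι) : Prop where
  facet : ∀ t, FacetRow S (ρ t)
  two_valued : ∀ t j j', S (ρ t) j ≠ 0 → S (ρ t) j' ≠ 0 → S (ρ t) j = S (ρ t) j'
  disjoint : ∀ t t', t ≠ t' → ∀ j, S (ρ t) j = 0 ∨ S (ρ t') j = 0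
  base : ∃ j, ∀ t, S (ρ t) j = 0

/-- The columns `j` and `l` lie over the same vertex of the simplex. -/
def SameType {ι κ : Type*} (S : ι → κ → ℝ) {r : ℕ} (ρ : Fin r → ι) (j l : κ) : Prop :=
  ∀ t, S (ρ t) j = 0 ↔ S (ρ t) l = 0

/-- The function is constant on each type of columns. -/
def TypeConst {ι κ : Type*} (S : ι → κ → ℝ) {r : ℕ} (ρ : Fin r → ι) (h : κ → ℝ) : Prop :=
  ∀ j l, SameType S ρ j l → h j = h l

/-- The set `X` of rows is a separator of the linear matroid of the facet rows modulo the functions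
that are constant on types. -/
def Separates {ι κ : Type*} [Fintype ι] (S : ι → κ → ℝ) {r : ℕ} (ρ : Fin r → ι) (X : Set ι) :
    Prop :=
  ∀ a : ι → ℝ, (∀ i, ¬ FacetRow S i → a i = 0) → TypeConst S ρ (fun j => ∑ i, a i * S i j) →
    TypeConst S ρ (fun j => ∑ i, X.indicator a i * S i j)

theorem Separates.compl {ι κ : Type*} [Fintype ι] {S : ι → κ → ℝ} {r : ℕ} {ρ : Fin r → ι}
    {X : Set ι} (h : Separates S ρ X) : Separates S ρ Xᶜ := by
  intro a ha hc j j' hj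
  have h1 := h a ha hc j j' hj
  have h2 := hc j j' hj
  have h3 : ∀ j, ∑ i, Xᶜ.indicator a i * S i j =
      ∑ i, a i * S i j - ∑ i, X.indicator a i * S i j := by
    intro j
    rw [← Finset.sum_sub_distrib]
    refine Finset.sum_congr rfl fun i _ => ?_
    by_cases hi : i ∈ X <;> simp [hi]
  simp only at h1 h2 ⊢
  rw [h3, h3, h1, h2]

theorem SpecialRows.eq_of_sameType {ι κ : Type*} {S : ι → κ → ℝ} {r : ℕ} {ρ : Fin r → ι}
    (hρ : SpecialRows S ρ) {j j' : κ} (h : SameType S ρ j j') (t : Fin r) :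
    S (ρ t) j = S (ρ t) j' := by
  by_cases h0 : S (ρ t) j = 0
  · rw [h0, (h t).1 h0]
  · exact hρ.two_valued t j j' h0 fun h' => h0 ((h t).2 h')

theorem SpecialRows.sameType_of_ne_zero {ι κ : Type*} {S : ι → κ → ℝ} {r : ℕ} {ρ : Fin r → ι}
    (hρ : SpecialRows S ρ) {j j' : κ} {t : Fin r} (h : S (ρ t) j ≠ 0) (hne : S (ρ t) j' ≠ 0) :
    SameType S ρ j j' := by
  intro t'
  by_cases htt : t' = t
  · subst htt; simp [h, hne]
  · simp [(hρ.disjoint t t' (Ne.symm htt) j).resolve_left h,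
      (hρ.disjoint t t' (Ne.symm htt) j').resolve_left hne]

/-- Functions that are constant on types are combinations of the special rows and constants. -/
theorem SpecialRows.exists_eq_sum {ι κ : Type*} {S : ι → κ → ℝ} {r : ℕ} {ρ : Fin r → ι}
    (hρ : SpecialRows S ρ) {h : κ → ℝ} (hh : TypeConst S ρ h) :
    ∃ (τ₀ : ℝ) (τ : Fin r → ℝ), ∀ j, h j = τ₀ + ∑ t, τ t * S (ρ t) j := by
  obtain ⟨j₀, hj₀⟩ := hρ.base
  choose jt hjt using fun t => (hρ.facet t).1
  -- The coefficients interpolate the values over the base type and over the other types; by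
  -- disjointness of the supports at most one summand is nonzero in each column.
  refine ⟨h j₀, fun t => (h (jt t) - h j₀) / S (ρ t) (jt t), fun j => ?_⟩
  by_cases hj : ∀ t, S (ρ t) j = 0
  · simp only [hj, mul_zero, Finset.sum_const_zero, add_zero]
    exact hh _ _ fun t => by simp [hj t, hj₀ t]
  · push Not at hj
    obtain ⟨t, ht⟩ := hj
    rw [Finset.sum_eq_single t]
    · have e : S (ρ t) j = S (ρ t) (jt t) := hρ.two_valued t _ _ ht (hjt t)
      have hne := hjt t
      rw [e, div_mul_cancel₀ _ hne, hh j (jt t) (hρ.sameType_of_ne_zero ht hne)]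
      ring
    · intro t' _ htt
      rw [(hρ.disjoint t t' (Ne.symm htt) j).resolve_left ht, mul_zero]
    · simp

/-! ### Gluing points along a separator -/

section Glue

variable {E ι κ : Type*} [NormedAddCommGroup E] [NormedSpace ℝ E]
  {v : κ → E} {σ : ι → E →ᵃ[ℝ] ℝ} {r : ℕ} {ρ : Fin r → ι} {X : Set ι}

/-- The slack matrix of a slack system. -/
abbrev slack (v : κ → E) (σ : ι → E →ᵃ[ℝ] ℝ) : ι → κ → ℝ := fun i j => σ i (v j)

/-- Up to a constant, a function that is constant on types agrees on the vertices with a combination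
of special rows, so on the direction space its linear part is the same combination of theirs. -/
theorem linear_eq_zero_of_typeConst (hρ : SpecialRows (slack v σ) ρ) {h : E →ᵃ[ℝ] ℝ}
    (hh : TypeConst (slack v σ) ρ fun j => h (v j)) {u : E} (hu : u ∈ vectorSpan ℝ (range v))
    (hu0 : ∀ t, (σ (ρ t)).linear u = 0) : h.linear u = 0 := by
  obtain ⟨τ₀, τ, hτ⟩ := hρ.exists_eq_sum hh
  have := linear_eq_zero_of_vectorSpan
    (f := h.linear - ∑ t, τ t • (σ (ρ t)).linear) (s := range v) ?_ hu
  · simpa [LinearMap.sum_apply, hu0] using this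
  · rintro _ ⟨j, rfl⟩ _ ⟨j', rfl⟩
    simp only [LinearMap.sub_apply, LinearMap.sum_apply, LinearMap.smul_apply, affine_apply_sub,
      smul_eq_mul, mul_sub, Finset.sum_sub_distrib]
    rw [hτ j, hτ j']
    ring

/-- Gluing two points of the affine hull that lie over the same point of the simplex. -/
theorem exists_glue [Fintype ι] (hρ : SpecialRows (slack v σ) ρ) (hX : Separates (slack v σ) ρ X) {x₁ x₂ : E}
    (h₁ : x₁ ∈ affineSpan ℝ (range v)) (h₂ : x₂ ∈ affineSpan ℝ (range v))
    (h : ∀ t, σ (ρ t) x₁ = σ (ρ t) x₂) :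
    ∃ x ∈ affineSpan ℝ (range v), (∀ t, σ (ρ t) x = σ (ρ t) x₁) ∧
      (∀ i ∈ X, FacetRow (slack v σ) i → σ i x = σ i x₁) ∧
      (∀ i ∉ X, FacetRow (slack v σ) i → σ i x = σ i x₂) := by
  classical
  let K : Submodule ℝ E := vectorSpan ℝ (range v) ⊓ ⨅ t, LinearMap.ker (σ (ρ t)).linear
  have hK : ∀ w, w ∈ K ↔ w ∈ vectorSpan ℝ (range v) ∧ ∀ t, (σ (ρ t)).linear w = 0 := by
    intro w; simp [K]
  let Λ : E →ₗ[ℝ] (ι → ℝ) := LinearMap.pi fun i =>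
    if FacetRow (slack v σ) i then (σ i).linear else 0
  set u := x₂ - x₁ with hu
  have huD : u ∈ vectorSpan ℝ (range v) :=
    vsub_mem_vectorSpan_of_mem_affineSpan_of_mem_affineSpan h₂ h₁
  have huK : u ∈ K := (hK u).2 ⟨huD, fun t => by rw [hu, affine_apply_sub, h t, sub_self]⟩
  -- The point sought is `x₁ + w`, where `w` leaves the special rows unchanged and changes the facet
  -- rows by `y`: not at all in `X`, by the difference between `x₂` and `x₁` outside `X`.
  let y : ι → ℝ := fun i => if FacetRow (slack v σ) i ∧ i ∉ X then (σ i).linear u else 0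
  have hy : y ∈ K.map Λ := by
    -- Otherwise some functional, with coefficients `a` on the facet rows, vanishes on the image of
    -- `K` but not at `y`. Differences of vertices of the same type lie in `K`, so this combination
    -- of rows is constant on types. By separation so is its part outside `X`, whose linear part
    -- therefore vanishes at `u`; but this is the value of the functional at `y`.
    by_contra hy
    obtain ⟨f, hfy, hf⟩ := Submodule.exists_le_ker_of_notMem hy
    set a : ι → ℝ := fun i =>
      if FacetRow (slack v σ) i then f (fun l => if i = l then 1 else 0) else 0 with ha
    have hfe : ∀ z, f z = ∑ i, z i * f (fun l => if i = l then 1 else 0) := fun z => by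
      rw [LinearMap.pi_apply_eq_sum_univ f z]; simp
    have hK0 : ∀ w ∈ K, ∑ i, a i * (σ i).linear w = 0 := by
      intro w hw
      have h0 : f (Λ w) = 0 := hf (Submodule.mem_map_of_mem hw)
      rw [hfe] at h0
      rw [← h0]
      refine Finset.sum_congr rfl fun i _ => ?_
      by_cases hi : FacetRow (slack v σ) i <;> simp [ha, Λ, hi, mul_comm]
    have htc : TypeConst (slack v σ) ρ (fun j => ∑ i, a i * slack v σ i j) := by
      intro j j' hjj
      have hw : v j - v j' ∈ K := (hK _).2 ⟨vsub_mem_vectorSpan ℝ ⟨j, rfl⟩ ⟨j', rfl⟩, fun t => by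
        rw [affine_apply_sub, sub_eq_zero]
        exact hρ.eq_of_sameType hjj t⟩
      have := hK0 _ hw
      simp only [affine_apply_sub, mul_sub, Finset.sum_sub_distrib] at this
      exact sub_eq_zero.1 this
    have htc' := hX.compl a (fun i hi => by simp [ha, hi]) htc
    have hlin := linear_eq_zero_of_typeConst hρ
      (h := ∑ i, Xᶜ.indicator a i • σ i) (by
        convert htc' using 2 with j
        rw [affineMap_sum_apply]
        rfl) huD ((hK u).1 huK).2
    rw [affineMap_sum_linear] at hlin
    refine hfy ?_
    rw [hfe]
    refine Eq.trans ?_ hlin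
    refine Finset.sum_congr rfl fun i _ => ?_
    by_cases hi : FacetRow (slack v σ) i <;> by_cases hiX : i ∈ X <;>
      simp [ha, y, hi, hiX, mul_comm]
  obtain ⟨w, hw, hwy⟩ := hy
  obtain ⟨hwD, hw0⟩ := (hK w).1 hw
  have hadd : ∀ i, σ i (x₁ + w) = σ i x₁ + (σ i).linear w := fun i => by
    have := affine_apply_add_smul (σ i) x₁ w 1
    simpa using this
  refine ⟨x₁ + w, by simpa using add_smul_mem_affineSpan h₁ hwD 1, fun t => ?_, fun i hi hF => ?_,
    fun i hi hF => ?_⟩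
  · rw [hadd, hw0 t, add_zero]
  · have : Λ w i = y i := congrFun hwy i
    simp only [Λ, y, LinearMap.pi_apply, if_pos hF, hi, not_true_eq_false, and_false,
      if_false] at this
    rw [hadd, this, add_zero]
  · have : Λ w i = y i := congrFun hwy i
    simp only [Λ, y, LinearMap.pi_apply, if_pos hF, hi, not_false_eq_true, and_true] at this
    rw [hadd, this, hu, affine_apply_sub]
    ring

end Glue

end GluedProduct

/-! ### The factors of a glued product -/

namespace GluedProduct

theorem vectorSpan_convexHull {E : Type*} [AddCommGroup E] [Module ℝ E] (s : Set E) :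
    vectorSpan ℝ (convexHull ℝ s) = vectorSpan ℝ s := by
  rw [← direction_affineSpan, affineSpan_convexHull, direction_affineSpan]

/-- The zero set of `g` in a polytope has codimension one if and only if `g` has the facet
property. -/
theorem dim_face_add_one_iff {F κ : Type*} [AddCommGroup F] [Module ℝ F] [FiniteDimensional ℝ F]
    {w : κ → F} {g : F →ᵃ[ℝ] ℝ} (hg : ∀ j, 0 ≤ g (w j)) (h0 : ∃ j, g (w j) = 0)
    (h1 : ∃ j, g (w j) ≠ 0) :
    dim {x ∈ convexHull ℝ (range w) | g x = 0} + 1 = dim (convexHull ℝ (range w)) ↔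
      FacetProperty w g := by
  obtain ⟨j₀, hj₀⟩ := h0
  obtain ⟨j₁, hj₁⟩ := h1
  set face := {x ∈ convexHull ℝ (range w) | g x = 0} with hface
  set D := vectorSpan ℝ (range w) with hD
  set G := vectorSpan ℝ face with hG
  -- `K` has codimension one in the direction `D` of the polytope, and both sides of the equivalence
  -- say that the direction `G` of the face is all of `K`.
  set K := D ⊓ LinearMap.ker g.linear with hK
  have hmem : ∀ j, g (w j) = 0 → w j ∈ face := fun j hj =>
    ⟨subset_convexHull ℝ _ ⟨j, rfl⟩, hj⟩
  have hpt : ∀ j, w j ∈ affineSpan ℝ (range w) := fun j => subset_affineSpan ℝ _ ⟨j, rfl⟩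
  have hGD : G ≤ D := by
    rw [hD, ← vectorSpan_convexHull]
    exact vectorSpan_mono ℝ fun x hx => hx.1
  have hGK : G ≤ K := by
    refine le_inf hGD fun u hu => ?_
    refine linear_eq_zero_of_vectorSpan (fun x hx y hy => ?_) hu
    rw [affine_apply_sub, hx.2, hy.2, sub_zero]
  have hKD : Module.finrank ℝ K + 1 = Module.finrank ℝ D := by
    set f : D →ₗ[ℝ] ℝ := g.linear.domRestrict D
    have hsurj : Function.Surjective f := by
      refine LinearMap.surjective_of_ne_zero fun hf => hj₁ ?_
      have := LinearMap.congr_fun hf ⟨w j₁ - w j₀, vsub_mem_vectorSpan ℝ ⟨j₁, rfl⟩ ⟨j₀, rfl⟩⟩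
      simpa [f, affine_apply_sub, hj₀] using this
    have h2 := LinearMap.finrank_range_add_finrank_ker f
    rw [LinearMap.range_eq_top.2 hsurj, finrank_top, Module.finrank_self] at h2
    have h3 : LinearMap.ker f = K.comap D.subtype := by
      ext x; simp [f, hK]
    have h4 : Module.finrank ℝ (K.comap D.subtype) = Module.finrank ℝ K :=
      (Submodule.comapSubtypeEquivOfLe inf_le_left).finrank_eq
    rw [h3, h4] at h2
    omega
  have hdim : dim face + 1 = dim (convexHull ℝ (range w)) ↔ G = K := by
    rw [dim, dim, vectorSpan_convexHull, ← hKD]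
    constructor
    · intro h
      exact Submodule.eq_of_le_of_finrank_eq hGK (Nat.add_right_cancel h)
    · intro h
      rw [← h]
  rw [hdim]
  constructor
  · intro hGK h hh
    have hlin : ∀ u ∈ K, h.linear u = 0 := by
      intro u hu
      rw [← hGK] at hu
      refine linear_eq_zero_of_vectorSpan (fun x hx y hy => ?_) hu
      rw [affine_apply_sub, eq_zero_of_mem_face hg hh hx.1 hx.2,
        eq_zero_of_mem_face hg hh hy.1 hy.2, sub_zero]
    refine ⟨h (w j₁) / g (w j₁), fun x hx => ?_⟩
    have hu1 : x - w j₀ ∈ D := vsub_mem_vectorSpan_of_mem_affineSpan_of_mem_affineSpan hx (hpt j₀)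
    have hu2 : w j₁ - w j₀ ∈ D := vsub_mem_vectorSpan ℝ ⟨j₁, rfl⟩ ⟨j₀, rfl⟩
    have := hlin ((x - w j₀) - (g x / g (w j₁)) • (w j₁ - w j₀))
      ⟨Submodule.sub_mem _ hu1 (Submodule.smul_mem _ _ hu2), by
        rw [SetLike.mem_coe, LinearMap.mem_ker, map_sub, map_smul, affine_apply_sub,
          affine_apply_sub, hj₀, smul_eq_mul]
        field_simp
        ring⟩
    rw [map_sub, map_smul, affine_apply_sub, affine_apply_sub, hh j₀ hj₀, smul_eq_mul] at this
    field_simp at this ⊢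
    linarith
  · intro hfp
    refine le_antisymm hGK fun u hu => ?_
    by_contra huG
    -- Shifted by a constant, `f` vanishes on the vertices of the face, so it is a multiple of `g`
    -- on the affine hull. But `g` is constant along `u`, and `f` is not.
    obtain ⟨f, hfu, hf⟩ := Submodule.exists_le_ker_of_notMem huG
    obtain ⟨c, hc⟩ := hfp (f.toAffineMap - AffineMap.const ℝ F (f (w j₀))) fun j hj => by
      have : w j - w j₀ ∈ LinearMap.ker f := hf (vsub_mem_vectorSpan ℝ (hmem j hj) (hmem j₀ hj₀))
      simpa using this
    have hx : w j₀ + u ∈ affineSpan ℝ (range w) := by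
      rw [add_comm]
      exact vadd_mem_affineSpan_of_mem_affineSpan_of_mem_vectorSpan (hpt j₀) hu.1
    have h2 := hc _ hx
    have h3 := affine_apply_add_smul g (w j₀) u 1
    have hu0 : g.linear u = 0 := hu.2
    rw [one_smul, hj₀, hu0] at h3
    rw [h3] at h2
    refine hfu ?_
    simpa using h2

/-- Every affine hull is the solution set of a system of linear equations. -/
theorem exists_mulVec_eq_iff {d : ℕ} {s : Set (Fin d → ℝ)} (hs : s.Nonempty) :
    ∃ (q : ℕ) (A : Matrix (Fin q) (Fin d) ℝ) (b : Fin q → ℝ),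
      ∀ x, x ∈ affineSpan ℝ s ↔ A.mulVec x = b := by
  obtain ⟨p, hp⟩ := hs
  have hp' := subset_affineSpan ℝ s hp
  set D := vectorSpan ℝ s
  let L : (Fin d → ℝ) →ₗ[ℝ] (Fin (Module.finrank ℝ ((Fin d → ℝ) ⧸ D)) → ℝ) :=
    (Module.finBasis ℝ ((Fin d → ℝ) ⧸ D)).equivFun.toLinearMap ∘ₗ D.mkQ
  refine ⟨_, LinearMap.toMatrix' L, L p, fun x => ?_⟩
  rw [LinearMap.toMatrix'_mulVec]
  have h1 : L x = L p ↔ x - p ∈ D := by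
    simp only [L, LinearMap.comp_apply, LinearEquiv.coe_coe, EmbeddingLike.apply_eq_iff_eq,
      Submodule.mkQ_apply]
    exact Submodule.Quotient.eq D
  rw [h1]
  constructor
  · intro hx
    exact vsub_mem_vectorSpan_of_mem_affineSpan_of_mem_affineSpan hx hp'
  · intro hx
    have := vadd_mem_affineSpan_of_mem_affineSpan_of_mem_vectorSpan hp' hx
    simpa using this

theorem one_le_dim {E : Type*} [AddCommGroup E] [Module ℝ E] [FiniteDimensional ℝ E] {P : Set E}
    {x y : E} (hx : x ∈ P) (hy : y ∈ P) (hxy : x ≠ y) : 1 ≤ dim P := by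
  by_contra! h
  have h0 : Module.finrank ℝ (vectorSpan ℝ P) = 0 := by
    change dim P = 0
    omega
  rw [Submodule.finrank_eq_zero] at h0
  have := vsub_mem_vectorSpan ℝ hx hy
  rw [h0, Submodule.mem_bot] at this
  exact hxy (sub_eq_zero.1 this)

open Classical in
/-- Some nonzero entry of a nonzero row. -/
noncomputable def rowValue {ι κ : Type*} (S : ι → κ → ℝ) (i : ι) : ℝ :=
  if h : ∃ j, S i j ≠ 0 then S i h.choose else 1

theorem rowValue_ne_zero {ι κ : Type*} (S : ι → κ → ℝ) (i : ι) : rowValue S i ≠ 0 := by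
  rw [rowValue]
  split_ifs with h
  · exact h.choose_spec
  · exact one_ne_zero

theorem SpecialRows.eq_rowValue {ι κ : Type*} {S : ι → κ → ℝ} {r : ℕ} {ρ : Fin r → ι}
    (hρ : SpecialRows S ρ) {t : Fin r} {j : κ} (h : S (ρ t) j ≠ 0) :
    S (ρ t) j = rowValue S (ρ t) := by
  have hex : ∃ j, S (ρ t) j ≠ 0 := ⟨j, h⟩
  rw [rowValue, dif_pos hex]
  exact hρ.two_valued t _ _ h hex.choose_spec

open Classical in
/-- The vertices of the factor that belongs to the set `X` of rows, as the columns of a matrix: the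
normalized special rows, the facet rows in `X`, and the indicator of the columns that vanish on all
special rows. -/
noncomputable def factorMatrix {m : ℕ} {κ : Type*} (S : Fin m → κ → ℝ) {r : ℕ} (ρ : Fin r → Fin m)
    (X : Set (Fin m)) : Fin (m + 1) → κ → ℝ := fun i j =>
  Fin.lastCases (motive := fun _ => ℝ) (if ∀ t, S (ρ t) j = 0 then 1 else 0)
    (fun i => if i ∈ range ρ then (if S i j = 0 then 0 else 1) else
      if i ∈ X ∧ FacetRow S i then S i j else 0) i

/-- The columns of `factorMatrix`. -/
noncomputable def factorVertex {m : ℕ} {κ : Type*} (S : Fin m → κ → ℝ) {r : ℕ} (ρ : Fin r → Fin m)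
    (X : Set (Fin m)) (j : κ) : Fin (m + 1) → ℝ := fun i => factorMatrix S ρ X i j

/-- The factor that belongs to the set `X` of rows. -/
noncomputable def factorPolytope {m : ℕ} {κ : Type*} (S : Fin m → κ → ℝ) {r : ℕ}
    (ρ : Fin r → Fin m) (X : Set (Fin m)) : Set (Fin (m + 1) → ℝ) :=
  convexHull ℝ (range (factorVertex S ρ X))

/-- The coordinates of the special rows in the factors. -/
def specialCoord {m r : ℕ} (ρ : Fin r → Fin m) (t : Fin r) : Fin (m + 1) := (ρ t).castSucc

theorem factorVertex_special {m : ℕ} {κ : Type*} (S : Fin m → κ → ℝ) {r : ℕ}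
    (ρ : Fin r → Fin m) (X : Set (Fin m)) (j : κ) (t : Fin r) :
    factorVertex S ρ X j (specialCoord ρ t) = 0 ∧ S (ρ t) j = 0 ∨
      factorVertex S ρ X j (specialCoord ρ t) = 1 ∧ S (ρ t) j ≠ 0 := by
  by_cases h : S (ρ t) j = 0 <;> simp [factorVertex, factorMatrix, specialCoord, h]

/-! ### Projections of the polytope to its factors, and lifting -/

section Factor

variable {m : ℕ} {E κ : Type*} [NormedAddCommGroup E] [NormedSpace ℝ E]
  {v : κ → E} {σ : Fin m → E →ᵃ[ℝ] ℝ} {r : ℕ} {ρ : Fin r → Fin m} {X : Set (Fin m)}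

open Classical in
/-- The projection of the polytope to the factor that belongs to `X`. -/
noncomputable def factorMap (v : κ → E) (σ : Fin m → E →ᵃ[ℝ] ℝ) (ρ : Fin r → Fin m)
    (X : Set (Fin m)) : E →ᵃ[ℝ] (Fin (m + 1) → ℝ) :=
  AffineMap.pi (Fin.lastCases (motive := fun _ => E →ᵃ[ℝ] ℝ)
    (AffineMap.const ℝ E 1 - ∑ t, (rowValue (slack v σ) (ρ t))⁻¹ • σ (ρ t))
    (fun i => if i ∈ range ρ then (rowValue (slack v σ) i)⁻¹ • σ i else
      if i ∈ X ∧ FacetRow (slack v σ) i then σ i else 0))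

theorem factorMap_last (x : E) : factorMap v σ ρ X x (Fin.last m) =
    1 - ∑ t, (rowValue (slack v σ) (ρ t))⁻¹ * σ (ρ t) x := by
  simp [factorMap, affineMap_sum_apply]

theorem factorMap_special (x : E) (t : Fin r) : factorMap v σ ρ X x (specialCoord ρ t) =
    (rowValue (slack v σ) (ρ t))⁻¹ * σ (ρ t) x := by
  simp [factorMap, specialCoord]

theorem factorMap_vertex (hρ : SpecialRows (slack v σ) ρ) (j : κ) :
    factorMap v σ ρ X (v j) = factorVertex (slack v σ) ρ X j := by
  classical
  funext i
  refine Fin.lastCases ?_ (fun i => ?_) i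
  · rw [factorMap_last, factorVertex, factorMatrix, Fin.lastCases_last]
    by_cases h : ∀ t, slack v σ (ρ t) j = 0
    · rw [if_pos h, Finset.sum_eq_zero fun t _ => ?_, sub_zero]
      have : σ (ρ t) (v j) = 0 := h t
      rw [this, mul_zero]
    · rw [if_neg h]
      push Not at h
      obtain ⟨t, ht⟩ := h
      rw [Finset.sum_eq_single t]
      · have : σ (ρ t) (v j) = rowValue (slack v σ) (ρ t) := hρ.eq_rowValue ht
        rw [this, inv_mul_cancel₀ (rowValue_ne_zero _ _), sub_self]
      · intro t' _ htt
        have : σ (ρ t') (v j) = 0 := (hρ.disjoint t t' (Ne.symm htt) j).resolve_left ht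
        rw [this, mul_zero]
      · simp
  · simp only [factorMap, AffineMap.pi_apply, Fin.lastCases_castSucc, factorVertex, factorMatrix]
    by_cases hi : i ∈ range ρ
    · obtain ⟨t, rfl⟩ := hi
      rw [if_pos ⟨t, rfl⟩, if_pos ⟨t, rfl⟩, AffineMap.coe_smul, Pi.smul_apply, smul_eq_mul]
      by_cases h0 : slack v σ (ρ t) j = 0
      · have : σ (ρ t) (v j) = 0 := h0
        rw [if_pos h0, this, mul_zero]
      · have : σ (ρ t) (v j) = rowValue (slack v σ) (ρ t) := hρ.eq_rowValue h0
        rw [if_neg h0, this, inv_mul_cancel₀ (rowValue_ne_zero _ _)]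
    · rw [if_neg hi, if_neg hi]
      split_ifs <;> rfl

/-- The normalizing scalars are nonzero and the last coordinate is a function of the special ones,
so neither affects equality. -/
theorem factorMap_eq_iff {x y : E} : factorMap v σ ρ X x = factorMap v σ ρ X y ↔
    (∀ t, σ (ρ t) x = σ (ρ t) y) ∧ ∀ i ∈ X, FacetRow (slack v σ) i → σ i x = σ i y := by
  classical
  constructor
  · intro h
    have hsp : ∀ t, σ (ρ t) x = σ (ρ t) y := fun t => by
      have := congrFun h (specialCoord ρ t)
      rw [factorMap_special, factorMap_special] at this
      exact mul_left_cancel₀ (inv_ne_zero (rowValue_ne_zero _ _)) this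
    refine ⟨hsp, fun i hi hF => ?_⟩
    by_cases hir : i ∈ range ρ
    · obtain ⟨t, rfl⟩ := hir
      exact hsp t
    · have := congrFun h i.castSucc
      simp only [factorMap, AffineMap.pi_apply, Fin.lastCases_castSucc, if_neg hir] at this
      rwa [if_pos ⟨hi, hF⟩] at this
  · rintro ⟨hsp, hX⟩
    funext i
    refine Fin.lastCases ?_ (fun i => ?_) i
    · rw [factorMap_last, factorMap_last]
      simp only [hsp]
    · simp only [factorMap, AffineMap.pi_apply, Fin.lastCases_castSucc]
      split_ifs with h1 h2
      · obtain ⟨t, rfl⟩ := h1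
        simp [hsp t]
      · exact hX i h2.1 h2.2
      · rfl

theorem range_factorVertex (hρ : SpecialRows (slack v σ) ρ) :
    factorMap v σ ρ X '' range v = range (factorVertex (slack v σ) ρ X) := by
  rw [← range_comp]
  congr 1
  funext j
  exact factorMap_vertex hρ j

theorem image_factorMap (hρ : SpecialRows (slack v σ) ρ) :
    factorMap v σ ρ X '' convexHull ℝ (range v) = factorPolytope (slack v σ) ρ X := by
  rw [AffineMap.image_convexHull, range_factorVertex hρ, factorPolytope]

/-- The glued point lies in the polytope since every facet row takes its value there from `x₁` or
from `x₂`. Only the rows in `X` have to be nonnegative at `x₁`, which may lie outside the polytope;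
this generality yields the inequality description of the factor. -/
theorem exists_lift [Finite κ] [Nonempty κ] (hS : IsSlackSystem v σ) (hρ : SpecialRows (slack v σ) ρ)
    (hX : Separates (slack v σ) ρ X) {x₁ x₂ : E} (h₁ : x₁ ∈ affineSpan ℝ (range v))
    (hnn : ∀ i ∈ X, FacetRow (slack v σ) i → 0 ≤ σ i x₁) (h₂ : x₂ ∈ convexHull ℝ (range v))
    (h : ∀ t, σ (ρ t) x₁ = σ (ρ t) x₂) :
    ∃ x ∈ convexHull ℝ (range v), factorMap v σ ρ X x = factorMap v σ ρ X x₁ ∧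
      factorMap v σ ρ Xᶜ x = factorMap v σ ρ Xᶜ x₂ := by
  obtain ⟨x, hx, hsp, hxX, hxX'⟩ := exists_glue hρ hX h₁ (convexHull_subset_affineSpan _ h₂) h
  refine ⟨x, ?_, ?_, ?_⟩
  · refine defines_facetRow hS x hx fun i hi => ?_
    by_cases hiX : i ∈ X
    · rw [hxX i hiX hi]; exact hnn i hiX hi
    · rw [hxX' i hiX hi]; exact nonneg_of_mem_convexHull (hS.nonneg i) h₂
  · exact factorMap_eq_iff.2 ⟨hsp, hxX⟩
  · exact factorMap_eq_iff.2 ⟨fun t => (hsp t).trans (h t), hxX'⟩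

theorem exists_lift_of_mem [Finite κ] [Nonempty κ] (hS : IsSlackSystem v σ) (hρ : SpecialRows (slack v σ) ρ)
    (hX : Separates (slack v σ) ρ X) {y₁ y₂ : Fin (m + 1) → ℝ}
    (h₁ : y₁ ∈ factorPolytope (slack v σ) ρ X) (h₂ : y₂ ∈ factorPolytope (slack v σ) ρ Xᶜ)
    (h : ∀ t, y₁ (specialCoord ρ t) = y₂ (specialCoord ρ t)) :
    ∃ x ∈ convexHull ℝ (range v), factorMap v σ ρ X x = y₁ ∧ factorMap v σ ρ Xᶜ x = y₂ := by
  rw [← image_factorMap hρ] at h₁ h₂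
  obtain ⟨x₁, hx₁, rfl⟩ := h₁
  obtain ⟨x₂, hx₂, rfl⟩ := h₂
  refine exists_lift hS hρ hX (convexHull_subset_affineSpan _ hx₁)
    (fun i _ _ => nonneg_of_mem_convexHull (hS.nonneg i) hx₁) hx₂ fun t => ?_
  have := h t
  rw [factorMap_special, factorMap_special] at this
  exact mul_left_cancel₀ (inv_ne_zero (rowValue_ne_zero _ _)) this

/-- Together the two projections record every facet row, and the facet rows separate points. -/
theorem injOn_factorMap_prod [Finite κ] [Nonempty κ] (hS : IsSlackSystem v σ) {x y : E}
    (hx : x ∈ convexHull ℝ (range v)) (hy : y ∈ convexHull ℝ (range v))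
    (h : factorMap v σ ρ X x = factorMap v σ ρ X y)
    (h' : factorMap v σ ρ Xᶜ x = factorMap v σ ρ Xᶜ y) : x = y := by
  refine eq_of_facetRow_eq hS (convexHull_subset_affineSpan _ hx)
    (convexHull_subset_affineSpan _ hy) fun i hi => ?_
  by_cases hiX : i ∈ X
  · exact (factorMap_eq_iff.1 h).2 i hiX hi
  · exact (factorMap_eq_iff.1 h').2 i hiX hi

theorem rowValue_pos (hS : IsSlackSystem v σ) (i : Fin m) : 0 < rowValue (slack v σ) i := by
  refine lt_of_le_of_ne ?_ (rowValue_ne_zero _ _).symm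
  rw [rowValue]
  split_ifs with h
  · exact hS.nonneg _ _
  · exact zero_le_one

theorem factorVertex_nonneg (hS : IsSlackSystem v σ) (j : κ) (i : Fin (m + 1)) :
    0 ≤ factorVertex (slack v σ) ρ X j i := by
  rw [factorVertex, factorMatrix]
  refine Fin.lastCases ?_ (fun i => ?_) i
  · rw [Fin.lastCases_last]; split_ifs <;> norm_num
  · rw [Fin.lastCases_castSucc]
    split_ifs
    · norm_num
    · norm_num
    · exact hS.nonneg i j
    · exact le_rfl

theorem factorPolytope_nonneg (hS : IsSlackSystem v σ) {y : Fin (m + 1) → ℝ}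
    (hy : y ∈ factorPolytope (slack v σ) ρ X) (i : Fin (m + 1)) : 0 ≤ y i :=
  nonneg_of_mem_convexHull (g := (LinearMap.proj (R := ℝ) (φ := fun _ : Fin (m + 1) => ℝ) i).toAffineMap)
    (fun j => factorVertex_nonneg hS j i) hy

/-- Inside its affine hull, the factor is described by the nonnegativity of all coordinates. -/
theorem mem_factorPolytope_of_nonneg [Finite κ] [Nonempty κ] (hS : IsSlackSystem v σ)
    (hρ : SpecialRows (slack v σ) ρ) (hX : Separates (slack v σ) ρ X) {y : Fin (m + 1) → ℝ}
    (hy : y ∈ affineSpan ℝ (range (factorVertex (slack v σ) ρ X))) (hy0 : ∀ i, 0 ≤ y i) :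
    y ∈ factorPolytope (slack v σ) ρ X := by
  rw [← range_factorVertex hρ, ← AffineSubspace.map_span] at hy
  obtain ⟨x₁, hx₁, rfl⟩ := hy
  have hx₁' : x₁ ∈ affineSpan ℝ (range v) := hx₁
  obtain ⟨j₀, hj₀⟩ := hρ.base
  choose jt hjt using fun t => (hρ.facet t).1
  -- The last coordinate and the special coordinates are nonnegative with sum one; this is what the
  -- extra row of `factorMatrix` is for. As weights of one vertex of each type they give a point of
  -- the polytope with the same special rows as `x₁`, and `x₁` can be glued to it.
  let w : Option (Fin r) → ℝ := fun o =>
    o.elim (factorMap v σ ρ X x₁ (Fin.last m)) fun t => factorMap v σ ρ X x₁ (specialCoord ρ t)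
  let p : Option (Fin r) → E := fun o => o.elim (v j₀) fun t => v (jt t)
  have hw : ∑ o, w o = 1 := by
    rw [Fintype.sum_option]
    simp only [w, Option.elim, factorMap_last, factorMap_special]
    ring
  have hw0 : ∀ o, 0 ≤ w o := fun o => by cases o <;> exact hy0 _
  have hx₂ : ∑ o, w o • p o ∈ convexHull ℝ (range v) :=
    (convex_convexHull ℝ _).sum_mem (fun o _ => hw0 o) hw fun o _ =>
      subset_convexHull ℝ _ (by cases o <;> exact ⟨_, rfl⟩)
  have hnn : ∀ i ∈ X, FacetRow (slack v σ) i → 0 ≤ σ i x₁ := by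
    intro i hi hF
    by_cases hir : i ∈ range ρ
    · obtain ⟨t, rfl⟩ := hir
      have := hy0 (specialCoord ρ t)
      rw [factorMap_special] at this
      exact nonneg_of_mul_nonneg_right this (inv_pos.2 (rowValue_pos hS _))
    · have := hy0 i.castSucc
      simp only [factorMap, AffineMap.pi_apply, Fin.lastCases_castSucc, if_neg hir] at this
      rwa [if_pos ⟨hi, hF⟩] at this
  have hsp : ∀ t, σ (ρ t) x₁ = σ (ρ t) (∑ o, w o • p o) := by
    intro t
    rw [affine_apply_sum _ hw, Fintype.sum_option]
    have e0 : σ (ρ t) (p none) = 0 := hj₀ t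
    rw [e0, mul_zero, zero_add, Finset.sum_eq_single t]
    · have e1 : σ (ρ t) (p (some t)) = rowValue (slack v σ) (ρ t) := hρ.eq_rowValue (hjt t)
      have := rowValue_ne_zero (slack v σ) (ρ t)
      rw [e1]
      simp only [w, Option.elim, factorMap_special]
      field_simp
    · intro t' _ htt
      have : σ (ρ t) (p (some t')) = 0 := (hρ.disjoint t' t htt (jt t')).resolve_left (hjt t')
      rw [this, mul_zero]
    · simp
  obtain ⟨x, hx, hxe, -⟩ := exists_lift hS hρ hX hx₁' hnn hx₂ hsp
  rw [← image_factorMap hρ]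
  exact ⟨x, hx, hxe⟩

end Factor

end GluedProduct

/-! ### The factors are simplicial and their glued product is the polytope -/

namespace GluedProduct

section Factor

variable {m : ℕ} {E κ : Type*} [NormedAddCommGroup E] [NormedSpace ℝ E]
  {v : κ → E} {σ : Fin m → E →ᵃ[ℝ] ℝ} {r : ℕ} {ρ : Fin r → Fin m} {X : Set (Fin m)}

theorem factorPolytope_special_le_one {S : Fin m → κ → ℝ} {y : Fin (m + 1) → ℝ}
    (hy : y ∈ factorPolytope S ρ X) (t : Fin r) : y (specialCoord ρ t) ≤ 1 := by
  have := nonneg_of_mem_convexHull (g := AffineMap.const ℝ (Fin (m + 1) → ℝ) (1 : ℝ) -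
    (LinearMap.proj (R := ℝ) (φ := fun _ : Fin (m + 1) => ℝ) (specialCoord ρ t)).toAffineMap)
    (v := factorVertex S ρ X) (fun j => ?_) hy
  · simpa using this
  · rcases factorVertex_special S ρ X j t with h | h <;> simp [h.1]

theorem factorVertex_mem (S : Fin m → κ → ℝ) (ρ : Fin r → Fin m) (X : Set (Fin m)) (j : κ) :
    factorVertex S ρ X j ∈ factorPolytope S ρ X :=
  subset_convexHull ℝ _ ⟨j, rfl⟩

theorem factorVertex_special_eq (S : Fin m → κ → ℝ) (ρ : Fin r → Fin m) (X Y : Set (Fin m)) (j : κ)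
    (t : Fin r) :
    factorVertex S ρ X j (specialCoord ρ t) = factorVertex S ρ Y j (specialCoord ρ t) := by
  rcases factorVertex_special S ρ X j t with h | h <;>
  rcases factorVertex_special S ρ Y j t with h' | h'
  · rw [h.1, h'.1]
  · exact absurd h.2 h'.2
  · exact absurd h'.2 h.2
  · rw [h.1, h'.1]

/-- If a vertex of the factor is a proper combination of `y₁` and `y₂`, these have the same special
coordinates, since such coordinates lie between 0 and 1 and are 0 or 1 at the vertex. So both lift
to points whose other projection is that of `v j`. The lifts combine to `v j`, which is extreme. -/
theorem factorVertex_extreme [Finite κ] [Nonempty κ] (hS : IsSlackSystem v σ)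
    (hρ : SpecialRows (slack v σ) ρ) (hX : Separates (slack v σ) ρ X) (j : κ) :
    factorVertex (slack v σ) ρ X j ∈ (factorPolytope (slack v σ) ρ X).extremePoints ℝ := by
  refine ⟨factorVertex_mem _ _ _ j, ?_⟩
  rintro y₁ h₁ y₂ h₂ ⟨a, b, ha, hb, hab, hsum⟩
  have hsp : ∀ t, y₁ (specialCoord ρ t) = factorVertex (slack v σ) ρ X j (specialCoord ρ t) ∧
      y₂ (specialCoord ρ t) = factorVertex (slack v σ) ρ X j (specialCoord ρ t) := by
    intro t
    have e := congrFun hsum (specialCoord ρ t)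
    simp only [Pi.add_apply, Pi.smul_apply, smul_eq_mul] at e
    have l₁ := factorPolytope_nonneg hS h₁ (specialCoord ρ t)
    have l₂ := factorPolytope_nonneg hS h₂ (specialCoord ρ t)
    have u₁ := factorPolytope_special_le_one h₁ t
    have u₂ := factorPolytope_special_le_one h₂ t
    have p₁ := mul_nonneg ha.le l₁
    have p₂ := mul_nonneg hb.le l₂
    have q₁ := mul_nonneg ha.le (sub_nonneg.2 u₁)
    have q₂ := mul_nonneg hb.le (sub_nonneg.2 u₂)
    rcases factorVertex_special (slack v σ) ρ X j t with h | h
    · rw [h.1] at e ⊢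
      constructor
      · exact (mul_eq_zero.1 (by linarith : a * y₁ (specialCoord ρ t) = 0)).resolve_left ha.ne'
      · exact (mul_eq_zero.1 (by linarith : b * y₂ (specialCoord ρ t) = 0)).resolve_left hb.ne'
    · rw [h.1] at e ⊢
      constructor
      · have := (mul_eq_zero.1 (by linarith : a * (1 - y₁ (specialCoord ρ t)) = 0)).resolve_left
          ha.ne'
        linarith
      · have := (mul_eq_zero.1 (by linarith : b * (1 - y₂ (specialCoord ρ t)) = 0)).resolve_left
          hb.ne'
        linarith
  obtain ⟨x₁, hx₁, e₁, e₁'⟩ := exists_lift_of_mem hS hρ hX h₁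
    (factorVertex_mem (slack v σ) ρ Xᶜ j)
    fun t => (hsp t).1.trans (factorVertex_special_eq _ _ _ _ _ _)
  obtain ⟨x₂, hx₂, e₂, e₂'⟩ := exists_lift_of_mem hS hρ hX h₂
    (factorVertex_mem (slack v σ) ρ Xᶜ j)
    fun t => (hsp t).2.trans (factorVertex_special_eq _ _ _ _ _ _)
  have hj : v j ∈ convexHull ℝ (range v) := subset_convexHull ℝ _ ⟨j, rfl⟩
  have hcomb : a • x₁ + b • x₂ = v j := by
    refine injOn_factorMap_prod (ρ := ρ) (X := X) hS
      ((convex_convexHull ℝ _) hx₁ hx₂ ha.le hb.le hab) hj ?_ ?_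
    · rw [Convex.combo_affine_apply hab, e₁, e₂, hsum, factorMap_vertex hρ]
    · rw [Convex.combo_affine_apply hab, e₁', e₂', ← add_smul, hab, one_smul, factorMap_vertex hρ]
  have := (hS.extreme j).2 hx₁ hx₂ ⟨a, b, ha, hb, hab, hcomb⟩
  rw [← e₁, this, factorMap_vertex hρ]

theorem extremePoints_factorPolytope [Finite κ] [Nonempty κ] (hS : IsSlackSystem v σ)
    (hρ : SpecialRows (slack v σ) ρ) (hX : Separates (slack v σ) ρ X) :
    (factorPolytope (slack v σ) ρ X).extremePoints ℝ = range (factorVertex (slack v σ) ρ X) :=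
  Subset.antisymm extremePoints_convexHull_subset
    (by rintro _ ⟨j, rfl⟩; exact factorVertex_extreme hS hρ hX j)

/-- A function on the factor is pulled back along the projection, where the facet property of the
special row applies; the resulting identity is checked at the vertices of the factor. -/
theorem facetProperty_special [Finite κ] [Nonempty κ] (hS : IsSlackSystem v σ)
    (hρ : SpecialRows (slack v σ) ρ) (t : Fin r) :
    FacetProperty (factorVertex (slack v σ) ρ X)
      (LinearMap.proj (R := ℝ) (φ := fun _ : Fin (m + 1) => ℝ) (specialCoord ρ t)).toAffineMap := by
  intro h hh
  obtain ⟨c, hc⟩ := facetProperty_of_facetRow hS (hρ.facet t) (h.comp (factorMap v σ ρ X))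
    fun j hj => by
      rw [AffineMap.comp_apply, factorMap_vertex hρ]
      refine hh j ?_
      rcases factorVertex_special (slack v σ) ρ X j t with h | h
      · exact h.1
      · exact absurd hj h.2
  refine ⟨c * rowValue (slack v σ) (ρ t), fun x hx => ?_⟩
  refine affine_eqOn_affineSpan (f := h) (g := (c * rowValue (slack v σ) (ρ t)) •
    (LinearMap.proj (R := ℝ) (φ := fun _ : Fin (m + 1) => ℝ) (specialCoord ρ t)).toAffineMap) ?_ hx
  rintro _ ⟨j, rfl⟩
  have h1 := hc (v j) (vertex_mem v j)
  rw [AffineMap.comp_apply, factorMap_vertex hρ] at h1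
  rw [h1]
  rcases factorVertex_special (slack v σ) ρ X j t with h | h
  · have : σ (ρ t) (v j) = 0 := h.2
    simp [h.1, this]
  · have : σ (ρ t) (v j) = rowValue (slack v σ) (ρ t) := hρ.eq_rowValue h.2
    simp [h.1, this]

theorem isSimplicialFactor_factorPolytope [Finite κ] [Nonempty κ] (hS : IsSlackSystem v σ)
    (hρ : SpecialRows (slack v σ) ρ) :
    IsSimplicialFactor (specialCoord ρ) (factorPolytope (slack v σ) ρ X) where
  polytope := ⟨_, finite_range _, range_nonempty _, rfl⟩
  projection := by
    obtain ⟨j₀, hj₀⟩ := hρ.base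
    choose jt hjt using fun t => (hρ.facet t).1
    have himg : ∀ t j, slack v σ (ρ t) j ≠ 0 →
        (fun t' => factorVertex (slack v σ) ρ X j (specialCoord ρ t')) = Pi.single t (1 : ℝ) := by
      intro t j hj
      funext t'
      by_cases htt : t' = t
      · subst htt
        rcases factorVertex_special (slack v σ) ρ X j t' with h | h
        · exact absurd h.2 hj
        · simp [h.1]
      · rw [Pi.single_eq_of_ne htt]
        rcases factorVertex_special (slack v σ) ρ X j t' with h | h
        · exact h.1
        · exact absurd ((hρ.disjoint t t' (Ne.symm htt) j).resolve_left hj) h.2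
    have himg0 : ∀ j, (∀ t, slack v σ (ρ t) j = 0) →
        (fun t' => factorVertex (slack v σ) ρ X j (specialCoord ρ t')) = 0 := by
      intro j hj
      funext t'
      rcases factorVertex_special (slack v σ) ρ X j t' with h | h
      · exact h.1
      · exact absurd (hj t') h.2
    have := (LinearMap.funLeft ℝ ℝ (specialCoord ρ)).image_convexHull
      (range (factorVertex (slack v σ) ρ X))
    refine Eq.trans this ?_
    congr 1
    ext z
    constructor
    · rintro ⟨_, ⟨j, rfl⟩, rfl⟩
      by_cases hj : ∀ t, slack v σ (ρ t) j = 0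
      · exact Or.inl (himg0 j hj)
      · push Not at hj
        obtain ⟨t, ht⟩ := hj
        exact Or.inr ⟨t, (himg t j ht).symm⟩
    · rintro (rfl | ⟨t, rfl⟩)
      · exact ⟨_, ⟨j₀, rfl⟩, himg0 j₀ hj₀⟩
      · exact ⟨_, ⟨jt t, rfl⟩, himg t _ (hjt t)⟩
  zero_one := by
    intro x hx t
    obtain ⟨j, rfl⟩ := extremePoints_convexHull_subset hx
    rcases factorVertex_special (slack v σ) ρ X j t with h | h
    · exact Or.inl h.1
    · exact Or.inr h.1
  facet := by
    intro t
    obtain ⟨j₀, hj₀⟩ := hρ.base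
    obtain ⟨j₁, hj₁⟩ := (hρ.facet t).1
    have h0 : factorVertex (slack v σ) ρ X j₀ (specialCoord ρ t) = 0 := by
      rcases factorVertex_special (slack v σ) ρ X j₀ t with h | h
      · exact h.1
      · exact absurd (hj₀ t) h.2
    have h1 : factorVertex (slack v σ) ρ X j₁ (specialCoord ρ t) ≠ 0 := by
      rcases factorVertex_special (slack v σ) ρ X j₁ t with h | h
      · exact absurd h.2 hj₁
      · simp [h.1]
    exact ⟨fun x hx => factorPolytope_nonneg hS hx _, ⟨_, factorVertex_mem _ _ _ j₀, h0⟩,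
      (dim_face_add_one_iff (g := (LinearMap.proj (R := ℝ) (φ := fun _ : Fin (m + 1) => ℝ)
        (specialCoord ρ t)).toAffineMap) (fun j => factorVertex_nonneg hS j _) ⟨j₀, h0⟩
        ⟨j₁, h1⟩).2 (facetProperty_special hS hρ t)⟩

/-- Inside its affine hull the factor is given by nonnegativity of the coordinates, so its slacks
are the coordinates themselves. Several columns can project to the same vertex; `e` selects one of
each kind. -/
theorem isSlackMatrix_factor [Finite κ] [Nonempty κ] (hS : IsSlackSystem v σ)
    (hρ : SpecialRows (slack v σ) ρ) (hX : Separates (slack v σ) ρ X) {n : ℕ} {e : Fin n → κ}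
    (he : Function.Injective (factorVertex (slack v σ) ρ X ∘ e))
    (hr : range (factorVertex (slack v σ) ρ X ∘ e) = range (factorVertex (slack v σ) ρ X)) :
    IsSlackMatrix (Matrix.of fun i j => factorMatrix (slack v σ) ρ X i (e j))
      (factorPolytope (slack v σ) ρ X) := by
  obtain ⟨q, A, b, hA⟩ := exists_mulVec_eq_iff (range_nonempty (factorVertex (slack v σ) ρ X))
  refine ⟨factorVertex (slack v σ) ρ X ∘ e, -1, 0, q, A, b, he, ?_, ?_, ?_, ?_⟩
  · rw [hr, extremePoints_factorPolytope hS hρ hX]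
  · rw [hr, factorPolytope]
  · ext y
    simp only [Matrix.neg_mulVec, Matrix.one_mulVec, mem_ofPred_eq, ← hA]
    constructor
    · intro hy
      exact ⟨fun i => by simpa using factorPolytope_nonneg hS hy i,
        convexHull_subset_affineSpan _ hy⟩
    · rintro ⟨h1, h2⟩
      exact mem_factorPolytope_of_nonneg hS hρ hX h2 fun i => by simpa using h1 i
  · intro i j
    simp [Matrix.neg_mulVec, factorVertex]

/-- The pair of projections is injective on the polytope, and by lifting it reaches every pair of
vertices with equal special coordinates. -/
theorem affinelyIsomorphic_gluedProduct [Finite κ] [Nonempty κ] (hS : IsSlackSystem v σ)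
    (hρ : SpecialRows (slack v σ) ρ) (hX : Separates (slack v σ) ρ X) :
    AffinelyIsomorphic (convexHull ℝ (range v)) (gluedProduct (specialCoord ρ) (specialCoord ρ)
      (factorPolytope (slack v σ) ρ X) (factorPolytope (slack v σ) ρ Xᶜ)) := by
  have himg : ((factorMap v σ ρ X).prod (factorMap v σ ρ Xᶜ)) '' convexHull ℝ (range v) =
      gluedProduct (specialCoord ρ) (specialCoord ρ)
        (factorPolytope (slack v σ) ρ X) (factorPolytope (slack v σ) ρ Xᶜ) := by
    apply Subset.antisymm
    · rw [AffineMap.image_convexHull]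
      refine convexHull_mono ?_
      rintro _ ⟨_, ⟨j, rfl⟩, rfl⟩
      rw [AffineMap.prod_apply, factorMap_vertex hρ, factorMap_vertex hρ]
      exact ⟨factorVertex_extreme hS hρ hX j, factorVertex_extreme hS hρ hX.compl j,
        fun t => factorVertex_special_eq _ _ _ _ _ _⟩
    · refine convexHull_min ?_ ((convex_convexHull ℝ _).affine_image _)
      rintro ⟨y₁, y₂⟩ ⟨h₁, h₂, h⟩
      obtain ⟨x, hx, rfl, rfl⟩ := exists_lift_of_mem hS hρ hX h₁.1 h₂.1 h
      exact ⟨x, hx, rfl⟩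
  refine ⟨(factorMap v σ ρ X).prod (factorMap v σ ρ Xᶜ), ?_⟩
  rw [← himg]
  refine InjOn.bijOn_image fun x hx y hy h => ?_
  rw [AffineMap.prod_apply, AffineMap.prod_apply, Prod.mk.injEq] at h
  exact injOn_factorMap_prod hS hx hy h.1 h.2

theorem factorVertex_ne {S : Fin m → κ → ℝ} (hρ : SpecialRows S ρ) {i : Fin m} (hi : i ∈ X)
    (hF : FacetRow S i) {j j' : κ} (hjj : SameType S ρ j j') (hne : S i j ≠ S i j') :
    factorVertex S ρ X j ≠ factorVertex S ρ X j' := by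
  intro h
  have hir : i ∉ range ρ := by
    rintro ⟨t, rfl⟩
    exact hne (hρ.eq_of_sameType hjj t)
  have := congrFun h i.castSucc
  simp only [factorVertex, factorMatrix, Fin.lastCases_castSucc, if_neg hir] at this
  rw [if_pos ⟨hi, hF⟩, if_pos ⟨hi, hF⟩] at this
  exact hne this

/-- The projection to the special coordinates maps the direction of the factor onto ℝ^r. For an
r-dimensional simplex it would therefore be injective, but two columns of the same type differ in
row `i`. -/
theorem not_isSimplex_factorPolytope {S : Fin m → κ → ℝ} (hρ : SpecialRows S ρ) {i : Fin m}
    (hi : i ∈ X) (hF : FacetRow S i) (hc : ¬ TypeConst S ρ (S i)) :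
    ¬ IsSimplex r (factorPolytope S ρ X) := by
  rintro ⟨s, hs⟩
  simp only [TypeConst, not_forall] at hc
  obtain ⟨j, j', hjj, hne⟩ := hc
  have hfne := factorVertex_ne hρ hi hF hjj hne
  obtain ⟨j₀, hj₀⟩ := hρ.base
  choose jt hjt using fun t => (hρ.facet t).1
  set D := vectorSpan ℝ (range (factorVertex S ρ X)) with hD
  have hmem : ∀ j j', factorVertex S ρ X j - factorVertex S ρ X j' ∈ D := fun j j' =>
    vsub_mem_vectorSpan ℝ ⟨j, rfl⟩ ⟨j', rfl⟩
  have hrank : Module.finrank ℝ D = Module.finrank ℝ (Fin r → ℝ) := by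
    have h1 := s.independent.finrank_vectorSpan (Fintype.card_fin (r + 1))
    rw [← vectorSpan_convexHull, ← hs, factorPolytope, vectorSpan_convexHull] at h1
    rw [hD, h1, Module.finrank_fin_fun]
  let f : D →ₗ[ℝ] (Fin r → ℝ) := (LinearMap.funLeft ℝ ℝ (specialCoord ρ)).domRestrict D
  have hsurj : Function.Surjective f := by
    rw [← LinearMap.range_eq_top, eq_top_iff, ← (Pi.basisFun ℝ (Fin r)).span_eq,
      Submodule.span_le]
    rintro _ ⟨t, rfl⟩
    refine ⟨⟨_, hmem (jt t) j₀⟩, ?_⟩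
    funext t'
    have e0 : factorVertex S ρ X j₀ (specialCoord ρ t') = 0 := by
      rcases factorVertex_special S ρ X j₀ t' with h | h
      · exact h.1
      · exact absurd (hj₀ t') h.2
    simp only [f, LinearMap.domRestrict_apply, LinearMap.funLeft_apply, Pi.sub_apply, e0, sub_zero,
      Pi.basisFun_apply]
    by_cases htt : t' = t
    · subst htt
      rcases factorVertex_special S ρ X (jt t') t' with h | h
      · exact absurd h.2 (hjt t')
      · simp [h.1]
    · rw [Pi.single_eq_of_ne htt]
      rcases factorVertex_special S ρ X (jt t) t' with h | h
      · exact h.1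
      · exact absurd ((hρ.disjoint t t' (Ne.symm htt) _).resolve_left (hjt t)) h.2
  have hinj := (LinearMap.injective_iff_surjective_of_finrank_eq_finrank hrank).2 hsurj
  have hker : f ⟨_, hmem j j'⟩ = 0 := by
    funext t
    simp only [f, LinearMap.domRestrict_apply, LinearMap.funLeft_apply, Pi.sub_apply,
      Pi.zero_apply, sub_eq_zero]
    rcases factorVertex_special S ρ X j t with h | h <;>
    rcases factorVertex_special S ρ X j' t with h' | h'
    · rw [h.1, h'.1]
    · exact absurd ((hjj t).1 h.2) h'.2
    · exact absurd ((hjj t).2 h'.2) h.2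
    · rw [h.1, h'.1]
  have := hinj (hker.trans (map_zero f).symm)
  exact hfne (sub_eq_zero.1 (congrArg Subtype.val this))

theorem one_le_dim_factorPolytope {S : Fin m → κ → ℝ} (hρ : SpecialRows S ρ) (hr : 0 < r) :
    1 ≤ dim (factorPolytope S ρ X) := by
  obtain ⟨j₀, hj₀⟩ := hρ.base
  obtain ⟨j₁, hj₁⟩ := (hρ.facet ⟨0, hr⟩).1
  refine one_le_dim (factorVertex_mem S ρ X j₀) (factorVertex_mem S ρ X j₁) fun h => ?_
  have := congrFun h (specialCoord ρ ⟨0, hr⟩)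
  rcases factorVertex_special S ρ X j₀ ⟨0, hr⟩ with h | h <;>
  rcases factorVertex_special S ρ X j₁ ⟨0, hr⟩ with h' | h'
  · exact hj₁ h'.2
  · rw [h.1, h'.1] at this; exact zero_ne_one this
  · exact h.2 (hj₀ _)
  · exact h.2 (hj₀ _)

theorem one_le_dim_factorPolytope_of_not_typeConst {S : Fin m → κ → ℝ} (hρ : SpecialRows S ρ)
    {i : Fin m} (hi : i ∈ X) (hF : FacetRow S i) (hc : ¬ TypeConst S ρ (S i)) :
    1 ≤ dim (factorPolytope S ρ X) := by
  simp only [TypeConst, not_forall] at hc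
  obtain ⟨j, j', hjj, hne⟩ := hc
  exact one_le_dim (factorVertex_mem S ρ X j) (factorVertex_mem S ρ X j')
    (factorVertex_ne hρ hi hF hjj hne)

end Factor

/-- A polytope with a slack matrix comes from a slack system. -/
theorem IsSlackMatrix.exists_slackSystem {m n d : ℕ} {S : Matrix (Fin m) (Fin n) ℝ}
    {P : Set (Fin d → ℝ)} (h : IsSlackMatrix S P) :
    ∃ (v : Fin n → Fin d → ℝ) (σ : Fin m → (Fin d → ℝ) →ᵃ[ℝ] ℝ), IsSlackSystem v σ ∧
      P = convexHull ℝ (range v) ∧ S = slack v σ := by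
  obtain ⟨v, A, b, q, A', b', hinj, hext, hconv, hP, hS⟩ := h
  let σ : Fin m → (Fin d → ℝ) →ᵃ[ℝ] ℝ := fun i => AffineMap.const ℝ (Fin d → ℝ) (b i) -
    ((LinearMap.proj i).comp (Matrix.mulVecLin A)).toAffineMap
  have hσ : ∀ i x, σ i x = b i - A.mulVec x i := fun i x => rfl
  have hvP : ∀ j, v j ∈ P := fun j => hconv ▸ subset_convexHull ℝ _ ⟨j, rfl⟩
  refine ⟨v, σ, ⟨hinj, fun j => ?_, fun i j => ?_, fun x hx hnn => ?_⟩, hconv, ?_⟩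
  · rw [← hconv, ← hext]
    exact ⟨j, rfl⟩
  · have := hvP j
    rw [hP] at this
    rw [hσ]
    exact sub_nonneg.2 (this.1 i)
  · rw [← hconv, hP]
    refine ⟨fun i => sub_nonneg.1 (hnn i), ?_⟩
    refine affine_eqOn_affineSpan (f := (Matrix.mulVecLin A').toAffineMap)
      (g := AffineMap.const ℝ (Fin d → ℝ) b') ?_ hx
    rintro _ ⟨j, rfl⟩
    have := hvP j
    rw [hP] at this
    exact this.2
  · funext i j
    rw [hS i j]
    rfl

end GluedProduct

/-! ### The rows of a slack matrix of a simplicial glued product -/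

namespace GluedProduct

/-- The vertices of the standard simplex `conv {0, e_1, …, e_r}`. -/
noncomputable def simplexVertex {r : ℕ} (o : Option (Fin r)) : Fin r → ℝ :=
  o.elim 0 fun t => Pi.single t 1

/-- The affine function of the selected coordinates with value `a o` over the vertex `o` of the
simplex. -/
noncomputable def typeFn {r d : ℕ} (c : Fin r → Fin d) (a : Option (Fin r) → ℝ) :
    (Fin d → ℝ) →ᵃ[ℝ] ℝ :=
  AffineMap.const ℝ (Fin d → ℝ) (a none) + (∑ t, (a (some t) - a none) •
    LinearMap.proj (R := ℝ) (φ := fun _ : Fin d => ℝ) (c t)).toAffineMap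

theorem typeFn_apply {r d : ℕ} (c : Fin r → Fin d) (a : Option (Fin r) → ℝ) (x : Fin d → ℝ) :
    typeFn c a x = a none + ∑ t, (a (some t) - a none) * x (c t) := by
  simp [typeFn]

theorem typeFn_of_type {r d : ℕ} {c : Fin r → Fin d} {a : Option (Fin r) → ℝ} {x : Fin d → ℝ}
    {o : Option (Fin r)} (h : ∀ t, x (c t) = simplexVertex o t) : typeFn c a x = a o := by
  rw [typeFn_apply]
  simp only [h]
  cases o with
  | none => simp [simplexVertex]
  | some t => simp [simplexVertex, Pi.single_apply]

theorem typeFn_congr {r d d' : ℕ} {c : Fin r → Fin d} {c' : Fin r → Fin d'}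
    {a : Option (Fin r) → ℝ} {x : Fin d → ℝ} {y : Fin d' → ℝ} (h : ∀ t, x (c t) = y (c' t)) :
    typeFn c a x = typeFn c' a y := by
  simp only [typeFn_apply, h]

theorem IsPolytope.finite_extremePoints {d : ℕ} {P : Set (Fin d → ℝ)} (h : IsPolytope P) :
    (P.extremePoints ℝ).Finite := by
  obtain ⟨V, hV, -, rfl⟩ := h
  exact hV.subset extremePoints_convexHull_subset

theorem IsPolytope.convexHull_extremePoints {d : ℕ} {P : Set (Fin d → ℝ)} (h : IsPolytope P) :
    convexHull ℝ (P.extremePoints ℝ) = P := by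
  have hfin := h.finite_extremePoints
  obtain ⟨V, hV, -, rfl⟩ := h
  have := closure_convexHull_extremePoints (hV.isCompact_convexHull ℝ) (convex_convexHull ℝ V)
  rwa [(hfin.isClosed_convexHull ℝ).closure_eq] at this

namespace IsSimplicialFactor

variable {r d : ℕ} {c : Fin r → Fin d} {P : Set (Fin d → ℝ)}

theorem convexHull_range (h : IsSimplicialFactor c P) :
    convexHull ℝ (range (Subtype.val : P.extremePoints ℝ → Fin d → ℝ)) = P := by
  rw [Subtype.range_coe_subtype]
  exact h.polytope.convexHull_extremePoints

/-- Two selected coordinates equal to 1 would have sum 2, whereas the sum of two different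
coordinates is at most 1 on the simplex. -/
theorem exists_type (h : IsSimplicialFactor c P) {x : Fin d → ℝ} (hx : x ∈ P.extremePoints ℝ) :
    ∃ o : Option (Fin r), ∀ t, x (c t) = simplexVertex o t := by
  classical
  by_cases h0 : ∀ t, x (c t) = 0
  · exact ⟨none, fun t => by simp [simplexVertex, h0 t]⟩
  · push Not at h0
    obtain ⟨t, ht⟩ := h0
    have ht1 := (h.zero_one x hx t).resolve_left ht
    refine ⟨some t, fun t' => ?_⟩
    by_cases htt : t' = t
    · subst htt; simp [simplexVertex, ht1]
    · simp only [simplexVertex, Option.elim, Pi.single_eq_of_ne htt]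
      refine (h.zero_one x hx t').resolve_right fun ht1' => ?_
      have hmem : (fun i => x (c i)) ∈
          convexHull ℝ (insert 0 (range fun i : Fin r => (Pi.single i 1 : Fin r → ℝ))) := by
        rw [← h.projection]
        exact ⟨x, hx.1, rfl⟩
      have hconv : Convex ℝ {y : Fin r → ℝ | y t + y t' ≤ 1} := by
        have := (convex_Iic (1 : ℝ)).linear_preimage
          (LinearMap.proj (R := ℝ) (φ := fun _ : Fin r => ℝ) t + LinearMap.proj t')
        exact this
      have := convexHull_min (t := {y : Fin r → ℝ | y t + y t' ≤ 1}) ?_ hconv hmem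
      · simp only [mem_ofPred_eq, ht1, ht1'] at this
        norm_num at this
      · rintro _ (rfl | ⟨s, rfl⟩)
        · simp
        · simp only [mem_ofPred_eq, Pi.single_apply]
          split_ifs with h1 h2
          · exact absurd (h2.trans h1.symm) htt
          all_goals norm_num

/-- Some point of `P` lies over `o`. The function with value 0 over `o` and 1 over the other
vertices of the simplex is nonnegative and vanishes at this point, hence also at some vertex of `P`.
-/
theorem exists_vertex (h : IsSimplicialFactor c P) (o : Option (Fin r)) :
    ∃ x ∈ P.extremePoints ℝ, ∀ t, x (c t) = simplexVertex o t := by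
  classical
  have hmem : simplexVertex o ∈
      convexHull ℝ (insert 0 (range fun i : Fin r => (Pi.single i 1 : Fin r → ℝ))) := by
    refine subset_convexHull ℝ _ ?_
    cases o with
    | none => exact Or.inl rfl
    | some t => exact Or.inr ⟨t, rfl⟩
  rw [← h.projection] at hmem
  obtain ⟨y, hy, hyo⟩ := hmem
  rw [← h.convexHull_range] at hy
  obtain ⟨x, hx⟩ := exists_vertex_eq_zero (v := (Subtype.val : P.extremePoints ℝ → Fin d → ℝ))
    (g := typeFn c fun o' => if o' = o then 0 else 1) (fun x => by
      obtain ⟨o', ho'⟩ := h.exists_type x.2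
      rw [typeFn_of_type ho']
      split_ifs <;> norm_num) hy (by
      rw [typeFn_of_type (o := o) fun t => congrFun hyo t]
      simp)
  refine ⟨x, x.2, ?_⟩
  obtain ⟨o', ho'⟩ := h.exists_type x.2
  rw [typeFn_of_type ho'] at hx
  have : o' = o := by
    by_contra hne
    simp [hne] at hx
  rwa [this] at ho'

theorem facetProperty (h : IsSimplicialFactor c P) (t : Fin r) :
    FacetProperty (Subtype.val : P.extremePoints ℝ → Fin d → ℝ)
      (LinearMap.proj (R := ℝ) (φ := fun _ : Fin d => ℝ) (c t)).toAffineMap := by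
  obtain ⟨x₀, hx₀, h0⟩ := h.exists_vertex none
  obtain ⟨x₁, hx₁, h1⟩ := h.exists_vertex (some t)
  refine (dim_face_add_one_iff (fun x => ?_) ⟨⟨x₀, hx₀⟩, ?_⟩ ⟨⟨x₁, hx₁⟩, ?_⟩).1 ?_
  · exact (h.facet t).1 x x.2.1
  · change x₀ (c t) = 0
    rw [h0 t]; rfl
  · change x₁ (c t) ≠ 0
    rw [h1 t]; simp [simplexVertex]
  · rw [h.convexHull_range]
    exact (h.facet t).2.2

/-- There is then exactly one vertex over each of the r + 1 vertices of the simplex, and these are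
affinely independent because their projections are. -/
theorem isSimplex (h : IsSimplicialFactor c P)
    (hinj : ∀ x ∈ P.extremePoints ℝ, ∀ y ∈ P.extremePoints ℝ, (∀ t, x (c t) = y (c t)) → x = y) :
    IsSimplex r P := by
  choose x hx hxt using h.exists_vertex
  let p : Fin (r + 1) → Fin d → ℝ := Fin.cases (x none) fun t => x (some t)
  have hp : AffineIndependent ℝ p := by
    rw [affineIndependent_iff_of_fintype]
    intro w hw h0
    rw [Finset.univ.weightedVSub_eq_linear_combination hw] at h0
    have hsucc : ∀ t : Fin r, w t.succ = 0 := by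
      intro t
      have := congrFun h0 (c t)
      rw [Finset.sum_apply, Fin.sum_univ_succ] at this
      simpa [p, hxt, simplexVertex, Pi.single_apply] using this
    intro i
    refine Fin.cases ?_ hsucc i
    rw [Fin.sum_univ_succ] at hw
    simpa [hsucc] using hw
  refine ⟨⟨p, hp⟩, ?_⟩
  conv_lhs => rw [← h.polytope.convexHull_extremePoints]
  congr 1
  apply Subset.antisymm
  · intro y hy
    obtain ⟨o, ho⟩ := h.exists_type hy
    have : y = x o := hinj y hy _ (hx o) fun t => by rw [ho, hxt]
    cases o with
    | none => exact ⟨0, this.symm⟩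
    | some t => exact ⟨t.succ, this.symm⟩
  · rintro _ ⟨i, rfl⟩
    refine Fin.cases ?_ (fun t => ?_) i
    · exact hx none
    · exact hx (some t)

end IsSimplicialFactor

/-- An affine map that is injective on a polytope has an affine left inverse. -/
theorem exists_affine_leftInverse {E F ι κ : Type*} [NormedAddCommGroup E] [NormedSpace ℝ E]
    [AddCommGroup F] [Module ℝ F] [Finite ι] [Finite κ] [Nonempty κ] {v : κ → E}
    {σ : ι → E →ᵃ[ℝ] ℝ} (hS : IsSlackSystem v σ) {f : E →ᵃ[ℝ] F}
    (hf : InjOn f (convexHull ℝ (range v))) : ∃ g : F →ᵃ[ℝ] E, ∀ j, g (f (v j)) = v j := by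
  set D := vectorSpan ℝ (range v)
  -- A short step from an interior point in any direction of `D` stays in the polytope, so
  -- injectivity of `f` there passes to its linear part on `D`.
  have hker : LinearMap.ker (f.linear.domRestrict D) = ⊥ := by
    rw [LinearMap.ker_eq_bot']
    rintro ⟨u, hu⟩ hu0
    obtain ⟨J, hJ, hmin⟩ := exists_minimal_defines hS
    obtain ⟨z, hz, hzpos⟩ := exists_interior_point hS univ univ_nonempty
    rw [image_univ] at hz
    have hev := hJ.eventually_mem (convexHull_subset_affineSpan _ hz) hu fun i hi =>
      Or.inl (hzpos i (by simpa using exists_vertex_ne_of_minimal hS hJ hmin hi))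
    obtain ⟨t, ht, ht0⟩ := (hev.and self_mem_nhdsWithin).exists
    have h1 : f (z + t • u) = f z := by
      have h2 : f.linear u = 0 := hu0
      have h3 := f.map_vadd z (t • u)
      rw [map_smul, h2, smul_zero, zero_vadd, vadd_eq_add, add_comm] at h3
      exact h3
    have h4 := hf ht hz h1
    have h5 : t • u = 0 := by simpa using h4
    exact Subtype.ext ((smul_eq_zero.1 h5).resolve_left (ne_of_gt ht0))
  obtain ⟨L, hL⟩ := LinearMap.exists_leftInverse_of_injective _ hker
  set p := v (Classical.arbitrary κ) with hp
  refine ⟨(D.subtype ∘ₗ L).toAffineMap + AffineMap.const ℝ F (p - L (f p)), fun j => ?_⟩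
  have hu : v j - p ∈ D := vsub_mem_vectorSpan ℝ ⟨j, rfl⟩ ⟨_, rfl⟩
  have h1 := congrArg Subtype.val (LinearMap.congr_fun hL ⟨v j - p, hu⟩)
  rw [LinearMap.comp_apply, LinearMap.domRestrict_apply, affine_apply_sub, map_sub,
    LinearMap.id_apply, Submodule.coe_sub] at h1
  simp only [AffineMap.coe_add, Pi.add_apply, LinearMap.coe_toAffineMap, LinearMap.comp_apply,
    Submodule.subtype_apply, AffineMap.const_apply]
  rw [add_sub_left_comm, h1]
  exact add_sub_cancel p (v j)

theorem affineMap_prod_split {F₁ F₂ : Type*} [AddCommGroup F₁] [Module ℝ F₁] [AddCommGroup F₂]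
    [Module ℝ F₂] (h : F₁ × F₂ →ᵃ[ℝ] ℝ) :
    ∃ (h₁ : F₁ →ᵃ[ℝ] ℝ) (h₂ : F₂ →ᵃ[ℝ] ℝ), ∀ z, h z = h₁ z.1 + h₂ z.2 := by
  refine ⟨(h.linear ∘ₗ LinearMap.inl ℝ F₁ F₂).toAffineMap,
    (h.linear ∘ₗ LinearMap.inr ℝ F₁ F₂).toAffineMap + AffineMap.const ℝ F₂ (h 0), fun z => ?_⟩
  have h1 := affine_apply_sub h z 0
  rw [sub_zero] at h1
  have h2 : z = LinearMap.inl ℝ F₁ F₂ z.1 + LinearMap.inr ℝ F₁ F₂ z.2 := by simp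
  have h3 : h.linear z = h.linear (LinearMap.inl ℝ F₁ F₂ z.1) +
    h.linear (LinearMap.inr ℝ F₁ F₂ z.2) := by rw [← map_add, ← h2]
  simp only [AffineMap.coe_add, Pi.add_apply, LinearMap.coe_toAffineMap, LinearMap.comp_apply,
    AffineMap.const_apply]
  linarith

/-- A bijection of polytopes by an affine map preserves the extreme points. -/
theorem mem_extremePoints_iff_of_bijOn {E F : Type*} [AddCommGroup E] [Module ℝ E]
    [AddCommGroup F] [Module ℝ F] {P : Set E} {Q : Set F} (hP : Convex ℝ P) {f : E →ᵃ[ℝ] F}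
    (hf : BijOn f P Q) {x : E} (hx : x ∈ P) :
    f x ∈ Q.extremePoints ℝ ↔ x ∈ P.extremePoints ℝ := by
  constructor
  · intro h
    refine ⟨hx, ?_⟩
    rintro a ha b hb ⟨α, β, hα, hβ, hαβ, rfl⟩
    exact hf.injOn ha hx (h.2 (hf.mapsTo ha) (hf.mapsTo hb)
      ⟨α, β, hα, hβ, hαβ, (Convex.combo_affine_apply hαβ).symm⟩)
  · intro h
    refine ⟨hf.mapsTo hx, ?_⟩
    rintro _ hq₁ _ hq₂ ⟨α, β, hα, hβ, hαβ, hs⟩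
    obtain ⟨a, ha, rfl⟩ := hf.surjOn hq₁
    obtain ⟨b, hb, rfl⟩ := hf.surjOn hq₂
    rw [← Convex.combo_affine_apply hαβ] at hs
    have := hf.injOn (hP ha hb hα.le hβ.le hαβ) hx hs
    rw [h.2 ha hb ⟨α, β, hα, hβ, hαβ, this⟩]

/-- The product is contained in `P₁ ×ˢ P₂`, and a point that is extreme in a larger set is extreme
in a smaller one that contains it. -/
theorem extremePoints_gluedProduct {r d₁ d₂ : ℕ} (c₁ : Fin r → Fin d₁) (c₂ : Fin r → Fin d₂)
    (P₁ : Set (Fin d₁ → ℝ)) (P₂ : Set (Fin d₂ → ℝ)) (hP₁ : Convex ℝ P₁) (hP₂ : Convex ℝ P₂) :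
    (gluedProduct c₁ c₂ P₁ P₂).extremePoints ℝ = {z | z.1 ∈ P₁.extremePoints ℝ ∧
      z.2 ∈ P₂.extremePoints ℝ ∧ ∀ i, z.1 (c₁ i) = z.2 (c₂ i)} := by
  refine Subset.antisymm extremePoints_convexHull_subset fun z hz => ?_
  have hsub : gluedProduct c₁ c₂ P₁ P₂ ⊆ P₁ ×ˢ P₂ :=
    convexHull_min (fun z hz => ⟨hz.1.1, hz.2.1.1⟩) (hP₁.prod hP₂)
  refine inter_extremePoints_subset_extremePoints_of_subset hsub
    ⟨subset_convexHull ℝ _ hz, ?_⟩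
  rw [extremePoints_prod]
  exact ⟨hz.1, hz.2.1⟩

end GluedProduct

/-! ### Facet rows of a glued product -/

namespace GluedProduct

/-- The vertices of a polytope that is affinely isomorphic to a simplicial glued product: vertex `j`
is the pair `(p j, q j)`. -/
structure IsGluedPresentation {E κ : Type*} [AddCommGroup E] [Module ℝ E] {r d₁ d₂ : ℕ}
    (c₁ : Fin r → Fin d₁) (c₂ : Fin r → Fin d₂) (P₁ : Set (Fin d₁ → ℝ)) (P₂ : Set (Fin d₂ → ℝ))
    (v : κ → E) (p : E →ᵃ[ℝ] (Fin d₁ → ℝ)) (q : E →ᵃ[ℝ] (Fin d₂ → ℝ)) : Prop where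
  left : IsSimplicialFactor c₁ P₁
  right : IsSimplicialFactor c₂ P₂
  mem_left : ∀ j, p (v j) ∈ P₁.extremePoints ℝ
  mem_right : ∀ j, q (v j) ∈ P₂.extremePoints ℝ
  coord_eq : ∀ j t, p (v j) (c₁ t) = q (v j) (c₂ t)
  pair : ∀ x ∈ P₁.extremePoints ℝ, ∀ y ∈ P₂.extremePoints ℝ, (∀ t, x (c₁ t) = y (c₂ t)) →
    ∃ j, p (v j) = x ∧ q (v j) = y
  split : ∀ h : E →ᵃ[ℝ] ℝ, ∃ (h₁ : (Fin d₁ → ℝ) →ᵃ[ℝ] ℝ) (h₂ : (Fin d₂ → ℝ) →ᵃ[ℝ] ℝ),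
    ∀ j, h (v j) = h₁ (p (v j)) + h₂ (q (v j))

/-- An affine left inverse of the isomorphism carries affine functions over to the product space,
where they split into a function of each component. -/
theorem exists_isGluedPresentation {E ι κ : Type*} [NormedAddCommGroup E] [NormedSpace ℝ E]
    [Finite ι] [Finite κ] [Nonempty κ] {v : κ → E} {σ : ι → E →ᵃ[ℝ] ℝ} (hS : IsSlackSystem v σ)
    {r d₁ d₂ : ℕ} {c₁ : Fin r → Fin d₁} {c₂ : Fin r → Fin d₂} {P₁ : Set (Fin d₁ → ℝ)}
    {P₂ : Set (Fin d₂ → ℝ)} (h₁ : IsSimplicialFactor c₁ P₁) (h₂ : IsSimplicialFactor c₂ P₂)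
    (hiso : AffinelyIsomorphic (convexHull ℝ (range v)) (gluedProduct c₁ c₂ P₁ P₂)) :
    ∃ p q, IsGluedPresentation c₁ c₂ P₁ P₂ v p q := by
  obtain ⟨f, hf⟩ := hiso
  have hP₁ : Convex ℝ P₁ := h₁.convexHull_range ▸ convex_convexHull ℝ _
  have hP₂ : Convex ℝ P₂ := h₂.convexHull_range ▸ convex_convexHull ℝ _
  have hext := extremePoints_gluedProduct c₁ c₂ P₁ P₂ hP₁ hP₂
  have hvert : ∀ j, f (v j) ∈ (gluedProduct c₁ c₂ P₁ P₂).extremePoints ℝ := fun j =>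
    (mem_extremePoints_iff_of_bijOn (convex_convexHull ℝ _) hf
      (subset_convexHull ℝ _ ⟨j, rfl⟩)).2 (hS.extreme j)
  rw [hext] at hvert
  obtain ⟨g, hg⟩ := exists_affine_leftInverse hS hf.injOn
  refine ⟨AffineMap.fst.comp f, AffineMap.snd.comp f, h₁, h₂, fun j => (hvert j).1,
    fun j => (hvert j).2.1, fun j => (hvert j).2.2, fun x hx y hy hxy => ?_, fun h => ?_⟩
  · have hz : (x, y) ∈ (gluedProduct c₁ c₂ P₁ P₂).extremePoints ℝ := by
      rw [hext]
      exact ⟨hx, hy, hxy⟩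
    obtain ⟨u, hu, huz⟩ := hf.surjOn hz.1
    rw [← huz, mem_extremePoints_iff_of_bijOn (convex_convexHull ℝ _) hf hu] at hz
    obtain ⟨j, rfl⟩ := extremePoints_convexHull_subset hz
    exact ⟨j, by simp [huz], by simp [huz]⟩
  · obtain ⟨k₁, k₂, hk⟩ := affineMap_prod_split (h.comp g)
    refine ⟨k₁, k₂, fun j => ?_⟩
    have := hk (f (v j))
    rwa [AffineMap.comp_apply, hg j] at this

namespace IsGluedPresentation

variable {E ι κ : Type*} [NormedAddCommGroup E] [NormedSpace ℝ E]
  {v : κ → E} {σ : ι → E →ᵃ[ℝ] ℝ} {r d₁ d₂ : ℕ} {c₁ : Fin r → Fin d₁} {c₂ : Fin r → Fin d₂}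
  {P₁ : Set (Fin d₁ → ℝ)} {P₂ : Set (Fin d₂ → ℝ)} {p : E →ᵃ[ℝ] (Fin d₁ → ℝ)}
  {q : E →ᵃ[ℝ] (Fin d₂ → ℝ)}

theorem exists_pair (h : IsGluedPresentation c₁ c₂ P₁ P₂ v p q) (o : Option (Fin r)) :
    ∃ j, ∀ t, p (v j) (c₁ t) = simplexVertex o t := by
  obtain ⟨x, hx, hxt⟩ := h.left.exists_vertex o
  obtain ⟨y, hy, hyt⟩ := h.right.exists_vertex o
  obtain ⟨j, rfl, rfl⟩ := h.pair x hx y hy fun t => by rw [hxt, hyt]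
  exact ⟨j, hxt⟩

/-- The `t`-th common coordinate as a function on the ambient space of the polytope. -/
noncomputable def coordFn (c₁ : Fin r → Fin d₁) (p : E →ᵃ[ℝ] (Fin d₁ → ℝ)) (t : Fin r) :
    E →ᵃ[ℝ] ℝ :=
  (LinearMap.proj (R := ℝ) (φ := fun _ : Fin d₁ => ℝ) (c₁ t)).toAffineMap.comp p

theorem coordFn_apply (t : Fin r) (x : E) : coordFn c₁ p t x = p x (c₁ t) := rfl

/-- If `h₁ + h₂` vanishes at all pairs of the same type with coordinate 0, each summand is constant
on types among these vertices. Moving the type function `A` from one summand to the other makes both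
vanish on the facets of their factors, so both are multiples of the coordinate. -/
theorem facetProperty_coordFn (h : IsGluedPresentation c₁ c₂ P₁ P₂ v p q) (t : Fin r) :
    FacetProperty v (coordFn c₁ p t) := by
  intro g hg
  obtain ⟨h₁, h₂, hsplit⟩ := h.split g
  choose x hx hxt using h.left.exists_vertex
  choose y hy hyt using h.right.exists_vertex
  have hzero : ∀ a ∈ P₁.extremePoints ℝ, ∀ b ∈ P₂.extremePoints ℝ, (∀ t, a (c₁ t) = b (c₂ t)) →
      a (c₁ t) = 0 → h₁ a + h₂ b = 0 := by
    intro a ha b hb hab ha0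
    obtain ⟨j, rfl, rfl⟩ := h.pair a ha b hb hab
    rw [← hsplit, hg j ha0]
  set A : Option (Fin r) → ℝ := fun o => h₁ (x o) with hA
  obtain ⟨k₁, hk₁⟩ := h.left.facetProperty t (h₁ - typeFn c₁ A) fun a ha => by
    obtain ⟨o, ho⟩ := h.left.exists_type a.2
    have ha0 : a.1 (c₁ t) = 0 := ha
    have e1 := hzero a.1 a.2 (y o) (hy o) (fun t => by rw [ho, hyt]) ha0
    have e2 := hzero (x o) (hx o) (y o) (hy o) (fun t => by rw [hxt, hyt])
      (by rw [hxt, ← ho, ha0])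
    rw [AffineMap.coe_sub, Pi.sub_apply, typeFn_of_type ho, hA]
    linarith
  obtain ⟨k₂, hk₂⟩ := h.right.facetProperty t (h₂ + typeFn c₂ A) fun b hb => by
    obtain ⟨o, ho⟩ := h.right.exists_type b.2
    have hb0 : b.1 (c₂ t) = 0 := hb
    have e2 := hzero (x o) (hx o) b.1 b.2 (fun t => by rw [hxt, ho])
      (by rw [hxt, ← ho, hb0])
    rw [AffineMap.coe_add, Pi.add_apply, typeFn_of_type ho, hA]
    linarith
  refine ⟨k₁ + k₂, fun z hz => ?_⟩
  refine affine_eqOn_affineSpan (f := g) (g := (k₁ + k₂) • coordFn c₁ p t) ?_ hz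
  rintro _ ⟨j, rfl⟩
  have e1 := hk₁ _ (subset_affineSpan ℝ _ ⟨⟨_, h.mem_left j⟩, rfl⟩)
  have e2 := hk₂ _ (subset_affineSpan ℝ _ ⟨⟨_, h.mem_right j⟩, rfl⟩)
  have e3 : typeFn c₁ A (p (v j)) = typeFn c₂ A (q (v j)) := typeFn_congr (h.coord_eq j)
  simp only [AffineMap.coe_sub, Pi.sub_apply, AffineMap.coe_add, Pi.add_apply,
    LinearMap.coe_toAffineMap, LinearMap.proj_apply] at e1 e2
  rw [← h.coord_eq j t] at e2
  rw [hsplit, AffineMap.coe_smul, Pi.smul_apply, coordFn_apply, smul_eq_mul]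
  linarith

theorem coord_zero_or_one (h : IsGluedPresentation c₁ c₂ P₁ P₂ v p q) (j : κ) (t : Fin r) :
    p (v j) (c₁ t) = 0 ∨ p (v j) (c₁ t) = 1 :=
  h.left.zero_one _ (h.mem_left j) t

/-- Each common coordinate defines a facet of the product, so up to a scalar it occurs among the
rows. -/
theorem exists_specialRows [Finite ι] [Finite κ] [Nonempty κ] (hS : IsSlackSystem v σ)
    (h : IsGluedPresentation c₁ c₂ P₁ P₂ v p q) :
    ∃ ρ : Fin r → ι, SpecialRows (slack v σ) ρ ∧
      ∀ t, ∃ a : ℝ, a ≠ 0 ∧ ∀ j, slack v σ (ρ t) j = a * p (v j) (c₁ t) := by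
  have hex : ∀ t, ∃ i, FacetRow (slack v σ) i ∧
      ∃ a : ℝ, a ≠ 0 ∧ ∀ j, slack v σ i j = a * p (v j) (c₁ t) := fun t => by
    obtain ⟨j₀, hj₀⟩ := h.exists_pair none
    obtain ⟨j₁, hj₁⟩ := h.exists_pair (some t)
    refine exists_facetRow_of_facetProperty hS (g := coordFn c₁ p t) (fun j => ?_) ⟨j₀, ?_⟩
      ⟨j₁, ?_⟩ (h.facetProperty_coordFn t)
    · rw [coordFn_apply]
      rcases h.coord_zero_or_one j t with e | e <;> rw [e]
      exact zero_le_one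
    · rw [coordFn_apply, hj₀ t]; rfl
    · rw [coordFn_apply, hj₁ t]; simp [simplexVertex]
  choose ρ hF a ha hρ using hex
  have hne : ∀ t j, slack v σ (ρ t) j ≠ 0 → p (v j) (c₁ t) = 1 := by
    intro t j hj
    refine (h.coord_zero_or_one j t).resolve_left fun h0 => hj ?_
    rw [hρ, h0, mul_zero]
  refine ⟨ρ, ⟨hF, fun t j j' hj hj' => ?_, fun t t' htt j => ?_, ?_⟩, fun t => ⟨a t, ha t, hρ t⟩⟩
  · rw [hρ, hρ, hne t j hj, hne t j' hj']
  · by_contra! hcon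
    have e1 := hne t j hcon.1
    have e2 := hne t' j hcon.2
    obtain ⟨o, ho⟩ := h.left.exists_type (h.mem_left j)
    rw [ho] at e1 e2
    cases o with
    | none => simp [simplexVertex] at e1
    | some s =>
      simp only [simplexVertex, Option.elim, Pi.single_apply] at e1 e2
      split_ifs at e1 e2 with i1 i2
      · exact htt (i1.trans i2.symm)
      · exact zero_ne_one e2
      · exact zero_ne_one e1
      · exact zero_ne_one e1
  · obtain ⟨j₀, hj₀⟩ := h.exists_pair none
    refine ⟨j₀, fun t => ?_⟩
    rw [hρ, hj₀ t]
    simp [simplexVertex]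

theorem exists_min_type {d : ℕ} {c : Fin r → Fin d} {P : Set (Fin d → ℝ)}
    (h : IsSimplicialFactor c P) (g : (Fin d → ℝ) →ᵃ[ℝ] ℝ) (o : Option (Fin r)) :
    ∃ x ∈ P.extremePoints ℝ, (∀ t, x (c t) = simplexVertex o t) ∧
      ∀ y ∈ P.extremePoints ℝ, (∀ t, y (c t) = simplexVertex o t) → g x ≤ g y := by
  obtain ⟨x, hx, hxt⟩ := h.exists_vertex o
  obtain ⟨z, hz, hmin⟩ := Set.exists_min_image
    {y | y ∈ P.extremePoints ℝ ∧ ∀ t, y (c t) = simplexVertex o t} g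
    (h.polytope.finite_extremePoints.subset fun y hy => hy.1) ⟨x, hx, hxt⟩
  exact ⟨z, hz.1, hz.2, fun y hy hyt => hmin y ⟨hy, hyt⟩⟩

/-- Each facet row depends only on one of the factors. -/
theorem facetRow_left_or_right [Finite ι] [Finite κ] [Nonempty κ] (hS : IsSlackSystem v σ)
    (h : IsGluedPresentation c₁ c₂ P₁ P₂ v p q) {i : ι} (hi : FacetRow (slack v σ) i) :
    (∀ j j', p (v j) = p (v j') → slack v σ i j = slack v σ i j') ∨
      ∀ j j', q (v j) = q (v j') → slack v σ i j = slack v σ i j' := by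
  obtain ⟨h₁, h₂, hsplit⟩ := h.split (σ i)
  -- The row is the sum of `h₁ - M₁`, `h₂ - M₂` and `M₁ + M₂`, where `M₁` and `M₂` are the minima
  -- over the types. All three are nonnegative, the last because the two minima are attained at a
  -- common column. So each vanishes where the row does, and the first two are multiples `a` and `b`
  -- of the row. A nonzero multiple exhibits the row as a function of one factor; if `a = b = 0`,
  -- the row is `M₁ + M₂`, which depends on the type only.
  choose x hx hxt hxmin using exists_min_type h.left h₁
  choose y hy hyt hymin using exists_min_type h.right h₂
  set M₁ := typeFn c₁ fun o => h₁ (x o) with hM₁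
  set M₂ := typeFn c₂ fun o => h₂ (y o) with hM₂
  have n₁ : ∀ j, 0 ≤ h₁ (p (v j)) - M₁ (p (v j)) := fun j => by
    obtain ⟨o, ho⟩ := h.left.exists_type (h.mem_left j)
    rw [hM₁, typeFn_of_type ho, sub_nonneg]
    exact hxmin o _ (h.mem_left j) ho
  have n₂ : ∀ j, 0 ≤ h₂ (q (v j)) - M₂ (q (v j)) := fun j => by
    obtain ⟨o, ho⟩ := h.right.exists_type (h.mem_right j)
    rw [hM₂, typeFn_of_type ho, sub_nonneg]
    exact hymin o _ (h.mem_right j) ho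
  have n₃ : ∀ j, 0 ≤ M₁ (p (v j)) + M₂ (q (v j)) := fun j => by
    obtain ⟨o, ho⟩ := h.left.exists_type (h.mem_left j)
    rw [hM₁, hM₂, typeFn_of_type ho, typeFn_of_type (o := o) fun t => by
      rw [← h.coord_eq, ho]]
    obtain ⟨l, hl₁, hl₂⟩ := h.pair (x o) (hx o) (y o) (hy o) fun t => by rw [hxt, hyt]
    rw [← hl₁, ← hl₂, ← hsplit]
    exact hS.nonneg i l
  have hfp := facetProperty_of_facetRow hS hi
  obtain ⟨a, ha⟩ := hfp ((h₁ - M₁).comp p) fun j hj => by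
    have := hsplit j
    rw [hj] at this
    simp only [AffineMap.comp_apply, AffineMap.coe_sub, Pi.sub_apply]
    linarith [n₁ j, n₂ j, n₃ j]
  obtain ⟨b, hb⟩ := hfp ((h₂ - M₂).comp q) fun j hj => by
    have := hsplit j
    rw [hj] at this
    simp only [AffineMap.comp_apply, AffineMap.coe_sub, Pi.sub_apply]
    linarith [n₁ j, n₂ j, n₃ j]
  by_cases ha0 : a = 0
  · by_cases hb0 : b = 0
    · left
      have key : ∀ j, slack v σ i j = M₁ (p (v j)) + typeFn c₁ (fun o => h₂ (y o)) (p (v j)) := by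
        intro j
        have e1 := ha _ (vertex_mem v j)
        have e2 := hb _ (vertex_mem v j)
        simp only [AffineMap.comp_apply, AffineMap.coe_sub, Pi.sub_apply, ha0, hb0,
          zero_mul] at e1 e2
        have e3 : typeFn c₁ (fun o => h₂ (y o)) (p (v j)) = M₂ (q (v j)) :=
          typeFn_congr (h.coord_eq j)
        have e4 : slack v σ i j = h₁ (p (v j)) + h₂ (q (v j)) := hsplit j
        linarith
      intro j j' hjj
      rw [key, key, hjj]
    · right
      intro j j' hjj
      have e1 := hb _ (vertex_mem v j)
      have e2 := hb _ (vertex_mem v j')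
      simp only [AffineMap.comp_apply, hjj] at e1 e2
      exact mul_left_cancel₀ hb0 (e1.symm.trans e2)
  · left
    intro j j' hjj
    have e1 := ha _ (vertex_mem v j)
    have e2 := ha _ (vertex_mem v j')
    simp only [AffineMap.comp_apply, hjj] at e1 e2
    exact mul_left_cancel₀ ha0 (e1.symm.trans e2)

end IsGluedPresentation

/-- A slack matrix of a polytope that is affinely isomorphic to a simplicial glued product has
special rows and a separation, which is nontrivial if the product is proper. -/
theorem exists_separates {E ι κ : Type*} [NormedAddCommGroup E] [NormedSpace ℝ E]
    [Fintype ι] [Finite κ] [Nonempty κ] {v : κ → E} {σ : ι → E →ᵃ[ℝ] ℝ} (hS : IsSlackSystem v σ)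
    {r d₁ d₂ : ℕ} {c₁ : Fin r → Fin d₁} {c₂ : Fin r → Fin d₂} {P₁ : Set (Fin d₁ → ℝ)}
    {P₂ : Set (Fin d₂ → ℝ)} (h₁ : IsSimplicialFactor c₁ P₁) (h₂ : IsSimplicialFactor c₂ P₂)
    (hiso : AffinelyIsomorphic (convexHull ℝ (range v)) (gluedProduct c₁ c₂ P₁ P₂)) :
    ∃ (ρ : Fin r → ι) (X : Set ι), SpecialRows (slack v σ) ρ ∧ Separates (slack v σ) ρ X ∧
      (¬ IsSimplex r P₁ → ∃ i ∈ X, FacetRow (slack v σ) i ∧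
        ¬ TypeConst (slack v σ) ρ (slack v σ i)) ∧
      (¬ IsSimplex r P₂ → ∃ i ∉ X, FacetRow (slack v σ) i ∧
        ¬ TypeConst (slack v σ) ρ (slack v σ i)) := by
  obtain ⟨p, q, h⟩ := exists_isGluedPresentation hS h₁ h₂ hiso
  obtain ⟨ρ, hρ, hcoord⟩ := h.exists_specialRows hS
  have hsame : ∀ {j j'}, SameType (slack v σ) ρ j j' ↔
      ∀ t, p (v j) (c₁ t) = p (v j') (c₁ t) := by
    intro j j'
    refine forall_congr' fun t => ?_
    obtain ⟨a, ha, hat⟩ := hcoord t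
    rw [hat, hat]
    rcases h.coord_zero_or_one j t with e | e <;> rcases h.coord_zero_or_one j' t with e' | e' <;>
      simp [e, e', ha]
  set X : Set ι := {i | ∀ j j', p (v j) = p (v j') → slack v σ i j = slack v σ i j'} with hXdef
  have hXc : ∀ i ∉ X, FacetRow (slack v σ) i →
      ∀ j j', q (v j) = q (v j') → slack v σ i j = slack v σ i j' := fun i hi hF =>
    (h.facetRow_left_or_right hS hF).resolve_left hi
  refine ⟨ρ, X, hρ, ?_, ?_, ?_⟩
  · intro a ha hc j j' hjj
    -- Column `l` has the first component of `j'` and the second of `j`. Between `j` and `l` neither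
    -- the whole combination nor its part outside `X` changes, so the part in `X` does not change;
    -- and this part has the same value at `l` and `j'`.
    obtain ⟨l, hl₁, hl₂⟩ := h.pair _ (h.mem_left j') _ (h.mem_right j) fun t => by
      rw [← hsame.1 hjj t, h.coord_eq]
    have hlj : SameType (slack v σ) ρ l j := hsame.2 fun t => by rw [hl₁, hsame.1 hjj t]
    have e0 := hc l j hlj
    have e1 : ∑ i, X.indicator a i * slack v σ i l = ∑ i, X.indicator a i * slack v σ i j' := by
      refine Finset.sum_congr rfl fun i _ => ?_
      by_cases hi : i ∈ X
      · rw [hi l j' hl₁]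
      · simp [hi]
    have e2 : ∑ i, Xᶜ.indicator a i * slack v σ i l = ∑ i, Xᶜ.indicator a i * slack v σ i j := by
      refine Finset.sum_congr rfl fun i _ => ?_
      by_cases hi : i ∈ X
      · simp [hi]
      · by_cases hF : FacetRow (slack v σ) i
        · rw [hXc i hi hF l j hl₂]
        · simp [hi, ha i hF]
    have e3 : ∀ j, ∑ i, a i * slack v σ i j = ∑ i, X.indicator a i * slack v σ i j +
        ∑ i, Xᶜ.indicator a i * slack v σ i j := by
      intro j
      rw [← Finset.sum_add_distrib]
      refine Finset.sum_congr rfl fun i _ => ?_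
      by_cases hi : i ∈ X <;> simp [hi]
    simp only [e3] at e0
    simp only
    linarith
  · intro hns
    -- Suppose all facet rows in `X` are constant on types. Two vertices of `P₁` of the same type,
    -- paired with the same vertex of `P₂`, give columns that agree in all facet rows and hence
    -- coincide. So `P₁` has only one vertex of each type and is a simplex.
    by_contra! hcon
    refine hns (h.left.isSimplex fun x hx x' hx' hxx => ?_)
    obtain ⟨o, ho⟩ := h.left.exists_type hx
    obtain ⟨y, hy, hyt⟩ := h.right.exists_vertex o
    obtain ⟨j, hj₁, hj₂⟩ := h.pair x hx y hy fun t => by rw [ho, hyt]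
    obtain ⟨j', hj₁', hj₂'⟩ := h.pair x' hx' y hy fun t => by rw [← hxx, ho, hyt]
    have hjj : v j = v j' := by
      refine eq_of_facetRow_eq hS (vertex_mem v j) (vertex_mem v j') fun i hi => ?_
      by_cases hiX : i ∈ X
      · exact hcon i hiX hi j j' (hsame.2 fun t => by rw [hj₁, hj₁', hxx])
      · exact hXc i hiX hi j j' (hj₂.trans hj₂'.symm)
    rw [← hj₁, ← hj₁', hjj]
  · intro hns
    by_contra! hcon
    refine hns (h.right.isSimplex fun y hy y' hy' hyy => ?_)
    obtain ⟨o, ho⟩ := h.right.exists_type hy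
    obtain ⟨x, hx, hxt⟩ := h.left.exists_vertex o
    obtain ⟨j, hj₁, hj₂⟩ := h.pair x hx y hy fun t => by rw [ho, hxt]
    obtain ⟨j', hj₁', hj₂'⟩ := h.pair x hx y' hy' fun t => by rw [← hyy, ho, hxt]
    have hjj : v j = v j' := by
      refine eq_of_facetRow_eq hS (vertex_mem v j) (vertex_mem v j') fun i hi => ?_
      by_cases hiX : i ∈ X
      · exact hiX j j' (hj₁.trans hj₁'.symm)
      · exact hcon i hiX hi j j' (hsame.2 fun t => by rw [hj₁, hj₁'])
    rw [← hj₂, ← hj₂', hjj]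

end GluedProduct

/-! ### Linear relations between rows and separators -/

namespace GluedProduct

/-- `a` is a linear relation between the rows of `M`. -/
def RowRel {ι κ : Type*} [Fintype ι] (M : ι → κ → ℝ) (a : ι → ℝ) : Prop :=
  ∀ l, ∑ i, a i * M i l = 0

/-- `X` is a separator of the linear matroid of the rows of `M`. -/
def IsSeparator {ι κ : Type*} [Fintype ι] (M : ι → κ → ℝ) (X : Set ι) : Prop :=
  ∀ a, RowRel M a → RowRel M (X.indicator a)

/-- The support of each column of `M` is contained in `X` or disjoint from `X`. -/
def ColumnClosed {ι κ : Type*} (M : ι → κ → ℝ) (X : Set ι) : Prop :=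
  ∀ l i q, M i l ≠ 0 → M q l ≠ 0 → (i ∈ X ↔ q ∈ X)

/-- Row `b` is the unit vector that belongs to column `l`. -/
def IsUnitRow {ι κ : Type*} (M : ι → κ → ℝ) (b : ι) (l : κ) : Prop :=
  M b l = 1 ∧ ∀ q, q ≠ l → M b q = 0

/-- Each column is zero or contains a unit row. -/
def IsReduced {ι κ : Type*} (M : ι → κ → ℝ) : Prop :=
  ∀ l, (∀ i, M i l = 0) ∨ ∃ b, IsUnitRow M b l

/-- In each column, restriction to `X` keeps either all nonzero terms of a relation or none. -/
theorem ColumnClosed.isSeparator {ι κ : Type*} [Fintype ι] {M : ι → κ → ℝ} {X : Set ι}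
    (h : ColumnClosed M X) : IsSeparator M X := by
  intro a ha l
  by_cases hl : ∃ i ∈ X, M i l ≠ 0
  · obtain ⟨i₀, hi₀, hne⟩ := hl
    rw [← ha l]
    refine Finset.sum_congr rfl fun i _ => ?_
    by_cases hi : M i l = 0
    · simp [hi]
    · rw [indicator_of_mem ((h l i₀ i hne hi).1 hi₀)]
  · push Not at hl
    refine Finset.sum_eq_zero fun i _ => ?_
    by_cases hi : i ∈ X
    · simp [hl i hi]
    · simp [hi]

/-- Row `i` is the combination of the unit rows `β l'` with coefficients `M i l'`. In column `l`
this relation involves `i` and `b` with opposite nonzero contributions, so a separator keeps both or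
neither. -/
theorem IsSeparator.mem_iff_of_isUnitRow {ι κ : Type*} [Fintype ι] [Fintype κ] {M : ι → κ → ℝ}
    {X : Set ι} (h : IsSeparator M X) (hM : IsReduced M) {i b : ι} {l : κ} (hb : IsUnitRow M b l)
    (hi : M i l ≠ 0) : i ∈ X ↔ b ∈ X := by
  classical
  have hex : ∀ l', ∃ b', ((∀ i, M i l' = 0) ∨ IsUnitRow M b' l') ∧ (l' = l → b' = b) := by
    intro l'
    by_cases hl : l' = l
    · exact ⟨b, Or.inr (hl ▸ hb), fun _ => rfl⟩
    · rcases hM l' with h0 | ⟨b', hb'⟩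
      · exact ⟨b, Or.inl h0, fun _ => rfl⟩
      · exact ⟨b', Or.inr hb', fun h => absurd h hl⟩
  choose β hβ hβl using hex
  have hδ : ∀ l₁ l₂, M i l₁ * M (β l₁) l₂ = if l₁ = l₂ then M i l₁ else 0 := by
    intro l₁ l₂
    rcases hβ l₁ with h0 | h1
    · simp [h0 i]
    · by_cases hl : l₁ = l₂
      · rw [if_pos hl, ← hl, h1.1, mul_one]
      · rw [if_neg hl, h1.2 l₂ (Ne.symm hl), mul_zero]
  set a : ι → ℝ := fun q => (if q = i then 1 else 0) - ∑ l, if q = β l then M i l else 0 with ha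
  -- With `c = 1` this says that `a` is a relation, and with `c` the indicator of `X` it evaluates
  -- the restricted relation.
  have key : ∀ (c : ι → ℝ) (l₂ : κ), ∑ q, c q * a q * M q l₂ = M i l₂ * (c i - c (β l₂)) := by
    intro c l₂
    have e1 : ∀ q, c q * a q * M q l₂ = (if q = i then c q * M q l₂ else 0) -
        ∑ l₁, if q = β l₁ then c q * (M i l₁ * M q l₂) else 0 := by
      intro q
      rw [ha]
      simp only [mul_sub, sub_mul, Finset.mul_sum, Finset.sum_mul]
      congr 1
      · split_ifs <;> ring
      · refine Finset.sum_congr rfl fun l₁ _ => ?_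
        split_ifs <;> ring
    simp only [e1, Finset.sum_sub_distrib]
    rw [Finset.sum_comm]
    simp only [Finset.sum_ite_eq', Finset.mem_univ, if_true, hδ, mul_ite, mul_zero]
    ring
  have h1 : RowRel M a := fun l₂ => by
    have := key 1 l₂
    simpa using this
  have h2 := h a h1 l
  have e : ∀ q, X.indicator a q = X.indicator 1 q * a q := fun q => by
    by_cases hq : q ∈ X <;> simp [hq]
  simp only [e] at h2
  rw [key, hβl l rfl] at h2
  have h3 := (mul_eq_zero.1 h2).resolve_left hi
  by_cases hiX : i ∈ X <;> by_cases hbX : b ∈ X <;> simp [hiX, hbX] at h3 ⊢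

theorem IsSeparator.columnClosed {ι κ : Type*} [Fintype ι] [Fintype κ] {M : ι → κ → ℝ}
    {X : Set ι} (h : IsSeparator M X) (hM : IsReduced M) : ColumnClosed M X := by
  intro l i i' hi hi'
  rcases hM l with h0 | ⟨b, hb⟩
  · exact absurd (h0 i) hi
  · rw [h.mem_iff_of_isUnitRow hM hb hi, h.mem_iff_of_isUnitRow hM hb hi']

theorem rowRel_single {ι κ : Type*} [Fintype ι] [DecidableEq ι] (M : ι → κ → ℝ) (i : ι) :
    RowRel M (Pi.single i 1) ↔ ∀ l, M i l = 0 := by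
  simp [RowRel, Pi.single_apply]

/-! ### Elimination -/

/-- `M` has the same row relations as `M₀`, and each column of `M` vanishes on the rows before `i`
or contains a unit row before row `i`. -/
structure Eliminated {m n : ℕ} (M₀ M : Fin m → Fin n → ℝ) (i : ℕ) : Prop where
  rowRel_iff : ∀ a, RowRel M a ↔ RowRel M₀ a
  reduced : ∀ l, (∀ q : Fin m, (q : ℕ) < i → M q l = 0) ∨
    ∃ b : Fin m, (b : ℕ) < i ∧ IsUnitRow M b l

/-- Column `p` can serve to eliminate row `i`. -/
def IsPivot {m n : ℕ} (M : Fin m → Fin n → ℝ) (i : Fin m) (p : Fin n) : Prop :=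
  M i p ≠ 0 ∧ ∀ q < i, M q p = 0

theorem eliminated_zero {m n : ℕ} (M : Fin m → Fin n → ℝ) : Eliminated M M 0 :=
  ⟨fun _ => Iff.rfl, fun _ => Or.inl fun _ h => absurd h (Nat.not_lt_zero _)⟩

theorem Eliminated.isReduced {m n : ℕ} {M₀ M : Fin m → Fin n → ℝ} (h : Eliminated M₀ M m) :
    IsReduced M := fun l =>
  (h.reduced l).imp (fun h q => h q q.2) fun ⟨b, _, hb⟩ => ⟨b, hb⟩

/-- A column that vanishes before row `i` also vanishes in row `i`, or it would be a pivot. -/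
theorem Eliminated.succ_of_not_isPivot {m n : ℕ} {M₀ M : Fin m → Fin n → ℝ} {i : Fin m}
    (h : Eliminated M₀ M i) (hp : ∀ p, ¬ IsPivot M i p) : Eliminated M₀ M (i + 1) := by
  refine ⟨h.rowRel_iff, fun l => ?_⟩
  rcases h.reduced l with h0 | ⟨b, hbi, hb⟩
  · refine Or.inl fun q hq => ?_
    rcases Nat.lt_succ_iff_lt_or_eq.1 hq with hq | hq
    · exact h0 q hq
    · obtain rfl : q = i := Fin.ext hq
      by_contra hne
      exact hp l ⟨hne, fun q' hq' => h0 q' hq'⟩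
  · exact Or.inr ⟨b, by omega, hb⟩

/-- These are invertible column operations, so they preserve the row relations. They turn row `i`
into the unit row of column `p`. The rows before `i` vanish in column `p` and stay unchanged, so
earlier unit rows survive. -/
theorem Eliminated.succ_of_isPivot {m n : ℕ} {M₀ M M' : Fin m → Fin n → ℝ} {i : Fin m}
    (h : Eliminated M₀ M i) {p : Fin n} (hp : IsPivot M i p)
    (hM' : ∀ q l, M' q l = if l = p then M q p / M i p else M q l - M i l * (M q p / M i p)) :
    Eliminated M₀ M' (i + 1) := by
  have hip := hp.1
  have hzero : ∀ q < i, ∀ l, M' q l = M q l := by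
    intro q hq l
    rw [hM']
    split_ifs with hl
    · rw [hl, hp.2 q hq, zero_div]
    · rw [hp.2 q hq]; ring
  have hi : ∀ l, l ≠ p → M' i l = 0 := by
    intro l hl
    rw [hM', if_neg hl, div_self hip]; ring
  refine ⟨fun a => ?_, fun l => ?_⟩
  · rw [← h.rowRel_iff]
    have e1 : ∑ q, a q * M' q p = (∑ q, a q * M q p) / M i p := by
      rw [Finset.sum_div]
      refine Finset.sum_congr rfl fun q _ => ?_
      rw [hM', if_pos rfl, mul_div_assoc]
    have e2 : ∀ l, l ≠ p → ∑ q, a q * M' q l =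
        ∑ q, a q * M q l - M i l * ((∑ q, a q * M q p) / M i p) := by
      intro l hl
      rw [Finset.sum_div, Finset.mul_sum, ← Finset.sum_sub_distrib]
      refine Finset.sum_congr rfl fun q _ => ?_
      rw [hM', if_neg hl]; ring
    constructor
    · intro ha
      have hp0 : ∑ q, a q * M q p = 0 := by
        have := ha p
        rw [e1, div_eq_zero_iff] at this
        exact this.resolve_right hip
      intro l
      by_cases hl : l = p
      · rw [hl, hp0]
      · have := ha l
        rwa [e2 l hl, hp0, zero_div, mul_zero, sub_zero] at this
    · intro ha l
      by_cases hl : l = p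
      · rw [hl, e1, ha p, zero_div]
      · rw [e2 l hl, ha l, ha p]; simp
  · by_cases hl : l = p
    · subst hl
      exact Or.inr ⟨i, by omega, by rw [hM', if_pos rfl, div_self hip], hi⟩
    · rcases h.reduced l with h0 | ⟨b, hbi, hb⟩
      · refine Or.inl fun q hq => ?_
        rcases Nat.lt_succ_iff_lt_or_eq.1 hq with hq | hq
        · rw [hzero q hq, h0 q hq]
        · obtain rfl : q = i := Fin.ext hq
          exact hi l hl
      · refine Or.inr ⟨b, by omega, ?_, fun l' hl' => ?_⟩
        · rw [hzero b hbi, hb.1]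
        · rw [hzero b hbi, hb.2 l' hl']

/-! ### Connected components -/

/-- `R` is the finest equivalence relation that identifies rows with a common nonzero entry in one
of the columns before column `j`. -/
structure Connected {m n : ℕ} (M : Fin m → Fin n → ℝ) (R : Fin m → Fin m → Prop) (j : ℕ) :
    Prop where
  refl : ∀ i, R i i
  symm : ∀ i i', R i i' → R i' i
  trans : ∀ i i' i'', R i i' → R i' i'' → R i i''
  column : ∀ l : Fin n, (l : ℕ) < j → ∀ i i', M i l ≠ 0 → M i' l ≠ 0 → R i i'
  finest : ∀ Z : Set (Fin m), ColumnClosed M Z → ∀ i i', R i i' → (i ∈ Z ↔ i' ∈ Z)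

theorem connected_zero {m n : ℕ} (M : Fin m → Fin n → ℝ) {R : Fin m → Fin m → Prop}
    (hR : ∀ i i', R i i' ↔ i = i') : Connected M R 0 := by
  refine ⟨fun i => (hR i i).2 rfl, fun i i' h => ?_, fun i i' i'' h h' => ?_, fun l h => ?_,
    fun Z _ i i' h => ?_⟩
  · rw [hR] at h ⊢; exact h.symm
  · rw [hR] at h h' ⊢; exact h.trans h'
  · exact absurd h (Nat.not_lt_zero _)
  · rw [hR] at h; rw [h]

/-- Column `j` merges the classes that meet its support into one class. -/
theorem Connected.succ {m n : ℕ} {M : Fin m → Fin n → ℝ} {R R' : Fin m → Fin m → Prop} {j : Fin n}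
    (h : Connected M R j) (hR' : ∀ i i', R' i i' ↔
      R i i' ∨ (∃ q, M q j ≠ 0 ∧ R q i) ∧ ∃ q, M q j ≠ 0 ∧ R q i') :
    Connected M R' (j + 1) := by
  refine ⟨fun i => (hR' i i).2 (Or.inl (h.refl i)), fun i i' hi => ?_, fun i i' i'' hi hi' => ?_,
    fun l hl i i' hi hi' => ?_, fun Z hZ i i' hi => ?_⟩
  · rw [hR'] at hi ⊢
    exact hi.imp (h.symm i i') And.symm
  · rw [hR'] at hi hi' ⊢
    rcases hi with hi | ⟨hi₁, q₁, hq₁, hi₂⟩ <;> rcases hi' with hi' | ⟨⟨q₂, hq₂, hi'₁⟩, hi'₂⟩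
    · exact Or.inl (h.trans _ _ _ hi hi')
    · exact Or.inr ⟨⟨q₂, hq₂, h.trans _ _ _ hi'₁ (h.symm _ _ hi)⟩, hi'₂⟩
    · exact Or.inr ⟨hi₁, q₁, hq₁, h.trans _ _ _ hi₂ hi'⟩
    · exact Or.inr ⟨hi₁, hi'₂⟩
  · rw [hR']
    rcases Nat.lt_succ_iff_lt_or_eq.1 hl with hl | hl
    · exact Or.inl (h.column l hl i i' hi hi')
    · obtain rfl : l = j := Fin.ext hl
      exact Or.inr ⟨⟨i, hi, h.refl i⟩, i', hi', h.refl i'⟩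
  · rw [hR'] at hi
    rcases hi with hi | ⟨⟨q₁, hq₁, hi₁⟩, q₂, hq₂, hi₂⟩
    · exact h.finest Z hZ i i' hi
    · rw [← h.finest Z hZ _ _ hi₁, ← h.finest Z hZ _ _ hi₂, hZ j q₁ q₂ hq₁ hq₂]

theorem Connected.columnClosed {m n : ℕ} {M : Fin m → Fin n → ℝ} {R : Fin m → Fin m → Prop}
    (h : Connected M R n) (i₀ : Fin m) : ColumnClosed M {i | R i₀ i} := by
  intro l i i' hi hi'
  have hR := h.column l l.2 i i' hi hi'
  exact ⟨fun h₀ => h.trans _ _ _ h₀ hR, fun h₀ => h.trans _ _ _ h₀ (h.symm _ _ hR)⟩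

/-! ### Separations of slack matrices -/

open Classical in
/-- The facet rows modulo the functions that are constant on types; `ref j` is a column of the type
of `j`. -/
noncomputable def reducedMatrix {ι κ : Type*} (S : ι → κ → ℝ) (ref : κ → κ) : ι → κ → ℝ :=
  fun i j => if FacetRow S i then S i j - S i (ref j) else 0

/-- `ref` picks one column of each type. -/
structure IsTypeRep {ι κ : Type*} (S : ι → κ → ℝ) {r : ℕ} (ρ : Fin r → ι) (ref : κ → κ) :
    Prop where
  sameType : ∀ j, SameType S ρ j (ref j)
  eq_of_sameType : ∀ j j', SameType S ρ j j' → ref j = ref j'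

theorem IsTypeRep.typeConst_iff {ι κ : Type*} {S : ι → κ → ℝ} {r : ℕ} {ρ : Fin r → ι}
    {ref : κ → κ} (h : IsTypeRep S ρ ref) (g : κ → ℝ) :
    TypeConst S ρ g ↔ ∀ j, g j - g (ref j) = 0 := by
  constructor
  · intro hg j
    rw [hg j (ref j) (h.sameType j), sub_self]
  · intro hg j j' hjj
    have e1 := hg j
    have e2 := hg j'
    rw [h.eq_of_sameType j j' hjj] at e1
    linarith

/-- Subtracting the reference column of its type from each column turns constancy on types into
vanishing. -/
theorem IsTypeRep.rowRel_iff {ι κ : Type*} [Fintype ι] {S : ι → κ → ℝ} {r : ℕ} {ρ : Fin r → ι}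
    {ref : κ → κ} (h : IsTypeRep S ρ ref) (a : ι → ℝ) :
    RowRel (reducedMatrix S ref) a ↔
      TypeConst S ρ (fun j => ∑ i, {i | FacetRow S i}.indicator a i * S i j) := by
  rw [h.typeConst_iff]
  refine forall_congr' fun j => ?_
  rw [← Finset.sum_sub_distrib]
  refine Eq.congr (Finset.sum_congr rfl fun i _ => ?_) rfl
  by_cases hi : FacetRow S i
  · simp [reducedMatrix, hi, mul_sub]
  · simp [reducedMatrix, hi]

theorem IsTypeRep.separates_iff {ι κ : Type*} [Fintype ι] {S : ι → κ → ℝ} {r : ℕ} {ρ : Fin r → ι}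
    {ref : κ → κ} (h : IsTypeRep S ρ ref) (X : Set ι) :
    Separates S ρ X ↔ IsSeparator (reducedMatrix S ref) X := by
  constructor
  · intro hX a ha
    rw [h.rowRel_iff] at ha ⊢
    have := hX _ (fun i hi => by simp [hi]) ha
    rwa [indicator_indicator, inter_comm, ← indicator_indicator] at this
  · intro hX a ha hc
    have e : ∀ b : ι → ℝ, (∀ i, ¬ FacetRow S i → b i = 0) →
        {i | FacetRow S i}.indicator b = b := fun b hb => by
      funext i
      by_cases hi : FacetRow S i
      · simp [hi]
      · simp [hi, hb i hi]
    have := hX a (by rwa [h.rowRel_iff, e a ha])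
    rwa [h.rowRel_iff, e _ fun i hi => ?_] at this
    by_cases hiX : i ∈ X
    · simp [hiX, ha i hi]
    · simp [hiX]

theorem IsTypeRep.reducedMatrix_eq_zero_iff {ι κ : Type*} {S : ι → κ → ℝ} {r : ℕ} {ρ : Fin r → ι}
    {ref : κ → κ} (h : IsTypeRep S ρ ref) (i : ι) :
    (∃ j, reducedMatrix S ref i j ≠ 0) ↔ FacetRow S i ∧ ¬ TypeConst S ρ (S i) := by
  rw [h.typeConst_iff]
  by_cases hi : FacetRow S i <;> simp [reducedMatrix, hi]

/-- Separators depend only on the row relations, which elimination preserves; for a reduced matrix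
they can be read off the supports of the columns. -/
theorem Eliminated.separates_iff {m n : ℕ} {S M : Fin m → Fin n → ℝ} {r : ℕ} {ρ : Fin r → Fin m}
    {ref : Fin n → Fin n} (href : IsTypeRep S ρ ref)
    (hM : Eliminated (reducedMatrix S ref) M m) (X : Set (Fin m)) :
    Separates S ρ X ↔ ColumnClosed M X := by
  rw [href.separates_iff]
  constructor
  · intro h
    refine IsSeparator.columnClosed (fun a ha => ?_) hM.isReduced
    rw [hM.rowRel_iff] at ha ⊢
    exact h a ha
  · intro h a ha
    rw [← hM.rowRel_iff] at ha ⊢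
    exact h.isSeparator a ha

/-- Whether row `i` is zero is also a matter of row relations, namely whether the unit vector of `i`
is one. -/
theorem Eliminated.exists_ne_zero_iff {m n : ℕ} {S M : Fin m → Fin n → ℝ} {r : ℕ}
    {ρ : Fin r → Fin m} {ref : Fin n → Fin n} (href : IsTypeRep S ρ ref)
    (hM : Eliminated (reducedMatrix S ref) M m) (i : Fin m) :
    (∃ j, M i j ≠ 0) ↔ FacetRow S i ∧ ¬ TypeConst S ρ (S i) := by
  rw [← href.reducedMatrix_eq_zero_iff, ← not_iff_not]
  push Not
  rw [← rowRel_single, ← rowRel_single, hM.rowRel_iff]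

/-! ### Distinct columns -/

/-- Column `j` differs from the columns before it. -/
def IsNewColumn {m n : ℕ} (F : Fin m → Fin n → ℝ) (j : Fin n) : Prop :=
  ∀ j' < j, ∃ i, F i j ≠ F i j'

theorem exists_isNewColumn {m n : ℕ} (F : Fin m → Fin n → ℝ) (j : Fin n) :
    ∃ j', IsNewColumn F j' ∧ ∀ i, F i j = F i j' := by
  induction j using WellFoundedLT.induction with
  | ind j ih =>
    by_cases h : IsNewColumn F j
    · exact ⟨j, h, fun _ => rfl⟩
    · simp only [IsNewColumn, not_forall, not_exists, not_not] at h
      obtain ⟨j', hj, he⟩ := h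
      obtain ⟨j'', h1, h2⟩ := ih j' hj
      exact ⟨j'', h1, fun i => (he i).trans (h2 i)⟩

theorem IsNewColumn.eq {m n : ℕ} {F : Fin m → Fin n → ℝ} {j j' : Fin n} (h : IsNewColumn F j)
    (h' : IsNewColumn F j') (he : ∀ i, F i j = F i j') : j = j' := by
  rcases lt_trichotomy j j' with hlt | rfl | hlt
  · obtain ⟨i, hi⟩ := h' j hlt
    exact absurd (he i).symm hi
  · rfl
  · obtain ⟨i, hi⟩ := h j' hlt
    exact absurd (he i) hi

open Classical in
/-- The number of elements of `K` below `j` and `n`. -/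
noncomputable def rank (n : ℕ) (K : ℕ → Prop) (j : ℕ) : ℕ :=
  ((Finset.range n).filter fun j' => j' < j ∧ K j').card

open Classical in
theorem rank_eq_count {n : ℕ} (K : ℕ → Prop) {j : ℕ} (hj : j ≤ n) : rank n K j = Nat.count K j := by
  rw [Nat.count_eq_card_filter_range, rank]
  congr 1
  ext x
  simp only [Finset.mem_filter, Finset.mem_range]
  constructor
  · rintro ⟨_, h⟩; exact h
  · rintro h; exact ⟨by omega, h⟩

theorem rank_lt_rank {n : ℕ} {K : ℕ → Prop} {j : ℕ} (hj : j < n) (hK : K j) :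
    rank n K j < rank n K n := by
  classical
  rw [rank_eq_count K hj.le, rank_eq_count K le_rfl]
  exact Nat.count_strict_mono hK hj

theorem rank_injective {n : ℕ} {K : ℕ → Prop} {j j' : ℕ} (hj : j < n) (hj' : j' < n) (hK : K j)
    (hK' : K j') (h : rank n K j = rank n K j') : j = j' := by
  classical
  rw [rank_eq_count K hj.le, rank_eq_count K hj'.le] at h
  exact Nat.count_injective hK hK' h

theorem exists_rank_eq {n : ℕ} {K : ℕ → Prop} {c : ℕ} (hc : c < rank n K n) :
    ∃ j < n, K j ∧ rank n K j = c := by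
  classical
  rw [rank_eq_count K le_rfl] at hc
  have key : ∀ N, c < Nat.count K N → ∃ j < N, K j ∧ Nat.count K j = c := by
    intro N
    induction N with
    | zero => simp
    | succ N ih =>
      intro h
      by_cases hN : c < Nat.count K N
      · obtain ⟨j, hj, h'⟩ := ih hN
        exact ⟨j, by omega, h'⟩
      · rw [Nat.count_succ] at h
        split_ifs at h with hK
        · exact ⟨N, by omega, hK, by omega⟩
        · omega
  obtain ⟨j, hj, hK, h⟩ := key n hc
  exact ⟨j, hj, hK, by rw [rank_eq_count K hj.le, h]⟩

end GluedProduct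

/-! ### Derived constructions of the language -/

namespace RealRAM

namespace Cmd

/-- The command does not write to the array `name` of natural numbers. -/
def NatFree (name : ℕ) : Cmd → Prop
  | natSet name' _ _ _ => name ≠ name'
  | realMap _ _ _ _ _ _ => True
  | seq p q => p.NatFree name ∧ q.NatFree name
  | ite _ p => p.NatFree name
  | loop x _ p => name ≠ x ∧ p.NatFree name

/-- The command does not write to the array `name` of reals. -/
def RealFree (name : ℕ) : Cmd → Prop
  | natSet _ _ _ _ => True
  | realMap name' _ _ _ _ _ => name ≠ name'
  | seq p q => p.RealFree name ∧ q.RealFree name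
  | ite _ p => p.RealFree name
  | loop _ _ p => p.RealFree name

theorem sem_nat {c : Cmd} {name : ℕ} (hc : c.NatFree name) (s : Store) :
    (c.sem s).nat name = s.nat name := by
  induction c generalizing s with
  | natSet name' i j e => exact Store.setNat_nat_of_ne _ hc _ _ _
  | realMap name' x y B B' e => rfl
  | seq p q ihp ihq => rw [sem, ihq hc.2, ihp hc.1]
  | ite b p ih =>
    rw [sem]
    split_ifs
    · exact ih hc s
    · rfl
  | loop x B p ih =>
    rw [sem]
    induction B.eval s with
    | zero => rfl
    | succ v ihv =>
      change (p.sem _).nat name = _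
      rw [ih hc.2, Store.setNat_nat_of_ne _ hc.1, ihv]

theorem sem_real {c : Cmd} {name : ℕ} (hc : c.RealFree name) (s : Store) :
    (c.sem s).real name = s.real name := by
  induction c generalizing s with
  | natSet name' i j e => rfl
  | realMap name' x y B B' e => simp only [sem, Store.setArray, if_neg hc]
  | seq p q ihp ihq => rw [sem, ihq hc.2, ihp hc.1]
  | ite b p ih =>
    rw [sem]
    split_ifs
    · exact ih hc s
    · rfl
  | loop x B p ih =>
    rw [sem]
    induction B.eval s with
    | zero => rfl
    | succ v ihv =>
      change (p.sem _).real name = _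
      rw [ih hc, Store.setNat_real, ihv]

/-- The rule for loops with an invariant. -/
theorem sem_loop {x : ℕ} {B : Bound} {p : Cmd} {s : Store} (Inv : ℕ → Store → Prop)
    (h0 : Inv 0 s) (hstep : ∀ v < B.eval s, ∀ s', Inv v s' → Inv (v + 1) (p.sem (s'.setNat x 0 0 v))) :
    Inv (B.eval s) ((loop x B p).sem s) := by
  rw [sem]
  have key : ∀ N ≤ B.eval s,
      Inv N (Nat.rec s (fun v s' => p.sem (s'.setNat x 0 0 v)) N : Store) := by
    intro N
    induction N with
    | zero => exact fun _ => h0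
    | succ v ih => exact fun h => hstep v (by omega) _ (ih (by omega))
  exact key _ le_rfl

end Cmd

namespace Tm

/-- The register `x`. -/
def var (x : ℕ) : Tm .nat := natLoad x (const 0) (const 0)

def ne0 (a : Tm .real) : Tm .bool := not (realEq a zero)

def or (a b : Tm .bool) : Tm .bool := not (and (not a) (not b))

def imp (a b : Tm .bool) : Tm .bool := not (and a (not b))

/-- Some value of the register `x` below `B` satisfies `b`. -/
def ex (x : ℕ) (B : Bound) (b : Tm .bool) : Tm .bool := natLt (const 0) (count x B b)

/-- All values of the register `x` below `B` satisfy `b`. -/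
def all (x : ℕ) (B : Bound) (b : Tm .bool) : Tm .bool := not (ex x B (not b))

/-- The least value of the register `x` below `B` that satisfies `b`, or `B` if there is none; the
register `y` serves as scratch space. -/
def find (x y : ℕ) (B : Bound) (b : Tm .bool) : Tm .nat :=
  -- The least solution equals the number of values below all solutions.
  count y B (all x B (imp b (natLt (var y) (var x))))

@[simp] theorem eval_var (x : ℕ) (s : Store) : (var x).eval s = s.nat x 0 0 := rfl

@[simp] theorem eval_const (c : ℕ) (s : Store) : (const c).eval s = c := rfl

@[simp] theorem eval_natLoad (name : ℕ) (i j : Tm .nat) (s : Store) :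
    (natLoad name i j).eval s = s.nat name (i.eval s) (j.eval s) := rfl

@[simp] theorem eval_realLoad (name : ℕ) (i j : Tm .nat) (s : Store) :
    (realLoad name i j).eval s = s.real name (i.eval s) (j.eval s) := rfl

@[simp] theorem eval_zero (s : Store) : zero.eval s = (0 : ℝ) := rfl

@[simp] theorem eval_one (s : Store) : one.eval s = (1 : ℝ) := rfl

@[simp] theorem eval_sub (a b : Tm .real) (s : Store) :
    (sub a b).eval s = (a.eval s - b.eval s : ℝ) := rfl

@[simp] theorem eval_mul (a b : Tm .real) (s : Store) :
    (mul a b).eval s = (a.eval s * b.eval s : ℝ) := rfl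

@[simp] theorem eval_div (a b : Tm .real) (s : Store) :
    (div a b).eval s = (a.eval s / b.eval s : ℝ) := rfl

open Classical in
@[simp] theorem eval_realIte (b : Tm .bool) (x y : Tm .real) (s : Store) :
    (realIte b x y).eval s = (if b.eval s then x.eval s else y.eval s : ℝ) := rfl

@[simp] theorem eval_natLt (a b : Tm .nat) (s : Store) :
    (natLt a b).eval s ↔ (a.eval s : ℕ) < b.eval s := Iff.rfl

@[simp] theorem eval_natEq (a b : Tm .nat) (s : Store) :
    (natEq a b).eval s ↔ (a.eval s : ℕ) = b.eval s := Iff.rfl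

@[simp] theorem eval_realEq (a b : Tm .real) (s : Store) :
    (realEq a b).eval s ↔ (a.eval s : ℝ) = b.eval s := Iff.rfl

@[simp] theorem eval_not (a : Tm .bool) (s : Store) : (not a).eval s ↔ ¬ a.eval s := Iff.rfl

@[simp] theorem eval_and (a b : Tm .bool) (s : Store) :
    (and a b).eval s ↔ a.eval s ∧ b.eval s := Iff.rfl

@[simp] theorem eval_or (a b : Tm .bool) (s : Store) :
    (or a b).eval s ↔ a.eval s ∨ b.eval s := by
  simp only [or, eval_not, eval_and]; tauto

@[simp] theorem eval_imp (a b : Tm .bool) (s : Store) :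
    (imp a b).eval s ↔ (a.eval s → b.eval s) := by
  simp only [imp, eval_not, eval_and]; tauto

@[simp] theorem eval_ne0 (a : Tm .real) (s : Store) :
    (ne0 a).eval s ↔ (a.eval s : ℝ) ≠ 0 := Iff.rfl

open Classical in
theorem eval_count (x : ℕ) (B : Bound) (b : Tm .bool) (s : Store) :
    (count x B b).eval s =
      ((Finset.range (B.eval s)).filter fun v => b.eval (s.setNat x 0 0 v)).card := rfl

@[simp] theorem eval_ex (x : ℕ) (B : Bound) (b : Tm .bool) (s : Store) :
    (ex x B b).eval s ↔ ∃ v < B.eval s, b.eval (s.setNat x 0 0 v) := by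
  simp [ex, eval_count, Finset.card_pos, Finset.filter_nonempty_iff]

@[simp] theorem eval_all (x : ℕ) (B : Bound) (b : Tm .bool) (s : Store) :
    (all x B b).eval s ↔ ∀ v < B.eval s, b.eval (s.setNat x 0 0 v) := by
  simp [all]

theorem _root_.RealRAM.Bound.eval_setNat (B : Bound) (s : Store) {x : ℕ} (hx : x ≠ 0) (i j v : ℕ) :
    B.eval (s.setNat x i j v) = B.eval s :=
  B.eval_eq_of_nat_zero (Store.setNat_nat_of_ne _ (Ne.symm hx) _ _ _)

/-- The least number below `N` that satisfies `p`, or `N` if there is none. -/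
noncomputable def _root_.RealRAM.findBelow (N : ℕ) (p : ℕ → Prop) : ℕ := by
  classical
  exact ((Finset.range N).filter fun u => ∀ v < N, p v → u < v).card

theorem _root_.RealRAM.findBelow_spec {N : ℕ} {p : ℕ → Prop} (h : ∃ v < N, p v) :
    findBelow N p < N ∧ p (findBelow N p) := by
  classical
  have h' : ∃ v, v < N ∧ p v := h
  have e : findBelow N p = Nat.find h' := by
    rw [findBelow]
    have : ((Finset.range N).filter fun u => ∀ v < N, p v → u < v) =
        Finset.range (Nat.find h') := by
      ext u
      simp only [Finset.mem_filter, Finset.mem_range]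
      constructor
      · rintro ⟨_, hu⟩
        exact hu _ (Nat.find_spec h').1 (Nat.find_spec h').2
      · intro hu
        refine ⟨hu.trans (Nat.find_spec h').1, fun v hv hpv => hu.trans_le ?_⟩
        exact Nat.find_min' h' ⟨hv, hpv⟩
    convert congrArg Finset.card this
    simp
  rw [e]
  exact Nat.find_spec h'

theorem _root_.RealRAM.findBelow_of_not {N : ℕ} {p : ℕ → Prop} (h : ¬ ∃ v < N, p v) :
    findBelow N p = N := by
  classical
  rw [findBelow, Finset.filter_true_of_mem, Finset.card_range]
  exact fun u _ v hv hpv => absurd ⟨v, hv, hpv⟩ h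

theorem eval_find {x y : ℕ} (hxy : x ≠ y) (hy : y ≠ 0) (B : Bound) (b : Tm .bool) (s : Store)
    {p : ℕ → Prop} (hp : ∀ u, ∀ v < B.eval s, b.eval ((s.setNat y 0 0 u).setNat x 0 0 v) ↔ p v) :
    (find x y B b).eval s = findBelow (B.eval s) p := by
  classical
  rw [find, eval_count, findBelow]
  congr 1
  refine Finset.filter_congr fun u _ => ?_
  simp only [eval_all, eval_imp, eval_natLt, eval_var, Bound.eval_setNat B s hy]
  refine forall₂_congr fun v hv => ?_
  rw [hp u v hv]
  simp [Store.setNat, hxy.symm]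

end Tm

end RealRAM

/-! ### The algorithm -/

namespace RealRAM

/-- The initial part of the real array `name`. -/
def Store.view (s : Store) (name m n : ℕ) : Fin m → Fin n → ℝ := fun i j => s.real name i j

@[simp] theorem Store.view_setNat (s : Store) (name m n name' i j v : ℕ) :
    (s.setNat name' i j v).view name m n = s.view name m n := rfl

/-- The format of the input matrix is `m × n`, and the array `6` holds the tuple `ρ` of rows. -/
structure Store.Holds (s : Store) {m : ℕ} (n : ℕ) {r : ℕ} (ρ : Fin r → Fin m) : Prop where
  rows : s.nat 0 0 0 = m
  cols : s.nat 0 0 1 = n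
  tuple : ∀ t : Fin r, s.nat 6 t 0 = ρ t

theorem Store.setNat_nat (s : Store) (name i j x name' i' j' : ℕ) :
    (s.setNat name i j x).nat name' i' j' =
      if name' = name ∧ i' = i ∧ j' = j then x else s.nat name' i' j' := rfl

theorem Store.Holds.setNat {s : Store} {m n r : ℕ} {ρ : Fin r → Fin m} (h : s.Holds n ρ)
    {name : ℕ} (h0 : name ≠ 0) (h6 : name ≠ 6) (i j v : ℕ) : (s.setNat name i j v).Holds n ρ := by
  refine ⟨?_, ?_, fun t => ?_⟩
  · rw [Store.setNat_nat_of_ne _ h0.symm, h.rows]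
  · rw [Store.setNat_nat_of_ne _ h0.symm, h.cols]
  · rw [Store.setNat_nat_of_ne _ h6.symm, h.tuple]

theorem Store.Holds.congr {s s' : Store} {m n r : ℕ} {ρ : Fin r → Fin m} (h : s.Holds n ρ)
    (h0 : s'.nat 0 = s.nat 0) (h6 : s'.nat 6 = s.nat 6) : s'.Holds n ρ :=
  ⟨by rw [h0, h.rows], by rw [h0, h.cols], fun t => by rw [h6, h.tuple]⟩

namespace Recognition

open Tm GluedProduct

/-- The entry of the array `name` whose position is held by the registers `x` and `y`. -/
def entry (name x y : ℕ) : Tm .real := realLoad name (var x) (var y)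

/-- The index of the special row whose number is held by the register `t`. -/
def specialRow (t : ℕ) : Tm .nat := natLoad 6 (var t) (const 0)

/-- The entry of a special row. -/
def specialEntry (t y : ℕ) : Tm .real := realLoad 0 (specialRow t) (var y)

def eq0 (a : Tm .real) : Tm .bool := realEq a zero

/-- The term `a` is evaluated within the scope of the bound variables 20 and 21 and must not depend
on them. Conventions for the whole algorithm: the arrays 0 to 3 hold the input, the two outputs and
the verdict; 4 the reduced matrix, 5 the connectivity relation, 6 the tuple of special rows; 8 the
pivot column, 9 the picked row; the real arrays 16 and 17 the factor matrices. -/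
def isFacetRow (a : Tm .nat) : Tm .bool :=
  and (ex 20 .cols (ne0 (realLoad 0 a (var 20)))) (all 21 .rows
    (imp (ex 20 .cols (ne0 (entry 0 21 20)))
      (imp (all 20 .cols (imp (ne0 (entry 0 21 20)) (ne0 (realLoad 0 a (var 20)))))
        (all 20 .cols (imp (ne0 (realLoad 0 a (var 20))) (ne0 (entry 0 21 20)))))))

def isSameType (r x y : ℕ) : Tm .bool :=
  all 23 (.const r) (and (imp (eq0 (specialEntry 23 x)) (eq0 (specialEntry 23 y)))
    (imp (eq0 (specialEntry 23 y)) (eq0 (specialEntry 23 x))))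

/-- The tuple consists of row indices. -/
def inRange (r : ℕ) : Tm .bool :=
  all 24 (.const r) (natLt (specialRow 24) (natLoad 0 (const 0) (const 0)))

/-- The tuple satisfies `SpecialRows`. -/
def isSpecial (r : ℕ) : Tm .bool :=
  and (all 24 (.const r) (isFacetRow (specialRow 24)))
    (and (all 24 (.const r) (all 25 .cols (all 26 .cols (imp (ne0 (specialEntry 24 25))
        (imp (ne0 (specialEntry 24 26)) (realEq (specialEntry 24 25) (specialEntry 24 26)))))))
      (and (all 24 (.const r) (all 25 (.const r) (imp (not (natEq (var 24) (var 25)))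
          (all 26 .cols (or (eq0 (specialEntry 24 26)) (eq0 (specialEntry 25 26)))))))
        (ex 26 .cols (all 24 (.const r) (eq0 (specialEntry 24 26))))))

variable {s : Store} {m n r : ℕ} {ρ : Fin r → Fin m}

theorem eval_isFacetRow (hm : s.nat 0 0 0 = m) (hn : s.nat 0 0 1 = n) {a : Tm .nat} {i : Fin m}
    (ha : ∀ u v, a.eval ((s.setNat 21 0 0 u).setNat 20 0 0 v) = (i : ℕ)) :
    (isFacetRow a).eval s ↔ FacetRow (s.view 0 m n) i := by
  have ha' : ∀ v, a.eval (s.setNat 20 0 0 v) = (i : ℕ) := fun v => by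
    have := ha (s.nat 21 0 0) v
    rwa [Store.setNat_self] at this
  simp [isFacetRow, FacetRow, entry, Bound.eval, Fin.exists_iff, Fin.forall_iff, ha, ha',
    Store.setNat_nat, hm, hn, Store.view]

theorem eval_isSameType (h : s.Holds n ρ) {x y : ℕ} {j j' : Fin n} (hx : x ≠ 23) (hy : y ≠ 23)
    (hj : s.nat x 0 0 = j) (hj' : s.nat y 0 0 = j') :
    (isSameType r x y).eval s ↔ SameType (s.view 0 m n) ρ j j' := by
  have ht : ∀ t (ht : t < r), s.nat 6 t 0 = ρ ⟨t, ht⟩ := fun t ht => h.tuple ⟨t, ht⟩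
  simp only [isSameType, SameType, specialEntry, specialRow, eq0, eval_all, eval_and, eval_imp,
    eval_realEq, eval_realLoad, eval_zero, eval_natLoad, eval_var, eval_const, Store.setNat_nat,
    Store.setNat_real, Fin.forall_iff, Bound.eval, hx, hy, Store.view]
  refine forall₂_congr fun t htr => ?_
  simp [hj, hj', ht t htr]
  tauto

theorem eval_inRange (hm : s.nat 0 0 0 = m) :
    (inRange r).eval s ↔ ∀ t < r, s.nat 6 t 0 < m := by
  simp [inRange, specialRow, Bound.eval, Store.setNat_nat, hm]

theorem eval_isSpecial (h : s.Holds n ρ) :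
    (isSpecial r).eval s ↔ SpecialRows (s.view 0 m n) ρ := by
  have ht : ∀ t (ht : t < r), s.nat 6 t 0 = ρ ⟨t, ht⟩ := fun t ht => h.tuple ⟨t, ht⟩
  have e1 : (all 24 (.const r) (isFacetRow (specialRow 24))).eval s ↔
      ∀ t, FacetRow (s.view 0 m n) (ρ t) := by
    rw [eval_all, Fin.forall_iff]
    refine forall₂_congr fun t htr => ?_
    rw [eval_isFacetRow (m := m) (n := n) (i := ρ ⟨t, htr⟩)]
    · rfl
    · simp [Store.setNat_nat, h.rows]
    · simp [Store.setNat_nat, h.cols]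
    · simp [specialRow, Store.setNat_nat, ht t htr]
  have e2 : (all 24 (.const r) (all 25 .cols (all 26 .cols (imp (ne0 (specialEntry 24 25))
      (imp (ne0 (specialEntry 24 26)) (realEq (specialEntry 24 25) (specialEntry 24 26))))))).eval s
      ↔ ∀ t j j', s.view 0 m n (ρ t) j ≠ 0 → s.view 0 m n (ρ t) j' ≠ 0 →
        s.view 0 m n (ρ t) j = s.view 0 m n (ρ t) j' := by
    rw [eval_all, Fin.forall_iff]
    refine forall₂_congr fun t htr => ?_
    simp [specialEntry, specialRow, Store.setNat_nat, Bound.eval, Fin.forall_iff, Store.view,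
      ht t htr, h.cols]
  have e3 : (all 24 (.const r) (all 25 (.const r) (imp (not (natEq (var 24) (var 25)))
      (all 26 .cols (or (eq0 (specialEntry 24 26)) (eq0 (specialEntry 25 26))))))).eval s ↔
      ∀ t t', t ≠ t' → ∀ j, s.view 0 m n (ρ t) j = 0 ∨ s.view 0 m n (ρ t') j = 0 := by
    rw [eval_all, Fin.forall_iff]
    refine forall₂_congr fun t htr => ?_
    rw [eval_all, Fin.forall_iff]
    refine forall₂_congr fun t' htr' => ?_
    simp [specialEntry, specialRow, Store.setNat_nat, Bound.eval, Fin.forall_iff, Store.view,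
      ht t htr, ht t' htr', h.cols, eq0, Fin.ext_iff]
  have e4 : (ex 26 .cols (all 24 (.const r) (eq0 (specialEntry 24 26)))).eval s ↔
      ∃ j, ∀ t, s.view 0 m n (ρ t) j = 0 := by
    rw [eval_ex, Fin.exists_iff]
    simp only [Bound.eval, h.cols, ← exists_prop]
    refine exists_congr fun j => exists_congr fun hj => ?_
    rw [eval_all, Fin.forall_iff]
    refine forall₂_congr fun t htr => ?_
    simp [specialEntry, specialRow, Store.setNat_nat, Store.view, ht t htr, eq0]
  rw [isSpecial, eval_and, eval_and, eval_and, e1, e2, e3, e4]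
  exact ⟨fun ⟨h1, h2, h3, h4⟩ => ⟨h1, h2, h3, h4⟩,
    fun h => ⟨h.facet, h.two_valued, h.disjoint, h.base⟩⟩

end Recognition
end RealRAM

/-! ### Elimination and components as commands -/

namespace RealRAM

theorem Cmd.view_realMap {name x y : ℕ} {B B' : Bound} {e : Tm .real} {s : Store} {m n : ℕ}
    (hm : m ≤ B.eval s) (hn : n ≤ B'.eval s) (i : Fin m) (j : Fin n) :
    ((Cmd.realMap name x y B B' e).sem s).view name m n i j =
      e.eval ((s.setNat x 0 0 i).setNat y 0 0 j) := by
  have h : (i : ℕ) < B.eval s ∧ (j : ℕ) < B'.eval s := ⟨by omega, by omega⟩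
  simp only [sem, Store.view, Store.setArray, if_true, if_pos h]

theorem Cmd.view_eq {c : Cmd} {name : ℕ} (hc : c.RealFree name) (s : Store) (m n : ℕ) :
    (c.sem s).view name m n = s.view name m n := by
  funext i j
  simp only [Store.view, sem_real hc]

namespace Recognition

open Tm GluedProduct

/-- Write `reducedMatrix` into the array `4`. -/
def reduce (r : ℕ) : Cmd :=
  .realMap 4 12 13 .rows .cols (realIte (isFacetRow (var 12))
    (sub (entry 0 12 13) (realLoad 0 (var 12) (find 14 15 .cols (isSameType r 13 14)))) zero)

/-- Eliminate in the array `4`. -/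
def eliminate : Cmd :=
  .loop 10 .rows (.seq
    (.natSet 8 0 0 (find 14 15 .cols (and (ne0 (entry 4 10 14))
      (all 16 .rows (imp (natLt (var 16) (var 10)) (eq0 (entry 4 16 14)))))))
    (.ite (natLt (var 8) (natLoad 0 (const 0) (const 1)))
      (.realMap 4 12 13 .rows .cols (realIte (natEq (var 13) (var 8))
        (div (entry 4 12 8) (entry 4 10 8))
        (sub (entry 4 12 13) (mul (entry 4 10 13) (div (entry 4 12 8) (entry 4 10 8))))))))

/-- The row held by `x` is connected to a row with a nonzero entry in the column held by `11`. -/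
def touches (x : ℕ) : Tm .bool := ex 14 .rows (and (ne0 (entry 4 14 11)) (ne0 (entry 5 14 x)))

/-- Write the characteristic matrix of the connectivity relation of the array `4` into the
array `5`. -/
def connect : Cmd :=
  .seq (.realMap 5 12 13 .rows .rows (realIte (natEq (var 12) (var 13)) one zero))
    (.loop 11 .cols (.realMap 5 12 13 .rows .rows
      (realIte (or (ne0 (entry 5 12 13)) (and (touches 12) (touches 13))) one zero)))

def isNonzeroRow (x : ℕ) : Tm .bool := ex 16 .cols (ne0 (entry 4 x 16))

/-- Write the index of the first nonzero row of the array `4` into register `9`. -/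
def pick : Cmd := .natSet 9 0 0 (find 14 15 .rows (isNonzeroRow 14))

variable {s : Store} {m n r : ℕ} {ρ : Fin r → Fin m}

/-- The reference column is the first column of the same type. -/
theorem sem_reduce (h : s.Holds n ρ) : ∃ ref, IsTypeRep (s.view 0 m n) ρ ref ∧
    ((reduce r).sem s).view 4 m n = reducedMatrix (s.view 0 m n) ref := by
  set S := s.view 0 m n with hS
  let p : Fin n → ℕ → Prop := fun j v => ∃ hv : v < n, SameType S ρ j ⟨v, hv⟩
  have hspec : ∀ j, findBelow n (p j) < n ∧ p j (findBelow n (p j)) := fun j =>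
    findBelow_spec ⟨j, j.2, j.2, fun _ => Iff.rfl⟩
  refine ⟨fun j => ⟨findBelow n (p j), (hspec j).1⟩, ⟨fun j => ?_, fun j j' hjj => ?_⟩, ?_⟩
  · exact (hspec j).2.2
  · have : p j = p j' := by
      funext v
      refine propext (exists_congr fun hv => forall_congr' fun t => ?_)
      rw [hjj t]
    simp only [this]
  · funext i j
    rw [reduce, Cmd.view_realMap h.rows.ge h.cols.ge]
    have hs' : ((s.setNat 12 0 0 i).setNat 13 0 0 j).Holds n ρ :=
      (h.setNat (by decide) (by decide) _ _ _).setNat (by decide) (by decide) _ _ _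
    have e1 : (isFacetRow (var 12)).eval ((s.setNat 12 0 0 i).setNat 13 0 0 j) ↔ FacetRow S i :=
      eval_isFacetRow hs'.rows hs'.cols (by simp [Store.setNat_nat])
    have e2 : (find 14 15 .cols (isSameType r 13 14)).eval
        ((s.setNat 12 0 0 i).setNat 13 0 0 j) = findBelow n (p j) := by
      have := eval_find (x := 14) (y := 15) (by decide) (by decide) .cols (isSameType r 13 14)
        ((s.setNat 12 0 0 i).setNat 13 0 0 j) (p := p j) fun u v hv => ?_
      · rw [this]
        simp only [Bound.eval, hs'.cols]
      · simp only [Bound.eval, hs'.cols] at hv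
        rw [eval_isSameType (j := j) (j' := ⟨v, hv⟩) ((hs'.setNat (by decide) (by decide) _ _ _).setNat
          (by decide) (by decide) _ _ _) (by decide) (by decide)]
        · exact ⟨fun h => ⟨hv, h⟩, fun h => h.2⟩
        · simp [Store.setNat_nat]
        · simp
    rw [eval_realIte, reducedMatrix]
    by_cases hF : FacetRow S i
    · rw [if_pos (e1.2 hF), if_pos hF, eval_sub, eval_realLoad, e2]
      rfl
    · rw [if_neg fun h => hF (e1.1 h), if_neg hF, eval_zero]

theorem sem_eliminate (hm : s.nat 0 0 0 = m) (hn : s.nat 0 0 1 = n) :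
    Eliminated (s.view 4 m n) ((eliminate.sem s).view 4 m n) m := by
  have key := Cmd.sem_loop (x := 10) (B := .rows) (s := s)
    (p := .seq (.natSet 8 0 0 (find 14 15 .cols (and (ne0 (entry 4 10 14))
      (all 16 .rows (imp (natLt (var 16) (var 10)) (eq0 (entry 4 16 14)))))))
    (.ite (natLt (var 8) (natLoad 0 (const 0) (const 1)))
      (.realMap 4 12 13 .rows .cols (realIte (natEq (var 13) (var 8))
        (div (entry 4 12 8) (entry 4 10 8))
        (sub (entry 4 12 13) (mul (entry 4 10 13) (div (entry 4 12 8) (entry 4 10 8))))))))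
    (fun v s' => s'.nat 0 = s.nat 0 ∧ Eliminated (s.view 4 m n) (s'.view 4 m n) v)
    ⟨rfl, eliminated_zero _⟩ ?_
  · simp only [Bound.eval, hm] at key
    exact key.2
  rintro v hv s' ⟨h0, hE⟩
  simp only [Bound.eval, hm] at hv
  set i : Fin m := ⟨v, hv⟩ with hi
  have hm' : s'.nat 0 0 0 = m := by rw [h0, hm]
  have hn' : s'.nat 0 0 1 = n := by rw [h0, hn]
  have hfind : (find 14 15 .cols (and (ne0 (entry 4 10 14))
      (all 16 .rows (imp (natLt (var 16) (var 10)) (eq0 (entry 4 16 14)))))).eval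
      (s'.setNat 10 0 0 v) =
      findBelow n fun p => ∃ hp : p < n, IsPivot (s'.view 4 m n) i ⟨p, hp⟩ := by
    rw [eval_find (x := 14) (y := 15) (by decide) (by decide)
      (p := fun p => ∃ hp : p < n, IsPivot (s'.view 4 m n) i ⟨p, hp⟩)]
    · simp [Bound.eval, hn', Store.setNat_nat]
    · intro u p hp
      simp only [Bound.eval, Store.setNat_nat, hn'] at hp
      have hp' : p < n := by simpa using hp
      simp [hp', IsPivot, entry, eq0, Store.setNat_nat, Store.view, Bound.eval, hm',
        Fin.forall_iff, hi]
  refine ⟨?_, ?_⟩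
  · rw [Cmd.sem_nat (by simp [Cmd.NatFree]), Store.setNat_nat_of_ne _ (by decide), h0]
  rw [Cmd.sem, Cmd.sem, hfind]
  by_cases hex : ∃ p, ∃ hp : p < n, IsPivot (s'.view 4 m n) i ⟨p, hp⟩
  · obtain ⟨p, hp, hpiv⟩ := hex
    obtain ⟨hlt, _, hpiv⟩ := findBelow_spec (N := n)
      (p := fun p => ∃ hp : p < n, IsPivot (s'.view 4 m n) i ⟨p, hp⟩) ⟨p, hp, hp, hpiv⟩
    generalize findBelow n (fun p => ∃ hp : p < n, IsPivot (s'.view 4 m n) i ⟨p, hp⟩) = q at *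
    rw [Cmd.sem, if_pos (by simpa [Store.setNat_nat, hn'] using hlt)]
    refine hE.succ_of_isPivot (i := i) hpiv fun a l => ?_
    rw [Cmd.view_realMap (by simp [Bound.eval, Store.setNat_nat, hm'])
      (by simp [Bound.eval, Store.setNat_nat, hn'])]
    simp [entry, Store.setNat_nat, Store.view, hi, Fin.ext_iff]
  -- Without a pivot the search returns `n`, and the guard skips the elimination step.
  · rw [findBelow_of_not (fun ⟨p, _, h⟩ => hex ⟨p, h⟩), Cmd.sem,
      if_neg (by simp [Store.setNat_nat, hn'])]
    exact hE.succ_of_not_isPivot (i := i) fun p hp => hex ⟨p, p.2, hp⟩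

theorem eval_touches (hm : s.nat 0 0 0 = m) {x : ℕ} (hx : x ≠ 14) {i : Fin m} {j : Fin n}
    (hi : s.nat x 0 0 = i) (hj : s.nat 11 0 0 = j) :
    (touches x).eval s ↔ ∃ q, s.view 4 m n q j ≠ 0 ∧ s.view 5 m m q i ≠ 0 := by
  rw [touches, eval_ex, Fin.exists_iff]
  simp only [Bound.eval, hm, ← exists_prop]
  refine exists_congr fun q => exists_congr fun hq => ?_
  simp [entry, Store.setNat_nat, Store.view, hx, hi, hj]

theorem sem_connect (hm : s.nat 0 0 0 = m) (hn : s.nat 0 0 1 = n) :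
    Connected (s.view 4 m n) (fun i i' => (connect.sem s).view 5 m m i i' ≠ 0) n := by
  rw [connect, Cmd.sem]
  have key := Cmd.sem_loop (x := 11) (B := .cols)
    (s := (Cmd.realMap 5 12 13 .rows .rows
      (realIte (natEq (var 12) (var 13)) one zero)).sem s)
    (p := .realMap 5 12 13 .rows .rows
      (realIte (or (ne0 (entry 5 12 13)) (and (touches 12) (touches 13))) one zero))
    (fun v s' => s'.nat 0 = s.nat 0 ∧ s'.view 4 m n = s.view 4 m n ∧
      Connected (s.view 4 m n) (fun i i' => s'.view 5 m m i i' ≠ 0) v) ⟨rfl, ?_, ?_⟩ ?_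
  · have hb : Bound.eval ((Cmd.realMap 5 12 13 .rows .rows
      (realIte (natEq (var 12) (var 13)) one zero)).sem s) .cols = n := hn
    rw [hb] at key
    exact key.2.2
  · exact Cmd.view_eq (by simp [Cmd.RealFree]) _ _ _
  · refine connected_zero _ fun i i' => ?_
    rw [Cmd.view_realMap hm.ge hm.ge]
    simp [Store.setNat_nat, Fin.ext_iff]
  · rintro v hv s' ⟨h0, h4, hC⟩
    have hv' : v < n := by
      have : Bound.eval ((Cmd.realMap 5 12 13 .rows .rows
        (realIte (natEq (var 12) (var 13)) one zero)).sem s) .cols = n := hn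
      omega
    refine ⟨?_, ?_, ?_⟩
    · rw [Cmd.sem_nat (by simp [Cmd.NatFree]), Store.setNat_nat_of_ne _ (by decide), h0]
    · rw [Cmd.view_eq (by simp [Cmd.RealFree]), Store.view_setNat, h4]
    · refine hC.succ (j := ⟨v, hv'⟩) fun i i' => ?_
      rw [Cmd.view_realMap (by simp [Bound.eval, Store.setNat_nat, h0, hm])
        (by simp [Bound.eval, Store.setNat_nat, h0, hm]), ← h4]
      have e : ∀ x (q : Fin m), x ≠ 14 → (((s'.setNat 11 0 0 v).setNat 12 0 0 i).setNat 13 0 0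
          i').nat x 0 0 = q → ((touches x).eval (((s'.setNat 11 0 0 v).setNat 12 0 0 i).setNat 13 0 0
          i') ↔ ∃ a, s'.view 4 m n a ⟨v, hv'⟩ ≠ 0 ∧ s'.view 5 m m a q ≠ 0) := fun x q hx hq =>
        eval_touches (by simp [Store.setNat_nat, h0, hm]) hx hq (by simp [Store.setNat_nat])
      rw [← e 12 i (by decide) (by simp [Store.setNat_nat]),
        ← e 13 i' (by decide) (by simp)]
      have e5 : s'.view 5 m m i i' ≠ 0 ↔ (ne0 (entry 5 12 13)).eval
          (((s'.setNat 11 0 0 v).setNat 12 0 0 i).setNat 13 0 0 i') := Iff.rfl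
      rw [e5, ← eval_and, ← eval_or, eval_realIte]
      split_ifs with hc
      · simpa using hc
      · simpa using hc

/-- The row held by `x` belongs to the component that was picked. -/
def inComponent (x : ℕ) : Tm .bool :=
  and (natLt (var 9) (natLoad 0 (const 0) (const 0))) (ne0 (entry 5 9 x))

/-- The component that was picked. -/
def component (s : Store) (m : ℕ) : Set (Fin m) :=
  {i | s.nat 9 0 0 < m ∧ s.real 5 (s.nat 9 0 0) i ≠ 0}

/-- There are nonzero rows outside the component that was picked. -/
def isDisconnected : Tm .bool := ex 14 .rows (and (isNonzeroRow 14) (not (inComponent 14)))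

/-- Find a component of the matroid of facet rows. -/
def analyze (r : ℕ) : Cmd := .seq (reduce r) (.seq eliminate (.seq connect pick))

theorem eval_isNonzeroRow (hn : s.nat 0 0 1 = n) {x : ℕ} (hx : x ≠ 16) {i : Fin m}
    (hi : s.nat x 0 0 = i) : (isNonzeroRow x).eval s ↔ ∃ j, s.view 4 m n i j ≠ 0 := by
  rw [isNonzeroRow, eval_ex, Fin.exists_iff]
  simp only [Bound.eval, hn, ← exists_prop]
  refine exists_congr fun q => exists_congr fun hq => ?_
  simp [entry, Store.setNat_nat, Store.view, hx, hi]

theorem eval_inComponent (hm : s.nat 0 0 0 = m) {x : ℕ} {i : Fin m} (hi : s.nat x 0 0 = i) :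
    (inComponent x).eval s ↔ i ∈ component s m := by
  simp [inComponent, component, entry, hm, hi]

/-- The picked component, empty if there are no nonzero rows, is closed under columns and hence a
separator. The nonzero rows after elimination are the facet rows that are not constant on types. A
separator contains a component entirely or not at all; so if some separator splits the nonzero rows,
they do not all lie in the picked component. -/
theorem sem_analyze (h : s.Holds n ρ) :
    Separates (s.view 0 m n) ρ (component ((analyze r).sem s) m) ∧
    (isDisconnected.eval ((analyze r).sem s) →
      (∃ i ∈ component ((analyze r).sem s) m, FacetRow (s.view 0 m n) i ∧
        ¬ TypeConst (s.view 0 m n) ρ (s.view 0 m n i)) ∧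
      ∃ i ∉ component ((analyze r).sem s) m, FacetRow (s.view 0 m n) i ∧
        ¬ TypeConst (s.view 0 m n) ρ (s.view 0 m n i)) ∧
    ∀ Z, Separates (s.view 0 m n) ρ Z →
      (∃ i ∈ Z, FacetRow (s.view 0 m n) i ∧ ¬ TypeConst (s.view 0 m n) ρ (s.view 0 m n i)) →
      (∃ i ∉ Z, FacetRow (s.view 0 m n) i ∧ ¬ TypeConst (s.view 0 m n) ρ (s.view 0 m n i)) →
      isDisconnected.eval ((analyze r).sem s) := by
  set S := s.view 0 m n with hS
  obtain ⟨ref, href, hred⟩ := sem_reduce h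
  set s₁ := (reduce r).sem s with hs₁
  have hm₁ : s₁.nat 0 0 0 = m := h.rows
  have hn₁ : s₁.nat 0 0 1 = n := h.cols
  have hE := sem_eliminate hm₁ hn₁
  rw [hred] at hE
  set s₂ := eliminate.sem s₁ with hs₂
  have h0₂ : s₂.nat 0 = s.nat 0 := Cmd.sem_nat (by simp [eliminate, Cmd.NatFree]) _
  have hm₂ : s₂.nat 0 0 0 = m := by rw [h0₂, h.rows]
  have hn₂ : s₂.nat 0 0 1 = n := by rw [h0₂, h.cols]
  have hC := sem_connect hm₂ hn₂
  set s₃ := connect.sem s₂ with hs₃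
  have h0₃ : s₃.nat 0 = s.nat 0 := by
    rw [hs₃, Cmd.sem_nat (by simp [connect, Cmd.NatFree]), h0₂]
  have hm₃ : s₃.nat 0 0 0 = m := by rw [h0₃, h.rows]
  have hn₃ : s₃.nat 0 0 1 = n := by rw [h0₃, h.cols]
  have h4₃ : s₃.view 4 m n = s₂.view 4 m n := Cmd.view_eq (by simp [connect, Cmd.RealFree]) _ _ _
  set M := s₂.view 4 m n with hM
  have hnz : ∀ i, (∃ j, M i j ≠ 0) ↔ FacetRow S i ∧ ¬ TypeConst S ρ (S i) :=
    hE.exists_ne_zero_iff href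
  have hfind : (find 14 15 .rows (isNonzeroRow 14)).eval s₃ =
      findBelow m fun i => ∃ hi : i < m, ∃ j, M ⟨i, hi⟩ j ≠ 0 := by
    rw [eval_find (x := 14) (y := 15) (by decide) (by decide)
      (p := fun i => ∃ hi : i < m, ∃ j, M ⟨i, hi⟩ j ≠ 0)]
    · simp only [Bound.eval, hm₃]
    · intro u v hv
      simp only [Bound.eval, hm₃] at hv
      rw [eval_isNonzeroRow (m := m) (n := n) (i := ⟨v, hv⟩) (by simp [Store.setNat_nat, hn₃])
        (by decide) (by simp)]
      simp only [Store.view_setNat, h4₃]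
      exact ⟨fun h => ⟨hv, h⟩, fun h => h.2⟩
  have hs₄ : (analyze r).sem s = s₃.setNat 9 0 0
      (findBelow m fun i => ∃ hi : i < m, ∃ j, M ⟨i, hi⟩ j ≠ 0) := by
    rw [← hfind]; rfl
  rw [hs₄]
  set i₀ := findBelow m fun i => ∃ hi : i < m, ∃ j, M ⟨i, hi⟩ j ≠ 0 with hi₀
  have hcomp : component (s₃.setNat 9 0 0 i₀) m =
      {i : Fin m | i₀ < m ∧ s₃.real 5 i₀ i ≠ 0} := by
    simp [component]
  have hclosed : ColumnClosed M (component (s₃.setNat 9 0 0 i₀) m) := by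
    rw [hcomp]
    by_cases hlt : i₀ < m
    · simp only [hlt, true_and]
      exact hC.columnClosed ⟨i₀, hlt⟩
    · intro l i i' _ _
      simp [hlt]
  have hdis : isDisconnected.eval (s₃.setNat 9 0 0 i₀) ↔
      ∃ i ∉ component (s₃.setNat 9 0 0 i₀) m, ∃ j, M i j ≠ 0 := by
    rw [isDisconnected, eval_ex, Fin.exists_iff]
    simp only [Bound.eval, Store.setNat_nat, hm₃, ← exists_prop]
    refine exists_congr fun q => exists_congr fun hq => ?_
    rw [eval_and, eval_not, eval_isNonzeroRow (m := m) (n := n) (i := ⟨q, hq⟩)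
      (by simp [Store.setNat_nat, hn₃]) (by decide) (by simp),
      eval_inComponent (m := m) (i := ⟨q, hq⟩) (by simp [Store.setNat_nat, hm₃]) (by simp)]
    simp only [Store.view_setNat, h4₃]
    exact ⟨fun h => ⟨h.2, h.1⟩, fun ⟨h1, h2⟩ => ⟨h2, h1⟩⟩
  refine ⟨(hE.separates_iff href _).2 hclosed, fun hd => ?_, fun Z hZ hz hz' => ?_⟩
  · obtain ⟨i, hi, hij⟩ := hdis.1 hd
    refine ⟨?_, i, hi, (hnz i).1 hij⟩
    obtain ⟨hlt, _, hne⟩ := findBelow_spec (N := m)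
      (p := fun i => ∃ hi : i < m, ∃ j, M ⟨i, hi⟩ j ≠ 0) ⟨i, i.2, i.2, hij⟩
    refine ⟨⟨i₀, hlt⟩, ?_, (hnz _).1 hne⟩
    rw [hcomp]
    exact ⟨hlt, hC.refl ⟨i₀, hlt⟩⟩
  · obtain ⟨z, hzZ, hz⟩ := hz
    obtain ⟨z', hzZ', hz'⟩ := hz'
    rw [← hnz] at hz hz'
    rw [hdis]
    by_contra! hcon
    have hZc : ColumnClosed M Z := (hE.separates_iff href Z).1 hZ
    have hz₁ : z ∈ component (s₃.setNat 9 0 0 i₀) m := by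
      by_contra hn
      obtain ⟨j, hj⟩ := hz
      exact hj (hcon z hn j)
    have hz₂ : z' ∈ component (s₃.setNat 9 0 0 i₀) m := by
      by_contra hn
      obtain ⟨j, hj⟩ := hz'
      exact hj (hcon z' hn j)
    rw [hcomp] at hz₁ hz₂
    have e1 := hC.finest Z hZc ⟨i₀, hz₁.1⟩ z hz₁.2
    have e2 := hC.finest Z hZc ⟨i₀, hz₁.1⟩ z' hz₂.2
    exact hzZ' (e2.1 (e1.2 hzZ))

end Recognition
end RealRAM

/-! ### Writing the factor matrices and removing repeated columns -/

namespace RealRAM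

namespace Recognition

open Tm GluedProduct

def tt : Tm .bool := natEq (const 0) (const 0)

/-- Write `factorMatrix` for the set of rows described by `X` (as a condition on register `12`)
into the array `name`. -/
def factor (r name : ℕ) (X : Tm .bool) : Cmd :=
  .realMap name 12 13 .rowsSucc .cols (realIte (natLt (var 12) (natLoad 0 (const 0) (const 0)))
    (realIte (ex 14 (.const r) (natEq (specialRow 14) (var 12)))
      (realIte (eq0 (entry 0 12 13)) zero one)
      (realIte (and X (isFacetRow (var 12))) (entry 0 12 13) zero))
    (realIte (all 14 (.const r) (eq0 (specialEntry 14 13))) one zero))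

/-- The column held by `x` of the array `f` differs from the columns before it. -/
def isNew (f x : ℕ) : Tm .bool :=
  all 30 .cols (imp (natLt (var 30) (var x))
    (ex 31 .rowsSucc (not (realEq (entry f 31 x) (entry f 31 30)))))

/-- Copy the distinct columns of the array `f` into the array `out`. -/
def copy (f out : ℕ) : Cmd :=
  .seq (.natSet out 0 0 (count 14 .rowsSucc tt))
    (.seq (.natSet out 0 1 (count 14 .cols (isNew f 14)))
      (.realMap out 12 13 .rowsSucc .cols (realLoad f (var 12) (find 14 15 .cols
        (and (isNew f 14)
          (natEq (count 16 .cols (and (natLt (var 16) (var 14)) (isNew f 16))) (var 13)))))))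

/-- The matrix called `out` consists of the distinct columns of `F`. -/
def Lists (s : Store) (out : ℕ) {m n : ℕ} (F : Fin m → Fin n → ℝ) : Prop :=
  ∃ (N : ℕ) (e : Fin N → Fin n), N ≤ n ∧ s.rows out = m ∧ s.cols out = N ∧
    s.view out m N = (fun i c => F i (e c)) ∧
    (∀ c c', (∀ i, F i (e c) = F i (e c')) → c = c') ∧ ∀ j, ∃ c, ∀ i, F i j = F i (e c)

theorem Lists.congr {s s' : Store} {out m n : ℕ} {F : Fin m → Fin n → ℝ} (h : Lists s out F)
    (hn : s'.nat out = s.nat out) (hr : s'.real out = s.real out) : Lists s' out F := by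
  obtain ⟨N, e, h1, h2, h3, h4, h5⟩ := h
  refine ⟨N, e, h1, ?_, ?_, ?_, h5⟩
  · rw [← h2, Store.rows, Store.rows, hn]
  · rw [← h3, Store.cols, Store.cols, hn]
  · rw [← h4]
    funext i j
    simp only [Store.view, hr]

variable {s : Store} {m n r : ℕ} {ρ : Fin r → Fin m}

theorem sem_factor (h : s.Holds n ρ) {name : ℕ} {X : Tm .bool} {Y : Set (Fin m)}
    (hX : ∀ (i : Fin m) (j : ℕ), X.eval ((s.setNat 12 0 0 i).setNat 13 0 0 j) ↔ i ∈ Y) :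
    ((factor r name X).sem s).view name (m + 1) n = factorMatrix (s.view 0 m n) ρ Y := by
  classical
  have ht : ∀ t (ht : t < r), s.nat 6 t 0 = ρ ⟨t, ht⟩ := fun t ht => h.tuple ⟨t, ht⟩
  funext i j
  rw [factor, Cmd.view_realMap (by simp [Bound.eval, h.rows]) h.cols.ge]
  have hs' : ((s.setNat 12 0 0 i).setNat 13 0 0 j).Holds n ρ :=
    (h.setNat (by decide) (by decide) _ _ _).setNat (by decide) (by decide) _ _ _
  set s' := (s.setNat 12 0 0 i).setNat 13 0 0 j with hs'def
  induction i using Fin.lastCases with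
  | last =>
    have e0 : ¬ (natLt (var 12) (natLoad 0 (const 0) (const 0))).eval s' := by
      simp [hs'def, Store.setNat_nat, h.rows]
    have e1 : (all 14 (.const r) (eq0 (specialEntry 14 13))).eval s' ↔
        ∀ t, s.view 0 m n (ρ t) j = 0 := by
      rw [eval_all, Fin.forall_iff]
      refine forall₂_congr fun t htr => ?_
      simp [hs'def, eq0, specialEntry, specialRow, Store.setNat_nat, Store.view, ht t htr]
    rw [eval_realIte, if_neg e0, eval_realIte, factorMatrix, Fin.lastCases_last]
    by_cases hc : ∀ t, s.view 0 m n (ρ t) j = 0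
    · rw [if_pos (e1.2 hc), if_pos hc, eval_one]
    · rw [if_neg fun h => hc (e1.1 h), if_neg hc, eval_zero]
  | cast i =>
    have e0 : (natLt (var 12) (natLoad 0 (const 0) (const 0))).eval s' := by
      simp [hs'def, Store.setNat_nat, h.rows]
    have e1 : (ex 14 (.const r) (natEq (specialRow 14) (var 12))).eval s' ↔ i ∈ range ρ := by
      rw [eval_ex, mem_range, Fin.exists_iff]
      simp only [← exists_prop]
      refine exists_congr fun t => exists_congr fun htr => ?_
      simp [hs'def, specialRow, Store.setNat_nat, ht t htr, Fin.ext_iff]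
    have e2 : (isFacetRow (var 12)).eval s' ↔ FacetRow (s.view 0 m n) i :=
      eval_isFacetRow hs'.rows hs'.cols (by simp [hs'def, Store.setNat_nat])
    have e3 : X.eval s' ↔ i ∈ Y := hX i j
    have e4 : (entry 0 12 13).eval s' = s.view 0 m n i j := by
      simp [hs'def, entry, Store.setNat_nat, Store.view]
    have e5 : (and X (isFacetRow (var 12))).eval s' ↔ i ∈ Y ∧ FacetRow (s.view 0 m n) i := by
      rw [eval_and, e3, e2]
    have e6 : (eq0 (entry 0 12 13)).eval s' ↔ s.view 0 m n i j = 0 := by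
      rw [eq0, eval_realEq, e4]; rfl
    rw [eval_realIte, if_pos e0, eval_realIte, factorMatrix, Fin.lastCases_castSucc]
    by_cases hc : i ∈ range ρ
    · rw [if_pos (e1.2 hc), if_pos hc, eval_realIte]
      by_cases h0 : s.view 0 m n i j = 0
      · rw [if_pos (e6.2 h0), if_pos h0, eval_zero]
      · rw [if_neg fun h => h0 (e6.1 h), if_neg h0, eval_one]
    · rw [if_neg fun h => hc (e1.1 h), if_neg hc, eval_realIte]
      by_cases h0 : i ∈ Y ∧ FacetRow (s.view 0 m n) i
      · rw [if_pos (e5.2 h0), if_pos h0, e4]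
      · rw [if_neg fun h => h0 (e5.1 h), if_neg h0, eval_zero]

theorem eval_isNew (hm : s.nat 0 0 0 = m) (hn : s.nat 0 0 1 = n) {f x : ℕ} (hx : x ≠ 30)
    (hx' : x ≠ 31) {j : Fin n} (hj : s.nat x 0 0 = j) :
    (isNew f x).eval s ↔ IsNewColumn (s.view f (m + 1) n) j := by
  rw [isNew, eval_all, IsNewColumn, Fin.forall_iff]
  simp only [Bound.eval, hn]
  refine forall₂_congr fun v hv => ?_
  rw [eval_imp]
  refine imp_congr ?_ ?_
  · simp [Store.setNat_nat, hx, hj, Fin.lt_def]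
  · rw [eval_ex, Fin.exists_iff]
    simp only [Bound.eval, Store.setNat_nat, hm, ← exists_prop]
    refine exists_congr fun q => exists_congr fun hq => ?_
    simp [entry, Store.setNat_nat, Store.view, hx, hx', hj]

/-- Output column `c` is the first occurrence of a column that has exactly `c` other first
occurrences before it; by the injectivity of `rank` every distinct column is listed once. -/
theorem sem_copy (hm : s.nat 0 0 0 = m) (hn : s.nat 0 0 1 = n) {f out : ℕ} (ho : out ≠ 0) :
    Lists ((copy f out).sem s) out (s.view f (m + 1) n) := by
  classical
  set F := s.view f (m + 1) n with hF
  obtain ⟨K, hK⟩ : ∃ K : ℕ → Prop, ∀ j, K j ↔ ∃ hj : j < n, IsNewColumn F ⟨j, hj⟩ :=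
    ⟨_, fun _ => Iff.rfl⟩
  have hnew : ∀ (s' : Store), s'.nat 0 = s.nat 0 → s'.real = s.real → ∀ x v, x ≠ 30 → x ≠ 31 →
      s'.nat x 0 0 = v → v < n → ((isNew f x).eval s' ↔ K v) := by
    intro s' h0 hr x v hx hx' hxv hv
    rw [eval_isNew (m := m) (n := n) (j := ⟨v, hv⟩) (by rw [h0, hm]) (by rw [h0, hn]) hx hx' hxv]
    have : s'.view f (m + 1) n = F := by
      funext i j
      simp only [Store.view, hr, hF]
    rw [this, hK]
    exact ⟨fun h => ⟨hv, h⟩, fun h => h.2⟩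
  have hcount : ∀ (s' : Store), s'.nat 0 = s.nat 0 → s'.real = s.real →
      (count 14 .cols (isNew f 14)).eval s' = rank n K n := by
    intro s' h0 hr
    rw [eval_count, rank]
    simp only [Bound.eval, h0, hn]
    congr 1
    refine Finset.filter_congr fun v hv => ?_
    rw [Finset.mem_range] at hv
    rw [hnew (s'.setNat 14 0 0 v) (by rw [Store.setNat_nat_of_ne _ (by decide), h0]) hr 14 v (by decide) (by decide)
      (by simp) hv]
    simp [hv]
  have hrows : (count 14 .rowsSucc tt).eval s = m + 1 := by
    rw [eval_count]
    simp [tt, Bound.eval, hm]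
  set s₁ := s.setNat out 0 0 (m + 1) with hs₁
  set s₂ := s₁.setNat out 0 1 (rank n K n) with hs₂
  have h0₁ : s₁.nat 0 = s.nat 0 := Store.setNat_nat_of_ne _ (Ne.symm ho) _ _ _
  have h0₂ : s₂.nat 0 = s.nat 0 := by rw [hs₂, Store.setNat_nat_of_ne _ (Ne.symm ho), h0₁]
  have hsem : (copy f out).sem s = (Cmd.realMap out 12 13 .rowsSucc .cols (realLoad f (var 12)
      (find 14 15 .cols (and (isNew f 14)
        (natEq (count 16 .cols (and (natLt (var 16) (var 14)) (isNew f 16))) (var 13)))))).sem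
      s₂ := by
    change Cmd.sem _ ((s.setNat out 0 0 ((count 14 .rowsSucc tt).eval s)).setNat out 0 1
      ((count 14 .cols (isNew f 14)).eval (s.setNat out 0 0 ((count 14 .rowsSucc tt).eval s)))) = _
    rw [hrows, ← hs₁, hcount s₁ h0₁ rfl]
  have hle : rank n K n ≤ n := by
    rw [rank]
    exact (Finset.card_filter_le _ _).trans (by simp)
  have hspec : ∀ c : Fin (rank n K n), findBelow n (fun j => K j ∧ rank n K j = c) < n ∧
      K (findBelow n fun j => K j ∧ rank n K j = c) ∧
      rank n K (findBelow n fun j => K j ∧ rank n K j = c) = c := fun c => by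
    obtain ⟨j, hj, h1, h2⟩ := exists_rank_eq c.2
    exact findBelow_spec (p := fun j => K j ∧ rank n K j = c) ⟨j, hj, h1, h2⟩
  have hfind : ∀ (i : Fin (m + 1)) (c : Fin (rank n K n)), (find 14 15 .cols (and (isNew f 14)
      (natEq (count 16 .cols (and (natLt (var 16) (var 14)) (isNew f 16))) (var 13)))).eval
      ((s₂.setNat 12 0 0 i).setNat 13 0 0 c) = findBelow n fun j => K j ∧ rank n K j = c := by
    intro i c
    rw [eval_find (x := 14) (y := 15) (by decide) (by decide)
      (p := fun j => K j ∧ rank n K j = c)]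
    · simp [Bound.eval, Store.setNat_nat, h0₂, hn]
    · intro u v hv
      have hv' : v < n := by simpa [Bound.eval, Store.setNat_nat, h0₂, hn] using hv
      set s₃ := (((s₂.setNat 12 0 0 i).setNat 13 0 0 c).setNat 15 0 0 u).setNat 14 0 0 v with hs₃
      have h0₃ : s₃.nat 0 = s.nat 0 := by
        rw [hs₃, Store.setNat_nat_of_ne _ (by decide), Store.setNat_nat_of_ne _ (by decide),
          Store.setNat_nat_of_ne _ (by decide), Store.setNat_nat_of_ne _ (by decide), h0₂]
      have hrank : (count 16 .cols (and (natLt (var 16) (var 14)) (isNew f 16))).eval s₃ =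
          rank n K v := by
        rw [eval_count, rank]
        simp only [Bound.eval, h0₃, hn]
        congr 1
        refine Finset.filter_congr fun w hw => ?_
        rw [Finset.mem_range] at hw
        rw [eval_and, hnew (s₃.setNat 16 0 0 w) (by rw [Store.setNat_nat_of_ne _ (by decide), h0₃]) rfl 16 w
          (by decide) (by decide) (by simp) hw]
        simp [hs₃, Store.setNat_nat]
      rw [eval_and, eval_natEq, hrank, hnew s₃ h0₃ rfl 14 v (by decide) (by decide)
        (by simp [hs₃]) hv']
      simp [hs₃, Store.setNat_nat]
  refine ⟨rank n K n, fun c => ⟨_, (hspec c).1⟩, hle, ?_, ?_, ?_, ?_, ?_⟩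
  · rw [hsem]
    simp [Store.rows, Cmd.sem, Store.setArray, hs₂, hs₁, Store.setNat_nat]
  · rw [hsem]
    simp [Store.cols, Cmd.sem, Store.setArray, hs₂, Store.setNat_nat]
  · funext i c
    have hc : (c : ℕ) < n := by omega
    have := Cmd.view_realMap (name := out) (x := 12) (y := 13) (B := .rowsSucc) (B' := .cols)
      (s := s₂) (m := m + 1) (n := rank n K n) (e := realLoad f (var 12)
      (find 14 15 .cols (and (isNew f 14)
        (natEq (count 16 .cols (and (natLt (var 16) (var 14)) (isNew f 16))) (var 13)))))
      (by simp [Bound.eval, h0₂, hm]) (by simpa [Bound.eval, h0₂, hn] using hle) i c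
    rw [hsem, this, eval_realLoad, hfind]
    simp [Store.setNat_nat, hF, Store.view, hs₂, hs₁]
  · intro c c' hcc
    have := IsNewColumn.eq ((hK _).1 (hspec c).2.1).2 ((hK _).1 (hspec c').2.1).2 hcc
    have h1 := (hspec c).2.2
    have h2 := (hspec c').2.2
    rw [Fin.mk.injEq] at this
    rw [this, h2] at h1
    exact (Fin.ext h1).symm
  · intro j
    obtain ⟨j', hj', he⟩ := exists_isNewColumn F j
    have hKj : K j' := (hK j').2 ⟨j'.2, hj'⟩
    refine ⟨⟨rank n K j', rank_lt_rank j'.2 hKj⟩, fun i => ?_⟩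
    rw [he i]
    have hs := hspec ⟨rank n K j', rank_lt_rank j'.2 hKj⟩
    congr 1
    exact Fin.ext (rank_injective j'.2 hs.1 hKj hs.2.1 hs.2.2.symm)

end Recognition
end RealRAM

/-! ### The search over tuples of rows -/

namespace RealRAM

namespace Recognition

open Tm GluedProduct

/-- Write slack matrices of the two factors into the arrays `1` and `2`, and accept. -/
def report (r : ℕ) : Cmd :=
  .seq (factor r 16 (inComponent 12)) (.seq (factor r 17 (not (inComponent 12)))
    (.seq (copy 16 1) (.seq (copy 17 2) (.natSet 3 0 0 (const 1)))))

/-- The test that decides whether the components found by `analyze` are reported. -/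
def isGood (b : Bool) : Tm .bool := cond b isDisconnected tt

/-- Test one tuple of rows. -/
def body (r : ℕ) (b : Bool) : Cmd :=
  .ite (and (natEq (natLoad 3 (const 0) (const 0)) (const 0)) (and (inRange r) (isSpecial r)))
    (.seq (analyze r) (.ite (isGood b) (report r)))

/-- Execute `p` for all tuples of row indices in the first `t` entries of the array `6`. -/
def forTuples (p : Cmd) : ℕ → Cmd
  | 0 => p
  | t + 1 => .loop 7 .rows (.seq (.natSet 6 t 0 (var 7)) (forTuples p t))

section Tuples

variable {p : Cmd} {s : Store}

theorem sem_forTuples (I : Store → Prop) (h6 : ∀ s t v, I s → I (s.setNat 6 t 0 v))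
    (h7 : ∀ s v, I s → I (s.setNat 7 0 0 v)) (hp : ∀ s, I s → I (p.sem s)) (t : ℕ) (hs : I s) :
    I ((forTuples p t).sem s) := by
  induction t generalizing s with
  | zero => exact hp s hs
  | succ t ih =>
    exact Cmd.sem_loop (fun _ => I) hs fun v _ s' hs' => ih (h6 _ _ _ (h7 _ _ hs'))

theorem forTuples_tuple (hp6 : p.NatFree 6) (t : ℕ) {t' : ℕ} (ht : t ≤ t') :
    ((forTuples p t).sem s).nat 6 t' 0 = s.nat 6 t' 0 := by
  induction t generalizing s with
  | zero => rw [forTuples, Cmd.sem_nat hp6]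
  | succ t ih =>
    refine Cmd.sem_loop (fun _ s' => s'.nat 6 t' 0 = s.nat 6 t' 0) rfl fun v _ s' hs' => ?_
    rw [Cmd.sem, ih (by omega), Cmd.sem, Store.setNat_nat, if_neg (by omega), Store.setNat_nat,
      if_neg (by simp), hs']

/-- Induction on the nesting depth: in the round in which entry `t` takes the value `ρ t`, the inner
loops meet the tuple, as they do not change the entries from `t` on; later rounds preserve `A`. -/
theorem sem_forTuples_hit {I A : Store → Prop} (h6 : ∀ s t v, I s → I (s.setNat 6 t 0 v))
    (h7 : ∀ s v, I s → I (s.setNat 7 0 0 v)) (hp : ∀ s, I s → I (p.sem s))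
    (hA6 : ∀ s t v, A s → A (s.setNat 6 t 0 v)) (hA7 : ∀ s v, A s → A (s.setNat 7 0 0 v))
    (hAp : ∀ s, A s → A (p.sem s)) (hp6 : p.NatFree 6) {m r : ℕ} (hm : ∀ s, I s → s.nat 0 0 0 = m)
    {ρ : Fin r → Fin m}
    (hit : ∀ s, I s → (∀ t : Fin r, s.nat 6 t 0 = ρ t) → A (p.sem s))
    {t : ℕ} (ht : t ≤ r) (hs : I s) (hρ : ∀ t' : Fin r, t ≤ t' → s.nat 6 t' 0 = ρ t') :
    A ((forTuples p t).sem s) := by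
  induction t generalizing s with
  | zero => exact hit s hs fun t' => hρ t' (Nat.zero_le _)
  | succ t ih =>
    have key := Cmd.sem_loop (x := 7) (B := .rows)
      (p := .seq (.natSet 6 t 0 (var 7)) (forTuples p t)) (s := s)
      (fun v s' => I s' ∧ (∀ t' : Fin r, t + 1 ≤ t' → s'.nat 6 t' 0 = ρ t') ∧
        ((ρ ⟨t, ht⟩ : ℕ) < v → A s')) ⟨hs, hρ, fun h => absurd h (Nat.not_lt_zero _)⟩ ?_
    · refine key.2.2 ?_
      simp only [Bound.eval, hm s hs]
      exact (ρ ⟨t, ht⟩).2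
    · rintro v hv s' ⟨hI, hT, hA⟩
      have e : (Cmd.natSet 6 t 0 (var 7)).sem (s'.setNat 7 0 0 v) =
          (s'.setNat 7 0 0 v).setNat 6 t 0 v := by
        simp [Cmd.sem]
      rw [Cmd.sem, e]
      have hI' : I ((s'.setNat 7 0 0 v).setNat 6 t 0 v) := h6 _ _ _ (h7 _ _ hI)
      refine ⟨sem_forTuples I h6 h7 hp t hI', fun t' ht' => ?_, fun hlt => ?_⟩
      · rw [forTuples_tuple hp6 t (by omega), Store.setNat_nat, if_neg (by omega),
          Store.setNat_nat, if_neg (by simp), hT t' ht']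
      · by_cases hv' : (ρ ⟨t, ht⟩ : ℕ) < v
        · exact sem_forTuples A hA6 hA7 hAp t (hA6 _ _ _ (hA7 _ _ (hA hv')))
        · refine ih (by omega) hI' fun t' ht' => ?_
          by_cases htt : (t' : ℕ) = t
          · have hv'' : (ρ ⟨t, ht⟩ : ℕ) = v := by omega
            have : t' = ⟨t, ht⟩ := Fin.ext htt
            rw [this, hv'']
            simp
          · rw [Store.setNat_nat, if_neg (by omega), Store.setNat_nat, if_neg (by simp),
              hT t' (by omega)]

end Tuples

variable {s : Store} {m n r : ℕ} {ρ : Fin r → Fin m}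

/-- A facet row that is not constant on types. -/
def Essential (S : Fin m → Fin n → ℝ) (ρ : Fin r → Fin m) (i : Fin m) : Prop :=
  FacetRow S i ∧ ¬ TypeConst S ρ (S i)

/-- The special rows and the separation describe a product; if `b` is true, a proper one. -/
structure Describes (b : Bool) (S : Fin m → Fin n → ℝ) (ρ : Fin r → Fin m) (X : Set (Fin m)) :
    Prop where
  special : SpecialRows S ρ
  separates : Separates S ρ X
  proper : b = true → (∃ i ∈ X, Essential S ρ i) ∧ ∃ i ∉ X, Essential S ρ i

/-- The matrices called `1` and `2` are slack matrices of the factors of a product. -/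
def Solved (s : Store) (r : ℕ) (b : Bool) (S : Fin m → Fin n → ℝ) : Prop :=
  ∃ (ρ : Fin r → Fin m) (X : Set (Fin m)), Describes b S ρ X ∧
    Lists s 1 (factorMatrix S ρ X) ∧ Lists s 2 (factorMatrix S ρ Xᶜ)

theorem Solved.congr {s s' : Store} {b : Bool} {S : Fin m → Fin n → ℝ} (h : Solved s r b S)
    (hn : ∀ out, out = 1 ∨ out = 2 → s'.nat out = s.nat out)
    (hr : ∀ out, out = 1 ∨ out = 2 → s'.real out = s.real out) : Solved s' r b S := by
  obtain ⟨ρ, X, h1, h2, h3⟩ := h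
  exact ⟨ρ, X, h1, h2.congr (hn 1 (Or.inl rfl)) (hr 1 (Or.inl rfl)),
    h3.congr (hn 2 (Or.inr rfl)) (hr 2 (Or.inr rfl))⟩

theorem sem_report (h : s.Holds n ρ) :
    Lists ((report r).sem s) 1 (factorMatrix (s.view 0 m n) ρ (component s m)) ∧
    Lists ((report r).sem s) 2 (factorMatrix (s.view 0 m n) ρ (component s m)ᶜ) ∧
    ((report r).sem s).nat 3 0 0 ≠ 0 := by
  set s₁ := (factor r 16 (inComponent 12)).sem s with hs₁
  set s₂ := (factor r 17 (not (inComponent 12))).sem s₁ with hs₂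
  set s₃ := (copy 16 1).sem s₂ with hs₃
  set s₄ := (copy 17 2).sem s₃ with hs₄
  have hfin : (report r).sem s = s₄.setNat 3 0 0 1 := rfl
  have v16 : s₁.view 16 (m + 1) n = factorMatrix (s.view 0 m n) ρ (component s m) := by
    refine sem_factor h fun i j => ?_
    simp [inComponent, component, entry, Store.setNat_nat, h.rows]
  have h₁ : s₁.Holds n ρ := h.congr (Cmd.sem_nat (by simp [factor, Cmd.NatFree]) _)
    (Cmd.sem_nat (by simp [factor, Cmd.NatFree]) _)
  have v0 : s₁.view 0 m n = s.view 0 m n := Cmd.view_eq (by simp [factor, Cmd.RealFree]) _ _ _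
  have hn₁ : s₁.nat = s.nat := rfl
  have hr₁ : s₁.real 5 = s.real 5 := Cmd.sem_real (by simp [factor, Cmd.RealFree]) _
  have v17 : s₂.view 17 (m + 1) n = factorMatrix (s.view 0 m n) ρ (component s m)ᶜ := by
    rw [← v0]
    refine sem_factor h₁ fun i j => ?_
    simp [inComponent, component, entry, Store.setNat_nat, h.rows, hn₁, hr₁]
  have v16₂ : s₂.view 16 (m + 1) n = s₁.view 16 (m + 1) n :=
    Cmd.view_eq (by simp [factor, Cmd.RealFree]) _ _ _
  have v17₃ : s₃.view 17 (m + 1) n = s₂.view 17 (m + 1) n :=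
    Cmd.view_eq (by simp [copy, Cmd.RealFree]) _ _ _
  have hn₂ : s₂.nat = s.nat := rfl
  have hn₃ : s₃.nat 0 = s.nat 0 := Cmd.sem_nat (c := copy 16 1) (by simp [copy, Cmd.NatFree]) s₂
  have l1 := sem_copy (s := s₂) (m := m) (n := n) (f := 16) (out := 1) (by rw [hn₂, h.rows])
    (by rw [hn₂, h.cols]) (by decide)
  have l2 := sem_copy (s := s₃) (m := m) (n := n) (f := 17) (out := 2) (by rw [hn₃, h.rows])
    (by rw [hn₃, h.cols]) (by decide)
  rw [v16₂, v16] at l1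
  rw [v17₃, v17] at l2
  rw [hfin]
  refine ⟨l1.congr ?_ ?_, l2.congr ?_ ?_, by simp⟩
  · rw [Store.setNat_nat_of_ne _ (by decide), hs₄, Cmd.sem_nat (by simp [copy, Cmd.NatFree])]
  · rw [Store.setNat_real, hs₄, Cmd.sem_real (by simp [copy, Cmd.RealFree])]
  · rw [Store.setNat_nat_of_ne _ (by decide)]
  · rw [Store.setNat_real]

/-- The first solution found is kept: later tuples must not overwrite it. -/
theorem sem_body_of_accepts {b : Bool} (h3 : s.nat 3 0 0 ≠ 0) : (body r b).sem s = s := by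
  rw [body, Cmd.sem, if_neg]
  rw [eval_and]
  exact fun h => h3 h.1

theorem body_natFree {b : Bool} {name : ℕ} (h : name ∉ ({1, 2, 3, 8, 9, 10, 11} : Finset ℕ)) :
    (body r b).NatFree name := by
  simp only [Finset.mem_insert, Finset.mem_singleton, not_or] at h
  simp [body, analyze, reduce, eliminate, connect, pick, report, factor, copy, Cmd.NatFree, h]

theorem body_realFree {b : Bool} : (body r b).RealFree 0 := by
  simp [body, analyze, reduce, eliminate, connect, pick, report, factor, copy, Cmd.RealFree]

theorem analyze_natFree {name : ℕ} (h : name ∉ ({8, 9, 10, 11} : Finset ℕ)) :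
    (analyze r).NatFree name := by
  simp only [Finset.mem_insert, Finset.mem_singleton, not_or] at h
  simp [analyze, reduce, eliminate, connect, pick, Cmd.NatFree, h]

theorem sem_body {b : Bool} (hm : s.nat 0 0 0 = m) (hn : s.nat 0 0 1 = n) (h3 : s.nat 3 0 0 = 0) :
    (((body r b).sem s).nat 3 0 0 ≠ 0 → Solved ((body r b).sem s) r b (s.view 0 m n)) ∧
    ∀ (ρ : Fin r → Fin m) (X : Set (Fin m)), (∀ t : Fin r, s.nat 6 t 0 = ρ t) →
      Describes b (s.view 0 m n) ρ X → ((body r b).sem s).nat 3 0 0 ≠ 0 := by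
  have e0 : (natEq (natLoad 3 (const 0) (const 0)) (const 0)).eval s := h3
  by_cases hR : (inRange r).eval s
  · rw [eval_inRange hm] at hR
    obtain ⟨ρ, hρ⟩ : ∃ ρ : Fin r → Fin m, ∀ t : Fin r, s.nat 6 t 0 = ρ t :=
      ⟨fun t => ⟨_, hR t t.2⟩, fun t => rfl⟩
    have hH : s.Holds n ρ := ⟨hm, hn, hρ⟩
    by_cases hsp : SpecialRows (s.view 0 m n) ρ
    · have hguard : (and (natEq (natLoad 3 (const 0) (const 0)) (const 0))
          (and (inRange r) (isSpecial r))).eval s := by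
        rw [eval_and, eval_and, eval_inRange hm, eval_isSpecial hH]
        exact ⟨e0, hR, hsp⟩
      rw [body, Cmd.sem, if_pos hguard, Cmd.sem, Cmd.sem]
      obtain ⟨a1, a2, a3⟩ := sem_analyze hH
      have hH' : ((analyze r).sem s).Holds n ρ :=
        hH.congr (Cmd.sem_nat (analyze_natFree (by decide)) _)
          (Cmd.sem_nat (analyze_natFree (by decide)) _)
      have v0 : ((analyze r).sem s).view 0 m n = s.view 0 m n :=
        Cmd.view_eq (by simp [analyze, reduce, eliminate, connect, pick, Cmd.RealFree]) _ _ _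
      have h3' : ((analyze r).sem s).nat 3 0 0 = 0 := by
        rw [Cmd.sem_nat (analyze_natFree (by decide)), h3]
      by_cases hg : (isGood b).eval ((analyze r).sem s)
      · rw [if_pos hg]
        obtain ⟨r1, r2, r3⟩ := sem_report hH'
        rw [v0] at r1 r2
        refine ⟨fun _ => ⟨ρ, _, ⟨hsp, a1, fun hb => ?_⟩, r1, r2⟩, fun _ _ _ _ => r3⟩
        rw [hb] at hg
        exact a2 hg
      · rw [if_neg hg]
        refine ⟨fun h => absurd h3' h, fun ρ' X hρ' hD => absurd ?_ hg⟩
        have : ρ' = ρ := funext fun t => Fin.ext (by rw [← hρ, hρ'])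
        subst this
        cases b with
        -- If properness is not demanded, the test is trivially true: every special tuple with the
        -- separator found is reported.
        | false => rfl
        | true => exact a3 X hD.separates (hD.proper rfl).1 (hD.proper rfl).2
    · rw [body, Cmd.sem, if_neg]
      · refine ⟨fun h => absurd h3 h, fun ρ' X hρ' hD => absurd hD.special ?_⟩
        have : ρ' = ρ := funext fun t => Fin.ext (by rw [← hρ, hρ'])
        rwa [this]
      · rw [eval_and, eval_and, eval_isSpecial hH]
        exact fun h => hsp h.2.2
  · rw [body, Cmd.sem, if_neg]
    · refine ⟨fun h => absurd h3 h, fun ρ' X hρ' hD => absurd ?_ hR⟩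
      rw [eval_inRange hm]
      intro t ht
      rw [hρ' ⟨t, ht⟩]
      exact (ρ' _).2
    · rw [eval_and, eval_and]
      exact fun h => hR h.2.1

/-- The command that recognizes products. -/
def recognize (r : ℕ) (b : Bool) : Cmd := forTuples (body r b) r

theorem sem_recognize {b : Bool} (hm : s.nat 0 0 0 = m) (hn : s.nat 0 0 1 = n)
    (h3 : s.nat 3 0 0 = 0) :
    (((recognize r b).sem s).nat 3 0 0 ≠ 0 → Solved ((recognize r b).sem s) r b (s.view 0 m n)) ∧
    ((∃ (ρ : Fin r → Fin m) (X : Set (Fin m)), Describes b (s.view 0 m n) ρ X) →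
      ((recognize r b).sem s).nat 3 0 0 ≠ 0) := by
  set S := s.view 0 m n with hS
  -- The input stays intact, and an accepting memory already contains a solution.
  let I : Store → Prop := fun s' => s'.nat 0 0 0 = m ∧ s'.nat 0 0 1 = n ∧ s'.view 0 m n = S ∧
    (s'.nat 3 0 0 ≠ 0 → Solved s' r b S)
  have hset : ∀ name, name = 6 ∨ name = 7 → ∀ s' i v, I s' → I (s'.setNat name i 0 v) := by
    rintro name hname s' i v ⟨h1, h2, h3, h4⟩
    have hne : ∀ c < 6, (s'.setNat name i 0 v).nat c = s'.nat c := fun c hc =>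
      Store.setNat_nat_of_ne _ (by omega) _ _ _
    refine ⟨by rw [hne 0 (by decide), h1], by rw [hne 0 (by decide), h2], h3, fun h => ?_⟩
    rw [hne 3 (by decide)] at h
    exact (h4 h).congr (fun out ho => hne out (by omega)) fun out ho => rfl
  have hbody : ∀ s', I s' → I ((body r b).sem s') := by
    rintro s' ⟨h1, h2, h3, h4⟩
    by_cases h : s'.nat 3 0 0 = 0
    · refine ⟨?_, ?_, ?_, ?_⟩
      · rw [Cmd.sem_nat (body_natFree (by decide)), h1]
      · rw [Cmd.sem_nat (body_natFree (by decide)), h2]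
      · rw [Cmd.view_eq body_realFree, h3]
      · rw [← h3]
        exact (sem_body h1 h2 h).1
    · rw [sem_body_of_accepts h]
      exact ⟨h1, h2, h3, h4⟩
  have hI : I s := ⟨hm, hn, rfl, fun h => absurd h3 h⟩
  refine ⟨(sem_forTuples I (fun s t v => hset 6 (Or.inl rfl) s t v)
    (fun s v => hset 7 (Or.inr rfl) s 0 v) hbody r hI).2.2.2, ?_⟩
  rintro ⟨ρ, X, hD⟩
  refine sem_forTuples_hit (I := I) (A := fun s => s.nat 3 0 0 ≠ 0) (m := m) (ρ := ρ)
    (fun s t v => hset 6 (Or.inl rfl) s t v) (fun s v => hset 7 (Or.inr rfl) s 0 v) hbody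
    (fun s t v h => ?_) (fun s v h => ?_) (fun s h => ?_) (body_natFree (by decide))
    (fun s h => h.1) (fun s' hI' hρ' => ?_) le_rfl hI fun t ht => absurd ht (by omega)
  · rwa [Store.setNat_nat_of_ne _ (by decide)]
  · rwa [Store.setNat_nat_of_ne _ (by decide)]
  · rwa [sem_body_of_accepts h]
  · by_cases h : s'.nat 3 0 0 = 0
    · refine (sem_body hI'.1 hI'.2.1 h).2 ρ X hρ' ?_
      rw [hI'.2.2.1]
      exact hD
    · rwa [sem_body_of_accepts h]

/-- Names from 40 on are thus free as scratch space, for every `r`: the tuple sits in one array, and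
all its loops share the register 7. -/
theorem recognize_wf (r : ℕ) (b : Bool) : (recognize r b).WF 40 := by
  have hb : (body r b).WF 40 := by
    cases b <;> simp [body, isGood, isDisconnected, isNonzeroRow, inComponent, tt, inRange,
      isSpecial, isFacetRow, analyze, reduce, eliminate, connect, pick, report, factor, copy, isNew,
      touches, specialEntry, specialRow, isSameType, entry, eq0, Cmd.WF, Tm.WF, var, ne0, ex, all,
      find, imp, Tm.or]
  have : ∀ t, (forTuples (body r b) t).WF 40 := by
    intro t
    induction t with
    | zero => exact hb
    | succ t ih =>
      exact ⟨by decide, by decide, ⟨by decide, by decide, by simp [var, Tm.WF]⟩, ih⟩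
  exact this r

end Recognition
end RealRAM

/-! ### The main theorem -/

namespace GluedProduct

open RealRAM RealRAM.Recognition

theorem isSlackMatrix_matrix {s : Store} {out a N d : ℕ} {P : Set (Fin d → ℝ)}
    (hr : s.rows out = a) (hc : s.cols out = N) (h : IsSlackMatrix (Matrix.of (s.view out a N)) P) :
    IsSlackMatrix (s.matrix out) P := by
  subst hr hc
  exact h

theorem gluedProduct_nonempty {r d₁ d₂ : ℕ} {c₁ : Fin r → Fin d₁} {c₂ : Fin r → Fin d₂}
    {P₁ : Set (Fin d₁ → ℝ)} {P₂ : Set (Fin d₂ → ℝ)} (h₁ : IsSimplicialFactor c₁ P₁)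
    (h₂ : IsSimplicialFactor c₂ P₂) : (gluedProduct c₁ c₂ P₁ P₂).Nonempty := by
  obtain ⟨x, hx, hxt⟩ := h₁.exists_vertex none
  obtain ⟨y, hy, hyt⟩ := h₂.exists_vertex none
  exact ⟨(x, y), subset_convexHull ℝ _ ⟨hx, hy, fun i => (hxt i).trans (hyt i).symm⟩⟩

/-- If the factors are described by special rows and separations, the notion is recognizable. -/
theorem polyTimeRecognizable_of_describes (R : ProductNotion) (r : ℕ) (b : Bool)
    (hsound : ∀ {m n d : ℕ} {v : Fin n → Fin d → ℝ} {σ : Fin m → (Fin d → ℝ) →ᵃ[ℝ] ℝ},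
      IsSlackSystem v σ → Nonempty (Fin n) → ∀ (ρ : Fin r → Fin m) (X : Set (Fin m)),
      Describes b (slack v σ) ρ X → R (m + 1) (m + 1) (factorPolytope (slack v σ) ρ X)
        (factorPolytope (slack v σ) ρ Xᶜ) (gluedProduct (specialCoord ρ) (specialCoord ρ)
          (factorPolytope (slack v σ) ρ X) (factorPolytope (slack v σ) ρ Xᶜ)))
    (hcomplete : ∀ {d₁ d₂ : ℕ} {P₁ : Set (Fin d₁ → ℝ)} {P₂ : Set (Fin d₂ → ℝ)}
      {Q : Set ((Fin d₁ → ℝ) × (Fin d₂ → ℝ))}, R d₁ d₂ P₁ P₂ Q →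
      ∃ (c₁ : Fin r → Fin d₁) (c₂ : Fin r → Fin d₂), IsSimplicialFactor c₁ P₁ ∧
        IsSimplicialFactor c₂ P₂ ∧ Q = gluedProduct c₁ c₂ P₁ P₂ ∧
        (b = true → ¬ IsSimplex r P₁ ∧ ¬ IsSimplex r P₂)) :
    PolyTimeRecognizable R := by
  obtain ⟨C, hC⟩ := (recognize r b).implements_compile (d := 40) (by decide) (recognize_wf r b)
  refine ⟨(recognize r b).compile 40,
    -- `C` bounds the running time and the second summand the output: each factor matrix has `m + 1`
    -- rows and at most `n` columns.
    C + 2 * ((Polynomial.X + 1) * Polynomial.X), fun m n d S P hSP => ?_⟩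
  obtain ⟨s', t, hexec, ht, hag⟩ := hC (Store.init S)
  obtain ⟨v, σ, hsys, rfl, rfl⟩ := hSP.exists_slackSystem
  set s := Store.init (slack v σ) with hs
  have hm : s.nat 0 0 0 = m := by simp [hs, Store.init]
  have hn : s.nat 0 0 1 = n := by simp [hs, Store.init]
  have h3 : s.nat 3 0 0 = 0 := by simp [hs, Store.init]
  have hview : s.view 0 m n = slack v σ := by
    funext i j
    simp [hs, Store.init, Store.view]
  have hsize : s.size = m + n := by simp [Store.size, hm, hn]
  obtain ⟨hsol, hacc⟩ := sem_recognize (r := r) (b := b) hm hn h3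
  rw [hview] at hsol hacc
  have hacc' : s'.Accepts ↔ ((recognize r b).sem s).nat 3 0 0 ≠ 0 := by
    rw [Store.Accepts, ← hag.nat 3 (by decide)]
  have hout : s'.Accepts → s'.rows 1 * s'.cols 1 + s'.rows 2 * s'.cols 2 ≤
      2 * ((m + n + 1) * (m + n)) ∧
      ∃ (d₁ d₂ : ℕ) (P₁ : Set (Fin d₁ → ℝ)) (P₂ : Set (Fin d₂ → ℝ))
        (Q : Set ((Fin d₁ → ℝ) × (Fin d₂ → ℝ))),
        R d₁ d₂ P₁ P₂ Q ∧ AffinelyIsomorphic (convexHull ℝ (range v)) Q ∧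
        IsSlackMatrix (s'.matrix 1) P₁ ∧ IsSlackMatrix (s'.matrix 2) P₂ := by
    intro ha
    obtain ⟨ρ, X, hD, hl₁, hl₂⟩ := (hsol (hacc'.1 ha)).congr (s' := s')
      (fun out ho => (hag.nat out (by omega)).symm) fun out ho => (hag.real out (by omega)).symm
    obtain ⟨j₀, -⟩ := hD.special.base
    have hne : Nonempty (Fin n) := ⟨j₀⟩
    have hlist : ∀ (out : ℕ) (Y : Set (Fin m)), Separates (slack v σ) ρ Y →
        Lists s' out (factorMatrix (slack v σ) ρ Y) → s'.rows out * s'.cols out ≤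
          (m + n + 1) * (m + n) ∧
        IsSlackMatrix (s'.matrix out) (factorPolytope (slack v σ) ρ Y) := by
      rintro out Y hY ⟨N, e, hN, hr, hc, hF, hinj, hsurj⟩
      refine ⟨?_, ?_⟩
      · rw [hr, hc]
        exact Nat.mul_le_mul (by omega) (by omega)
      · have key : IsSlackMatrix (Matrix.of fun i j => factorMatrix (slack v σ) ρ Y i (e j))
            (factorPolytope (slack v σ) ρ Y) := by
          refine isSlackMatrix_factor hsys hD.special hY (fun c c' h => hinj c c' (congrFun h)) ?_
          refine Subset.antisymm (range_comp_subset_range _ _) ?_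
          rintro _ ⟨j, rfl⟩
          obtain ⟨c, hc⟩ := hsurj j
          exact ⟨c, funext fun i => (hc i).symm⟩
        rw [← hF] at key
        exact isSlackMatrix_matrix hr hc key
    obtain ⟨b₁, k₁⟩ := hlist 1 X hD.separates hl₁
    obtain ⟨b₂, k₂⟩ := hlist 2 Xᶜ hD.separates.compl hl₂
    exact ⟨by omega, _, _, _, _, _, hsound hsys hne ρ X hD,
      affinelyIsomorphic_gluedProduct hsys hD.special hD.separates, k₁, k₂⟩
  refine ⟨s', t, hexec, ?_, ?_, fun ha => ⟨?_, (hout ha).2⟩⟩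
  · rw [hsize] at ht
    rw [Polynomial.eval_add]
    omega
  · constructor
    · intro ha
      obtain ⟨-, d₁, d₂, P₁, P₂, Q, h1, h2, -, -⟩ := hout ha
      exact ⟨d₁, d₂, P₁, P₂, Q, h1, h2⟩
    · rintro ⟨d₁, d₂, P₁, P₂, Q, hR, hiso⟩
      rw [hacc']
      obtain ⟨c₁, c₂, hf₁, hf₂, rfl, hp⟩ := hcomplete hR
      have hne : Nonempty (Fin n) := by
        obtain ⟨f, hf⟩ := hiso
        obtain ⟨z, hz⟩ := gluedProduct_nonempty hf₁ hf₂
        obtain ⟨x, hx, -⟩ := hf.surjOn hz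
        obtain ⟨_, j, -⟩ := convexHull_nonempty_iff.1 ⟨x, hx⟩
        exact ⟨j⟩
      obtain ⟨ρ, X, h1, h2, h3, h4⟩ := exists_separates hsys hf₁ hf₂ hiso
      exact hacc ⟨ρ, X, h1, h2, fun hb => ⟨h3 (hp hb).1, h4 (hp hb).2⟩⟩
  · refine (hout ha).1.trans ?_
    simp only [Polynomial.eval_add, Polynomial.eval_mul, Polynomial.eval_X, Polynomial.eval_one,
      Polynomial.eval_ofNat]
    omega

/-- For `k ≥ 2` each factor has vertices over different vertices of the simplex, so the dimension
condition is automatic and any special rows with any separator give a product. -/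
theorem polyTimeRecognizable_simplicial {k : ℕ} (hk : 2 ≤ k) :
    PolyTimeRecognizable (SimplicialGluedProduct k) := by
  refine polyTimeRecognizable_of_describes _ (k - 1) false ?_ ?_
  · intro m n d v σ hsys hne ρ X hD
    exact ⟨one_le_dim_factorPolytope hD.special (by omega),
      one_le_dim_factorPolytope hD.special (by omega), specialCoord ρ, specialCoord ρ,
      isSimplicialFactor_factorPolytope hsys hD.special,
      isSimplicialFactor_factorPolytope hsys hD.special, rfl⟩
  · rintro d₁ d₂ P₁ P₂ Q ⟨-, -, c₁, c₂, h₁, h₂, h⟩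
    exact ⟨c₁, c₂, h₁, h₂, h, fun h => absurd h (by decide)⟩

theorem properSimplicialGluedProduct_of_describes {k m n d : ℕ} {v : Fin n → Fin d → ℝ}
    {σ : Fin m → (Fin d → ℝ) →ᵃ[ℝ] ℝ} (hsys : IsSlackSystem v σ) (hne : Nonempty (Fin n))
    (ρ : Fin (k - 1) → Fin m) (X : Set (Fin m)) (hD : Describes true (slack v σ) ρ X) :
    ProperSimplicialGluedProduct k (m + 1) (m + 1) (factorPolytope (slack v σ) ρ X)
      (factorPolytope (slack v σ) ρ Xᶜ) (gluedProduct (specialCoord ρ) (specialCoord ρ)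
        (factorPolytope (slack v σ) ρ X) (factorPolytope (slack v σ) ρ Xᶜ)) := by
  obtain ⟨⟨i, hi, hF, hc⟩, i', hi', hF', hc'⟩ := hD.proper rfl
  exact ⟨⟨one_le_dim_factorPolytope_of_not_typeConst hD.special hi hF hc,
    one_le_dim_factorPolytope_of_not_typeConst hD.special hi' hF' hc',
    specialCoord ρ, specialCoord ρ, isSimplicialFactor_factorPolytope hsys hD.special,
    isSimplicialFactor_factorPolytope hsys hD.special, rfl⟩,
    not_isSimplex_factorPolytope hD.special hi hF hc,
    not_isSimplex_factorPolytope hD.special hi' hF' hc'⟩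

theorem polyTimeRecognizable_proper (k : ℕ) :
    PolyTimeRecognizable (ProperSimplicialGluedProduct k) := by
  refine polyTimeRecognizable_of_describes _ (k - 1) true ?_ ?_
  · intro m n d v σ hsys hne ρ X hD
    exact properSimplicialGluedProduct_of_describes hsys hne ρ X hD
  · rintro d₁ d₂ P₁ P₂ Q ⟨⟨-, -, c₁, c₂, h₁, h₂, h⟩, hs₁, hs₂⟩
    exact ⟨c₁, c₂, h₁, h₂, h, fun _ => ⟨hs₁, hs₂⟩⟩

theorem not_isSimplex_zero {E : Type*} [AddCommGroup E] [Module ℝ E] {P : Set E}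
    (h : 1 ≤ dim P) : ¬ IsSimplex 0 P := by
  rintro ⟨s, rfl⟩
  have : range s.points = {s.points 0} := by
    ext x
    simp [Fin.exists_fin_one, eq_comm]
  rw [dim, this, convexHull_singleton, vectorSpan_singleton, finrank_bot] at h
  omega

/-- A polytope of positive dimension is not a point, so for `k = 1` all products are proper. -/
theorem polyTimeRecognizable_simplicial_one :
    PolyTimeRecognizable (SimplicialGluedProduct 1) := by
  have : SimplicialGluedProduct 1 = ProperSimplicialGluedProduct 1 := by
    funext d₁ d₂ P₁ P₂ Q
    refine propext ⟨fun h => ⟨h, ?_, ?_⟩, fun h => h.1⟩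
    · exact not_isSimplex_zero h.1
    · exact not_isSimplex_zero h.2.1
  rw [this]
  exact polyTimeRecognizable_proper 1

theorem IsPolytope.isSimplicialFactor {d : ℕ} {P : Set (Fin d → ℝ)} (h : IsPolytope P)
    (c : Fin 0 → Fin d) : IsSimplicialFactor c P where
  polytope := h
  projection := by
    obtain ⟨V, -, ⟨x, hx⟩, rfl⟩ := h
    have h1 : (fun (x : Fin d → ℝ) (i : Fin 0) => x (c i)) '' convexHull ℝ V = {0} := by
      refine Subset.antisymm (fun _ _ => Subsingleton.elim _ _) ?_
      rintro _ rfl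
      exact ⟨x, subset_convexHull ℝ _ hx, Subsingleton.elim _ _⟩
    have h2 : insert (0 : Fin 0 → ℝ) (range fun i : Fin 0 => (Pi.single i 1 : Fin 0 → ℝ)) = {0} := by
      simp
    rw [h1, h2, convexHull_singleton]
  zero_one := fun _ _ i => i.elim0
  facet := fun i => i.elim0

/-- There are no coordinates to match, so all pairs of vertices are allowed, and convex hulls
commute with products. -/
theorem gluedProduct_zero {d₁ d₂ : ℕ} (c₁ : Fin 0 → Fin d₁) (c₂ : Fin 0 → Fin d₂)
    {P₁ : Set (Fin d₁ → ℝ)} {P₂ : Set (Fin d₂ → ℝ)} (h₁ : IsPolytope P₁) (h₂ : IsPolytope P₂) :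
    gluedProduct c₁ c₂ P₁ P₂ = P₁ ×ˢ P₂ := by
  have : {z : (Fin d₁ → ℝ) × (Fin d₂ → ℝ) | z.1 ∈ P₁.extremePoints ℝ ∧ z.2 ∈ P₂.extremePoints ℝ ∧
      ∀ i, z.1 (c₁ i) = z.2 (c₂ i)} = P₁.extremePoints ℝ ×ˢ P₂.extremePoints ℝ := by
    ext z
    simp [mem_prod]
  rw [gluedProduct, this, convexHull_prod, h₁.convexHull_extremePoints, h₂.convexHull_extremePoints]

theorem polyTimeRecognizable_cartesian : PolyTimeRecognizable CartesianProduct := by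
  refine polyTimeRecognizable_of_describes _ 0 true ?_ ?_
  · intro m n d v σ hsys hne ρ X hD
    obtain ⟨⟨h1, h2, c₁, c₂, h₁, h₂, h⟩, -, -⟩ :=
      properSimplicialGluedProduct_of_describes (k := 1) hsys hne ρ X hD
    exact ⟨h₁.polytope, h₂.polytope, h1, h2, gluedProduct_zero _ _ h₁.polytope h₂.polytope⟩
  · rintro d₁ d₂ P₁ P₂ Q ⟨h₁, h₂, hd₁, hd₂, rfl⟩
    exact ⟨Fin.elim0, Fin.elim0, h₁.isSimplicialFactor _, h₂.isSimplicialFactor _,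
      (gluedProduct_zero _ _ h₁ h₂).symm, fun _ => ⟨not_isSimplex_zero hd₁, not_isSimplex_zero hd₂⟩⟩

end GluedProduct

theorem theorem2 :
    (∀ k : ℕ, 1 ≤ k →
      GluedProduct.PolyTimeRecognizable (GluedProduct.SimplicialGluedProduct k) ∧
      GluedProduct.PolyTimeRecognizable (GluedProduct.ProperSimplicialGluedProduct k)) ∧
    GluedProduct.PolyTimeRecognizable GluedProduct.CartesianProduct := by
  refine ⟨fun k hk => ⟨?_, GluedProduct.polyTimeRecognizable_proper k⟩,
    GluedProduct.polyTimeRecognizable_cartesian⟩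
  rcases hk.eq_or_lt with rfl | hk
  · exact GluedProduct.polyTimeRecognizable_simplicial_one
  · exact GluedProduct.polyTimeRecognizable_simplicial hk
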